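/- **Setting.** Let $M>0$. On the space of variables $z=(\tau,t,r,\phi,\sigma,v,\omega)$ with $r>2M$ put $E=(1-2M/r)\sigma$, $L=r^2\omega$, and restrict to states of timelike equatorial Schwarzschild geodesics, $-\frac{r-2M}{r}\sigma^2+\frac{r}{r-2M}v^2+r^2\omega^2=-1$. Let $D_\tau$ be the total derivative $\partial_\tau+\sigma\partial_t+v\partial_r+\omega\partial_\phi+\dot\sigma\partial_\sigma+\dot v\partial_v+\dot\omega\partial_\omega$ with $$\dot\sigma=-\tfrac{2M}{r(r-2M)}\sigma v,\quad \dot v=-\tfrac{M(r-2M)}{r^3}\sigma^2+\tfrac{M}{r(r-2M)}v^2+(r-2M)\omega^2,\quad \dot\omega=-\tfrac2r v\omega .$$ Write $v(y;E,L)=\operatorname{sgn}(v)\sqrt{E^2-(1-2M/y)(1+L^2/y^2)}$. Let $r_0=r_0(E,L)$ be a distinguished radial point, chosen continuously for $(E,L)$ in an open set $U\subset\mathbb R^2$, of one of three kinds: * *turning point*: $r_0>2M$ is a simple root of $(E^2-1)r_0^3+2Mr_0^2-L^2r_0+2ML^2=0$; * *horizon point*: $r_0=2M$; * *centripetal point*: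 $r_0>0$ is a root of $Mr_0^2-L^2r_0+3L^2M=0$. Consider states with $(E,L)\in U$ such that $v(y;E,L)^2>0$ for every $y$ between $r_0$ and $r$, endpoints included, with the sole exception of $y=r_0$ for a turning point (where $r\neq r_0$). Call this set of states $\Omega$. On it define $$\Phi=\phi-L\int_{r_0}^r\frac{dy}{y^2v(y)},\qquad T=t-E\int_{r_0}^r\frac{y\,dy}{(y-2M)v(y)},\qquad \mathcal T=\tau-\int_{r_0}^r\frac{dy}{v(y)} .$$ For a horizon point the integral in $T$ diverges logarithmically; it (and the one in $t^\dagger$ below) denotes the Hadamard finite part $\lim_{\delta\to0^+}\bigl(\int_{2M+\delta}^r\frac{y\,dy}{(y-2M)v(y)}+\frac{2M}{v(2M)}\ln\frac{\delta}{2M}\bigr)$. All the other integrals converge. **Generator.** A function $C(\tau,t,r,\phi,\sigma,v,\omega)$ defines $\hat X_{(C)}=P^t\partial_t+P^r\partial_r+P^\phi\partial_\phi$ with $P^t=-\frac{r}{r-2M}C_\sigma+\sigma S(C)$, $P^r=\frac{r-2M}{r}C_v+vS(C)$, $P^\phi=r^{-2}C_\omega+\omega S(C)$, $S=\sigma\partial_\sigma+v\partial_v+\omega\partial_\omega$,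 its prolongation $\mathrm{pr}\hat X_{(C)}=\hat X_{(C)}+(D_\tau P^t)\partial_\sigma+(D_\tau P^r)\partial_v+(D_\tau P^\phi)\partial_\omega$, and the equivalent generator $\mathrm{pr}\hat Y_{(C)}=-\frac{P^r}{v}D_\tau+\mathrm{pr}\hat X_{(C)}$, which leaves $r$ invariant. Take $C=\mathcal T$ (regarded as a function of these variables, with $E,L$ as above); it is twice continuously differentiable near each state in $\Omega$. **Theorem.** For a state $z\in\Omega$ put $L^\dagger=Le^\varepsilon$, $E^\dagger=Ee^\varepsilon$, $r_0^\dagger=r_0(E^\dagger,L^\dagger)$, $v^\dagger(y)=v(y;E^\dagger,L^\dagger)$ (with the same sign $\operatorname{sgn}(v)$), and $$\tau^\dagger=\mathcal T+\int_{r_0^\dagger}^r\frac{dy}{v^\dagger(y)},\quad t^\dagger=T^\dagger+Ee^\varepsilon\int_{r_0^\dagger}^r\frac{y\,dy}{(y-2M)v^\dagger(y)},\quad r^\dagger=r,\quad \phi^\dagger=\Phi^\dagger+Le^\varepsilon\int_{r_0^\dagger}^r\frac{dy}{y^2v^\dagger(y)},$$ $$\sigma^\dagger=(1-2M/r)^{-1}Ee^\varepsilon,\quad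 v^\dagger=v^\dagger(r)=\operatorname{sgn}(v)\sqrt{E^2e^{2\varepsilon}-(1-2M/r)(1+L^2e^{2\varepsilon}/r^2)},\quad \omega^\dagger=r^{-2}Le^\varepsilon,$$ where $\Phi^\dagger=\Phi$, $T^\dagger=T$ for a turning or horizon point, while for a centripetal point $$\Phi^\dagger=\Phi+\int_0^\varepsilon C_{\mathcal T,\Phi}(Ee^{s},Le^{s})\,ds,\qquad T^\dagger=T+\int_0^\varepsilon C_{\mathcal T,T}(Ee^{s},Le^{s})\,ds,$$ $$C_{\mathcal T,\Phi}=\frac{(1-3u_0)(1+\bar L^2(u_0-1)^2)}{\bar L(3u_0-2)(u_0-1)\nu_0},\quad C_{\mathcal T,T}=\frac{2ME(1-3u_0)}{(3u_0-2)(u_0-1)u_0\nu_0},\quad \bar L=\frac{L}{2M},\ u_0=1-\frac{2M}{r_0},\ \nu_0=v(r_0;E,L).$$ Let $I_z$ be the set of $\varepsilon$ such that, for all $s$ between $0$ and $\varepsilon$, the conditions defining $\Omega$ (membership in $U$, and positivity of $v^2$ between the distinguished point and $r$) hold for $(r,Ee^s,Le^s)$. Then: 1. $I_z$ is an open interval containing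 $0$; the transformation $z\mapsto z^\dagger$ maps into $\Omega$, is the identity at $\varepsilon=0$, and obeys the local group law: if $\varepsilon\in I_z$ and $\eta\in I_{z^\dagger(\varepsilon)}$, then $\varepsilon+\eta\in I_z$ and $(z^\dagger(\varepsilon))^\dagger(\eta)=z^\dagger(\varepsilon+\eta)$. 2. It is the transformation group generated by $\mathrm{pr}\hat Y_{(\mathcal T)}$: on $I_z$ the curve $\varepsilon\mapsto z^\dagger(\varepsilon)$ is an integral curve of $\mathrm{pr}\hat Y_{(\mathcal T)}$, and every integral curve in $\Omega$ starting at $z$ is a restriction of it. It maps geodesics to geodesics, up to the change of parameter $d\tau^\dagger/d\tau=v/v^\dagger$. 3. $L$ and $E$ are scaled, $L(z^\dagger)=Le^\varepsilon$, $E(z^\dagger)=Ee^\varepsilon$, so that $L/E$ is preserved ($E\ne0$), and $\mathcal T(z^\dagger)=\mathcal T(z)$. 4. For a turning or horizon point, $\Phi$ and $T$ are invariant. For a horizon point $r_0$ is invariant as well; for a turning point $r_0^\dagger>2M$ is a root of $(E^2e^{2\varepsilon}-1)r_0^{\dagger3}+2Mr_0^{\dagger2}-L^2e^{2\varepsilon}r_0^\dagger+2ML^2e^{2\varepsilon}=0$.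 5. For a centripetal point, $\Phi(z^\dagger)=\Phi^\dagger$ and $T(z^\dagger)=T^\dagger$ are given by the (convergent) quadratures above, $L^2e^{2\varepsilon}>12M^2$, and $r_0^\dagger=(2M)^{-1}Le^\varepsilon\bigl(Le^\varepsilon\pm\sqrt{L^2e^{2\varepsilon}-12M^2}\bigr)$ with a sign independent of $\varepsilon$. -/

import Mathlib

open Filter Topology Set
open scoped Interval

noncomputable section

namespace SchwarzschildLRL

/-- Extended state space of the equatorial geodesic equations, with coordinates
`(τ, t, r, φ, σ, v, ω)` numbered `0, …, 6`; here `σ = dt/dτ`, `v = dr/dτ`, `ω = dφ/dτ`. -/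
abbrev State := Fin 7 → ℝ

/-! ### The geodesic equations and the classical constants of motion -/

/-- Geodesic energy `E = (1 - 2M/r) σ`. -/
def energy (M : ℝ) (z : State) : ℝ := (1 - 2 * M / z 2) * z 4

/-- Azimuthal angular momentum `L = r² ω`. -/
def angMom (z : State) : ℝ := z 2 ^ 2 * z 6

/-- `g(u,u)` for the equatorial Schwarzschild metric, `u = (σ, v, ω)`. -/
def metricNorm (M : ℝ) (z : State) : ℝ :=
  -((z 2 - 2 * M) / z 2) * z 4 ^ 2 + z 2 / (z 2 - 2 * M) * z 5 ^ 2 + z 2 ^ 2 * z 6 ^ 2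

/-- The total proper-time derivative `D_τ`, as a vector field on the extended state space:
`dτ/dτ = 1`, `dt/dτ = σ`, `dr/dτ = v`, `dφ/dτ = ω`, and `dσ/dτ`, `dv/dτ`, `dω/dτ` given by the
equatorial timelike geodesic equations. -/
def geodesicField (M : ℝ) (z : State) : State :=
  ![1, z 4, z 5, z 6,
    -(2 * M / (z 2 * (z 2 - 2 * M))) * z 4 * z 5,
    -(M * (z 2 - 2 * M) / z 2 ^ 3) * z 4 ^ 2 + M / (z 2 * (z 2 - 2 * M)) * z 5 ^ 2
      + (z 2 - 2 * M) * z 6 ^ 2,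
    -(2 / z 2) * z 5 * z 6]

/-- The squared radial speed `E² - (1 - 2M/y)(1 + L²/y²)` at radius `y`. -/
def radialSq (M E L y : ℝ) : ℝ := E ^ 2 - (1 - 2 * M / y) * (1 + L ^ 2 / y ^ 2)

/-- The radial speed `v(y) = s √(E² - (1 - 2M/y)(1 + L²/y²))`, with `s = sgn(v)`. -/
def radialSpeed (M s E L y : ℝ) : ℝ := s * √(radialSq M E L y)

/-! ### Dynamically distinguished radial points -/

/-- The three kinds of distinguished radial points. -/
inductive PointKind
  | turning
  | horizon
  | centripetal

/-- `r₀`, a function of `(E, L)`, is a (continuous) choice of distinguished radial point of the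
given kind for all `(E, L)` in `U`.  A turning point is a point outside the horizon at which `v`
vanishes and which is an actual radial extremum, `dv/dτ ≠ 0`: a simple root of the cubic.
A centripetal point is a positive root of the quadratic expressing `dv/dτ = 0`. -/
def IsDistinguished (M : ℝ) (U : Set (ℝ × ℝ)) (r₀ : ℝ → ℝ → ℝ) : PointKind → Prop
  | .turning =>
      ContinuousOn (fun p : ℝ × ℝ => r₀ p.1 p.2) U ∧
      ∀ E L, (E, L) ∈ U → 2 * M < r₀ E L ∧
        (E ^ 2 - 1) * r₀ E L ^ 3 + 2 * M * r₀ E L ^ 2 - L ^ 2 * r₀ E L + 2 * M * L ^ 2 = 0 ∧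
        3 * (E ^ 2 - 1) * r₀ E L ^ 2 + 4 * M * r₀ E L - L ^ 2 ≠ 0
  | .horizon => ∀ E L, (E, L) ∈ U → r₀ E L = 2 * M
  | .centripetal =>
      ContinuousOn (fun p : ℝ × ℝ => r₀ p.1 p.2) U ∧
      ∀ E L, (E, L) ∈ U → 0 < r₀ E L ∧
        M * r₀ E L ^ 2 - L ^ 2 * r₀ E L + 3 * L ^ 2 * M = 0

/-- The radius `r` can be joined to the distinguished point `r₀(E, L)` by radial motion with
constants of motion `E, L` outside the horizon: `v² > 0` on the closed segment between `r₀` and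
`r`, except at `r₀` itself when `r₀` is a turning point, and `v² > 0` at `r`. -/
def Regular (M : ℝ) (U : Set (ℝ × ℝ)) (k : PointKind) (r₀ : ℝ → ℝ → ℝ) (r E L : ℝ) : Prop :=
  2 * M < r ∧ (E, L) ∈ U ∧ 0 < radialSq M E L r ∧
    ∀ y ∈ uIcc (r₀ E L) r, (k = PointKind.turning → y ≠ r₀ E L) → 0 < radialSq M E L y

/-- The states of timelike geodesics in the exterior, with the four-velocity normalised, at which
the LRL quantities with distinguished point `r₀` are considered (`v ≠ 0` follows). -/
def domain (M : ℝ) (U : Set (ℝ × ℝ)) (k : PointKind) (r₀ : ℝ → ℝ → ℝ) : Set State :=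
  {z | metricNorm M z = -1 ∧ Regular M U k r₀ (z 2) (energy M z) (angMom z)}

/-! ### The LRL quantities -/

/-- `∫_a^r dy / v(y)`. -/
def properTimeIntegral (M s E L a r : ℝ) : ℝ := ∫ y in a..r, 1 / radialSpeed M s E L y

/-- `∫_a^r dy / (y² v(y))`. -/
def angleIntegral (M s E L a r : ℝ) : ℝ := ∫ y in a..r, 1 / (y ^ 2 * radialSpeed M s E L y)

/-- The residue at the horizon of `y / ((y - 2M) v(y))`. -/
def horizonResidue (M s E L : ℝ) : ℝ := 2 * M / radialSpeed M s E L (2 * M)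

/-- `∫_a^r y dy / ((y - 2M) v(y))`.  For `a = 2M` this integral diverges logarithmically, and it is
understood as its Hadamard finite part
`lim_{δ → 0+} (∫_{2M+δ}^r y dy / ((y - 2M) v(y)) + c log (δ / 2M))`, with `c` the residue,
written here as a convergent integral. -/
def timeIntegral (M s E L a r : ℝ) : ℝ :=
  if a = 2 * M then
    (∫ y in (2 * M)..r,
      (y / ((y - 2 * M) * radialSpeed M s E L y) - horizonResidue M s E L / (y - 2 * M)))
      + horizonResidue M s E L * Real.log ((r - 2 * M) / (2 * M))
  else ∫ y in a..r, y / ((y - 2 * M) * radialSpeed M s E L y)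

/-- The LRL angle `Φ = φ - L ∫_{r₀}^r dy / (y² v)`. -/
def lrlAngle (M : ℝ) (r₀ : ℝ → ℝ → ℝ) (z : State) : ℝ :=
  z 3 - angMom z * angleIntegral M (Real.sign (z 5)) (energy M z) (angMom z)
    (r₀ (energy M z) (angMom z)) (z 2)

/-- The LRL time `T = t - E ∫_{r₀}^r y dy / ((y - 2M) v)`. -/
def lrlTime (M : ℝ) (r₀ : ℝ → ℝ → ℝ) (z : State) : ℝ :=
  z 1 - energy M z * timeIntegral M (Real.sign (z 5)) (energy M z) (angMom z)
    (r₀ (energy M z) (angMom z)) (z 2)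

/-- The LRL proper time `𝒯 = τ - ∫_{r₀}^r dy / v`. -/
def lrlProperTime (M : ℝ) (r₀ : ℝ → ℝ → ℝ) (z : State) : ℝ :=
  z 0 - properTimeIntegral M (Real.sign (z 5)) (energy M z) (angMom z)
    (r₀ (energy M z) (angMom z)) (z 2)

/-! ### The Noether symmetry generator of a conserved quantity -/

/-- Partial derivative of `C` with respect to the `i`-th coordinate. -/
def partialD (i : Fin 7) (C : State → ℝ) (z : State) : ℝ :=
  deriv (fun x => C (Function.update z i x)) (z i)

/-- The scaling operator `S = σ ∂_σ + v ∂_v + ω ∂_ω`. -/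
def scaling (C : State → ℝ) (z : State) : ℝ :=
  z 4 * partialD 4 C z + z 5 * partialD 5 C z + z 6 * partialD 6 C z

/-- Component `P̂^t` of the variational symmetry of `C`. -/
def noetherT (M : ℝ) (C : State → ℝ) (z : State) : ℝ :=
  -(z 2 / (z 2 - 2 * M)) * partialD 4 C z + z 4 * scaling C z

/-- Component `P̂^r` of the variational symmetry of `C`. -/
def noetherR (M : ℝ) (C : State → ℝ) (z : State) : ℝ :=
  (z 2 - 2 * M) / z 2 * partialD 5 C z + z 5 * scaling C z

/-- Component `P̂^φ` of the variational symmetry of `C`. -/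
def noetherPhi (C : State → ℝ) (z : State) : ℝ :=
  1 / z 2 ^ 2 * partialD 6 C z + z 6 * scaling C z

/-- The total derivative `D_τ F` on solutions of the geodesic equations. -/
def totalD (M : ℝ) (F : State → ℝ) (z : State) : ℝ := fderiv ℝ F z (geodesicField M z)

/-- The prolonged generator `pr X̂ = P̂^μ ∂_{x^μ} + (D_τ P̂^μ) ∂_{u^μ}`. -/
def prolongedGenerator (M : ℝ) (C : State → ℝ) (z : State) : State :=
  ![0, noetherT M C z, noetherR M C z, noetherPhi C z,
    totalD M (noetherT M C) z, totalD M (noetherR M C) z, totalD M (noetherPhi C) z]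

/-- The equivalent generator `pr Ŷ = χ D_τ + pr X̂`, `χ = -P̂^r / v`, in the gauge in which `r` is
invariant. -/
def gaugedGenerator (M : ℝ) (C : State → ℝ) (z : State) : State :=
  (-(noetherR M C z / z 5)) • geodesicField M z + prolongedGenerator M C z

/-! ### The transformations generated by the LRL proper time -/

/-- `u₀ = 1 - 2M/r₀`. -/
def uZero (M : ℝ) (r₀ : ℝ → ℝ → ℝ) (E L : ℝ) : ℝ := 1 - 2 * M / r₀ E L

/-- `C_{𝒯,Φ}` for a centripetal point, with `L̄ = L/(2M)` and `ν₀ = v(r₀)`. -/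
def cAngle (M s : ℝ) (r₀ : ℝ → ℝ → ℝ) (E L : ℝ) : ℝ :=
  (1 - 3 * uZero M r₀ E L) * (1 + (L / (2 * M)) ^ 2 * (uZero M r₀ E L - 1) ^ 2) /
    (L / (2 * M) * (3 * uZero M r₀ E L - 2) * (uZero M r₀ E L - 1)
      * radialSpeed M s E L (r₀ E L))

/-- `C_{𝒯,T}` for a centripetal point. -/
def cTime (M s : ℝ) (r₀ : ℝ → ℝ → ℝ) (E L : ℝ) : ℝ :=
  2 * M * E * (1 - 3 * uZero M r₀ E L) /
    ((3 * uZero M r₀ E L - 2) * (uZero M r₀ E L - 1) * uZero M r₀ E L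
      * radialSpeed M s E L (r₀ E L))

/-- `Φ†`: invariant for a turning or horizon point, changed by a quadrature for a centripetal
point. -/
def angleDagger (M : ℝ) (r₀ : ℝ → ℝ → ℝ) (ε : ℝ) (z : State) : PointKind → ℝ
  | .centripetal => lrlAngle M r₀ z + ∫ x in (0 : ℝ)..ε,
      cAngle M (Real.sign (z 5)) r₀ (energy M z * Real.exp x) (angMom z * Real.exp x)
  | .turning => lrlAngle M r₀ z
  | .horizon => lrlAngle M r₀ z

/-- `T†`: invariant for a turning or horizon point, changed by a quadrature for a centripetal
point. -/
def timeDagger (M : ℝ) (r₀ : ℝ → ℝ → ℝ) (ε : ℝ) (z : State) : PointKind → ℝ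
  | .centripetal => lrlTime M r₀ z + ∫ x in (0 : ℝ)..ε,
      cTime M (Real.sign (z 5)) r₀ (energy M z * Real.exp x) (angMom z * Real.exp x)
  | .turning => lrlTime M r₀ z
  | .horizon => lrlTime M r₀ z

/-- The explicit transformation
`(τ, t, r, φ, σ, v, ω) ↦ (τ†, t†, r, φ†, σ†, v†, ω†)` with parameter `ε`. -/
def properTimeTransform (M : ℝ) (k : PointKind) (r₀ : ℝ → ℝ → ℝ) (ε : ℝ) (z : State) : State :=
  let s := Real.sign (z 5)
  let E' := energy M z * Real.exp ε
  let L' := angMom z * Real.exp ε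
  let a := r₀ E' L'
  ![lrlProperTime M r₀ z + properTimeIntegral M s E' L' a (z 2),
    timeDagger M r₀ ε z k + E' * timeIntegral M s E' L' a (z 2),
    z 2,
    angleDagger M r₀ ε z k + L' * angleIntegral M s E' L' a (z 2),
    (1 - 2 * M / z 2)⁻¹ * E',
    radialSpeed M s E' L' (z 2),
    (z 2 ^ 2)⁻¹ * L']

/-- The parameters `ε` for which the transformation of `z` is defined: all the way from `0` to `ε`
the scaled constants of motion stay in `U` and the radius stays regular for them. -/
def paramSet (M : ℝ) (U : Set (ℝ × ℝ)) (k : PointKind) (r₀ : ℝ → ℝ → ℝ) (z : State) : Set ℝ :=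
  {ε | ∀ x ∈ uIcc 0 ε,
    Regular M U k r₀ (z 2) (energy M z * Real.exp x) (angMom z * Real.exp x)}

end SchwarzschildLRL

end

/-! Write `I(E, L, r)` for the integral of `dy / |v|` from `r₀` to `r`, `Q = v²`, `f = 1 - 2M/y` (at
`y = r` outside the integrals) and `s = sgn v`, so that the LRL proper time is `τ - s I`. Away from
the mass shell it depends on the velocities only through `E`, `L` and the sign of `v`. The Noether
recipe therefore involves only derivatives of `I`, and with `K = E I_E + L I_L` the generator in the
gauge that fixes `r` has components `(s K, s I_E, 0, -s I_L, σ, (Q + f)/v, ω)`: see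
`gaugedGenerator_lrlProperTime`. Its prolongation needs only the `r`-derivatives of `I_E` and `I_L`,
which by symmetry of second derivatives come from `I_r = 1/√Q`.

The flow thus fixes `r` and multiplies `E` and `L` by `exp ε`; the normalisation then gives `v`, and
constancy of the LRL proper time gives `τ`. What remains is the motion of `Φ` and `T`. This amounts
to comparing the scaling derivatives of `J_φ = ∫ L dy / (y² √Q)` and `J_t = ∫ E dy / (f √Q)` with
`-I_L` and `I_E`, as in `hasDerivAt_scaling`. Under scaling `dQ/dε = 2 (Q + f)`, so the integrands
already agree pointwise: they change by `-∂_L (1/√Q)` and `∂_E (1/√Q)`. The behaviour at `r₀`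
decides the rest.

At a centripetal point the lower limit moves, and the end-point terms are precisely the rates
`C_{𝒯,Φ}` and `C_{𝒯,T}`. At the horizon the limit is fixed, and the pole removed by the finite part
has, after multiplication by `E`, the scale-invariant coefficient `2M sgn E`. At a turning point the
differentiated integrands behave like `Q^(-3/2)` and cannot be integrated. There the radial action
`S = ∫ √Q / f dy` is used: its end-point term vanishes, `S_E = J_t`, `S_L = -J_φ`, and `I = E S_E +
L S_L - S`. Hence `I_E = E S_EE + L S_LE` is the scaling derivative of `J_t`, and likewise for `L`.

The regularity behind this comes from the substitution `y = r₀ + (r - r₀) x²`, which turns each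
integral, square-root singularity included, into one over the fixed interval `[0, 1]` with a `C²`
integrand. Here `r₀` is `C²` by the implicit function theorem; for a centripetal point the openness
of `U` forces `L² > 12M²`, so that the root is simple.

Uniqueness of integral curves needs no Lipschitz estimate, since the system is triangular. Geodesics
go to geodesics because `E`, `L` and the LRL quantities are constant along them. -/

/-! ### Integrals over `[0, 1]` depending on a parameter, and implicit functions -/

section ParametricIntegral

variable {P F : Type*} [NormedAddCommGroup P] [NormedAddCommGroup F]

/-- Local boundedness, uniform over the compact fibre, of a map continuous along it. -/
theorem exists_eventually_norm_le_of_continuousAt {h : P × ℝ → F} {p : P}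
    (H : ∀ x ∈ Icc (0 : ℝ) 1, ContinuousAt h (p, x)) :
    ∃ B : ℝ, ∀ᶠ q in 𝓝 p, ∀ x ∈ Icc (0 : ℝ) 1, ‖h (q, x)‖ ≤ B := by
  have hc : ContinuousOn (fun x => h (p, x)) (Icc (0 : ℝ) 1) := fun x hx =>
    ((H x hx).comp (f := fun x : ℝ => (p, x)) (by fun_prop)).continuousWithinAt
  obtain ⟨B, hB⟩ := isCompact_Icc.exists_bound_of_continuousOn hc
  refine ⟨B + 1, isCompact_Icc.eventually_forall_of_forall_eventually fun x hx => ?_⟩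
  have h1 : ‖h (p, x)‖ < B + 1 := by linarith [hB x hx]
  exact ((H x hx).norm.eventually_lt_const h1).mono fun z hz => hz.le

theorem continuousOn_fibre {h : P × ℝ → F} {q : P}
    (H : ∀ x ∈ Icc (0 : ℝ) 1, ContinuousAt h (q, x)) :
    ContinuousOn (fun x => h (q, x)) (Icc (0 : ℝ) 1) := fun x hx =>
  ((H x hx).comp (f := fun x : ℝ => (q, x)) (by fun_prop)).continuousWithinAt

theorem intervalIntegrable_fibre {h : P × ℝ → F} {q : P}
    (H : ∀ x ∈ Icc (0 : ℝ) 1, ContinuousAt h (q, x)) :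
    IntervalIntegrable (fun x => h (q, x)) MeasureTheory.volume 0 1 :=
  (continuousOn_fibre H).intervalIntegrable_of_Icc zero_le_one

theorem aestronglyMeasurable_fibre {h : P × ℝ → F} {q : P}
    (H : ∀ x ∈ Icc (0 : ℝ) 1, ContinuousAt h (q, x)) :
    MeasureTheory.AEStronglyMeasurable (fun x => h (q, x))
      (MeasureTheory.volume.restrict (Ι (0 : ℝ) 1)) :=
  ((intervalIntegrable_fibre H).def').aestronglyMeasurable

variable [NormedSpace ℝ P] [NormedSpace ℝ F]

/-- Tube lemma: smoothness at a point is an open condition and `[0, 1]` is compact. -/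
theorem eventually_contDiffAt_fibre {n : ℕ} {h : P × ℝ → F} {p : P}
    (H : ∀ x ∈ Icc (0 : ℝ) 1, ContDiffAt ℝ n h (p, x)) :
    ∀ᶠ q in 𝓝 p, ∀ x ∈ Icc (0 : ℝ) 1, ContDiffAt ℝ n h (q, x) :=
  isCompact_Icc.eventually_forall_of_forall_eventually fun x hx =>
    (H x hx).eventually (by simp)

theorem continuousAt_integral_fibre {h : P × ℝ → F} {p : P}
    (H : ∀ x ∈ Icc (0 : ℝ) 1, ContDiffAt ℝ 0 h (p, x)) :
    ContinuousAt (fun q => ∫ x in (0 : ℝ)..1, h (q, x)) p := by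
  obtain ⟨B, hB⟩ := exists_eventually_norm_le_of_continuousAt
    (fun x hx => (H x hx).continuousAt)
  have hev := eventually_contDiffAt_fibre (n := 0) H
  refine intervalIntegral.continuousAt_of_dominated_interval (bound := fun _ => B) ?_ ?_
    (by simp) ?_
  · filter_upwards [hev] with q hq
    exact aestronglyMeasurable_fibre fun x hx => (hq x hx).continuousAt
  · filter_upwards [hB] with q hq
    refine Filter.Eventually.of_forall fun x hx => hq x ?_
    rw [uIoc_of_le zero_le_one] at hx
    exact Ioc_subset_Icc_self hx
  · refine Filter.Eventually.of_forall fun x hx => ?_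
    rw [uIoc_of_le zero_le_one] at hx
    exact (H x (Ioc_subset_Icc_self hx)).continuousAt.comp (f := fun q : P => (q, x))
      (by fun_prop)

/-- Dominated differentiation with a constant bound: the partial derivative is continuous along the
compact fibre, hence bounded uniformly for nearby parameters. -/
theorem hasFDerivAt_integral_fibre {h : P × ℝ → F} {p : P}
    (H : ∀ x ∈ Icc (0 : ℝ) 1, ContDiffAt ℝ 1 h (p, x)) :
    HasFDerivAt (fun q => ∫ x in (0 : ℝ)..1, h (q, x))
      (∫ x in (0 : ℝ)..1, (fderiv ℝ h (p, x)).comp (ContinuousLinearMap.inl ℝ P ℝ)) p := by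
  have hc : ∀ q, (∀ x ∈ Icc (0 : ℝ) 1, ContDiffAt ℝ 1 h (q, x)) → ∀ x ∈ Icc (0 : ℝ) 1,
      ContinuousAt (fun z => (fderiv ℝ h z).comp (ContinuousLinearMap.inl ℝ P ℝ)) (q, x) := by
    intro q hq x hx
    have := ((hq x hx).fderiv_right (m := 0) (by norm_num)).continuousAt
    exact this.clm_comp continuousAt_const
  obtain ⟨B, hB⟩ := exists_eventually_norm_le_of_continuousAt (hc p H)
  have hev := eventually_contDiffAt_fibre (n := 1) (h := h) (p := p) (by exact_mod_cast H)
  refine intervalIntegral.hasFDerivAt_integral_of_dominated_of_fderiv_le (bound := fun _ => B)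
    (F' := fun q x => (fderiv ℝ h (q, x)).comp (ContinuousLinearMap.inl ℝ P ℝ))
    (hev.and hB) ?_ ?_ ?_ ?_ (by simp) ?_
  · filter_upwards [hev] with q hq
    exact aestronglyMeasurable_fibre fun x hx => (hq x hx).continuousAt
  · exact intervalIntegrable_fibre fun x hx => (H x hx).continuousAt
  · exact aestronglyMeasurable_fibre
      (h := fun z => (fderiv ℝ h z).comp (ContinuousLinearMap.inl ℝ P ℝ)) (hc p H)
  · refine Filter.Eventually.of_forall fun x hx q hq => hq.2 x ?_
    rw [uIoc_of_le zero_le_one] at hx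
    exact Ioc_subset_Icc_self hx
  · refine Filter.Eventually.of_forall fun x hx q hq => ?_
    rw [uIoc_of_le zero_le_one] at hx
    have := ((hq.1 x (Ioc_subset_Icc_self hx)).differentiableAt (by norm_num)).hasFDerivAt
    exact this.comp q (f := fun q : P => (q, x)) (hasFDerivAt_prodMk_left q x)

end ParametricIntegral

/-- An integral over `[0, 1]` of a `C^n` integrand is `C^n` in the parameter. -/
theorem contDiffAt_integral_fibre {P : Type} [NormedAddCommGroup P] [NormedSpace ℝ P] (n : ℕ) :
    ∀ {F : Type} [NormedAddCommGroup F] [NormedSpace ℝ F] {h : P × ℝ → F} {p : P},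
    (∀ x ∈ Icc (0 : ℝ) 1, ContDiffAt ℝ n h (p, x)) →
    ContDiffAt ℝ n (fun q => ∫ x in (0 : ℝ)..1, h (q, x)) p := by
  -- The target space is generalised in the induction, because the derivative of the integral is an
  -- integral of the same kind with values in `P →L[ℝ] F`.
  induction n with
  | zero =>
    intro F _ _ h p H
    have hev := eventually_contDiffAt_fibre (h := h) (p := p) H
    refine contDiffAt_zero (f := fun q => ∫ x in (0 : ℝ)..1, h (q, x)).2 ⟨_, hev, fun q hq => ?_⟩
    exact (continuousAt_integral_fibre (h := h) (p := q) (by exact_mod_cast hq)).continuousWithinAt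
  | succ n ih =>
    intro F _ _ h p H
    have hev := eventually_contDiffAt_fibre (h := h) (p := p) H
    refine contDiffAt_succ_iff_hasFDerivAt.2
      ⟨fun q => ∫ x in (0 : ℝ)..1, (fderiv ℝ h (q, x)).comp (ContinuousLinearMap.inl ℝ P ℝ),
        ⟨_, hev, fun q hq => ?_⟩, ?_⟩
    · refine hasFDerivAt_integral_fibre (h := h) fun x hx => (hq x hx).of_le ?_
      norm_cast; omega
    · refine ih (h := fun z => (fderiv ℝ h z).comp (ContinuousLinearMap.inl ℝ P ℝ)) fun x hx => ?_
      have := (H x hx).fderiv_right (m := n) (by norm_cast)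
      exact this.clm_comp contDiffAt_const

/-- Implicit function theorem for a continuous solution `g` of a scalar equation. -/
theorem contDiffAt_of_implicit {P : Type*} [NormedAddCommGroup P] [NormedSpace ℝ P]
    [CompleteSpace P] {n : WithTop ℕ∞} (hn : n ≠ 0) {f : P × ℝ → ℝ} {g : P → ℝ} {p : P}
    (hf : ContDiffAt ℝ n f (p, g p)) (hg : ContinuousAt g p)
    (h0 : ∀ᶠ q in 𝓝 p, f (q, g q) = 0) {d : ℝ} (hd : d ≠ 0)
    (hfd : HasDerivAt (fun y => f (p, y)) d (g p)) : ContDiffAt ℝ n g p := by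
  have hinv : (fderiv ℝ f (p, g p) ∘L .inr ℝ P ℝ).IsInvertible := by
    have h1 : HasFDerivAt (fun y => f (p, y)) (fderiv ℝ f (p, g p) ∘L .inr ℝ P ℝ) (g p) :=
      (hf.differentiableAt hn).hasFDerivAt.comp (g p) (hasFDerivAt_prodMk_right p (g p))
    have h2 := h1.unique hfd.hasFDerivAt
    rw [h2]
    refine ⟨ContinuousLinearEquiv.unitsEquivAut ℝ (Units.mk0 d hd), ?_⟩
    ext; simp
  have hsm := hf.contDiffAt_implicitFunction hn hinv
  refine hsm.congr_of_eventuallyEq ?_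
  -- Continuity of `g` keeps `(q, g q)` in the neighbourhood where the level set of `f` is the graph
  -- of the implicit function, so `g` coincides with that function near `p`.
  have hT : Tendsto (fun q => (q, g q)) (𝓝 p) (𝓝 (p, g p)) :=
    (continuousAt_id.prodMk hg)
  filter_upwards [hT.eventually (hf.eventually_apply_eq_iff_implicitFunction hn hinv), h0]
    with q hq h0q
  exact (hq.1 (by rw [h0q, h0.self_of_nhds])).symm

/-! ### The quadratic path and the Leibniz rule with a moving end point -/

noncomputable section
namespace SchwarzschildLRL

/-- The quadratic parametrisation of the segment from `a` to `r`. -/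
def radialPath (a r x : ℝ) : ℝ := a + (r - a) * x ^ 2

theorem radialPath_zero (a r : ℝ) : radialPath a r 0 = a := by simp [radialPath]

theorem radialPath_one (a r : ℝ) : radialPath a r 1 = r := by simp [radialPath]

theorem hasDerivAt_radialPath (a r x : ℝ) :
    HasDerivAt (radialPath a r) (2 * (r - a) * x) x := by
  have h := ((hasDerivAt_pow 2 x).const_mul (r - a)).const_add a
  refine h.congr_deriv ?_
  norm_num; ring

theorem continuous_radialPath (a r : ℝ) : Continuous (radialPath a r) := by
  unfold radialPath; fun_prop

/-- Differentiation of `∫_{a(ε)}^r h(ε, y) dy`, written in the variable `x` of `radialPath`; the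
integrand `K` is smooth up to the end point, at which `h` only needs to have a limit. -/
theorem hasDerivAt_integral_radialPath {a d : ℝ → ℝ} {a' b r e : ℝ} {K h : ℝ × ℝ → ℝ}
    (ha : HasDerivAt a a' e)
    (hK : ∀ x ∈ Icc (0 : ℝ) 1, ContDiffAt ℝ 1 K (e, x))
    (hKh : ∀ x ∈ Ioo (0 : ℝ) 1, ∀ᶠ ε in 𝓝 e,
      K (ε, x) = h (ε, radialPath (a ε) r x) * (2 * (r - a ε) * x))
    (hh : ∀ x ∈ Ioc (0 : ℝ) 1, DifferentiableAt ℝ h (e, radialPath (a e) r x))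
    (hd : ∀ x ∈ Ioo (0 : ℝ) 1,
      HasDerivAt (fun ε => h (ε, radialPath (a e) r x)) (d (radialPath (a e) r x)) e)
    (hint : IntervalIntegrable (fun x => d (radialPath (a e) r x) * (2 * (r - a e) * x))
      MeasureTheory.volume 0 1)
    (hb : Tendsto (fun x => h (e, radialPath (a e) r x)) (𝓝[>] 0) (𝓝 b)) :
    HasDerivAt (fun ε => ∫ x in (0 : ℝ)..1, K (ε, x))
      ((∫ x in (0 : ℝ)..1, d (radialPath (a e) r x) * (2 * (r - a e) * x)) - b * a') e := by
  have hc : ∀ x ∈ Icc (0 : ℝ) 1,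
      ContinuousAt (fun z => (fderiv ℝ K z).comp (ContinuousLinearMap.inl ℝ ℝ ℝ)) (e, x) := by
    intro x hx
    exact (((hK x hx).fderiv_right (m := 0) (by norm_num)).continuousAt).clm_comp
      continuousAt_const
  have hci := intervalIntegrable_fibre
    (h := fun z => (fderiv ℝ K z).comp (ContinuousLinearMap.inl ℝ ℝ ℝ)) hc
  have hmain := (hasFDerivAt_integral_fibre hK).hasDerivAt
  rw [ContinuousLinearMap.intervalIntegral_apply hci] at hmain
  refine hmain.congr_deriv ?_
  have hci1 : IntervalIntegrable (fun x => (fderiv ℝ K (e, x)).comp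
      (ContinuousLinearMap.inl ℝ ℝ ℝ) 1) MeasureTheory.volume 0 1 :=
    (continuousOn_fibre
      (h := fun z => (fderiv ℝ K z).comp (ContinuousLinearMap.inl ℝ ℝ ℝ) (1 : ℝ)) (q := e)
      fun x hx => (hc x hx).clm_apply continuousAt_const).intervalIntegrable_of_Icc zero_le_one
  rw [eq_sub_iff_add_eq, ← eq_sub_iff_add_eq', ← intervalIntegral.integral_sub hint hci1]
  symm
  -- At fixed `x` the point `y = a + (r - a) x²` moves with speed `a' (1 - x²)`. The `ε`-derivative
  -- of `h · ∂y/∂x` is therefore `d · ∂y/∂x` plus the exact derivative of `h a' (1 - x²)` in `x`. No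
  -- integrability of `∂h/∂y` up to the end point is needed.
  have key : ∀ x ∈ Ioo (0 : ℝ) 1, HasDerivAt
      (fun x => -(h (e, radialPath (a e) r x) * (a' * (1 - x ^ 2))))
      (d (radialPath (a e) r x) * (2 * (r - a e) * x)
        - (fderiv ℝ K (e, x)).comp (ContinuousLinearMap.inl ℝ ℝ ℝ) 1) x := by
    intro x hx
    have hD := (hh x ⟨hx.1, hx.2.le⟩).hasFDerivAt
    set D := fderiv ℝ h (e, radialPath (a e) r x)
    have hd1 : D (1, 0) = d (radialPath (a e) r x) := by
      refine HasDerivAt.unique ?_ (hd x hx)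
      exact hD.comp_hasDerivAt (f := fun ε => (ε, radialPath (a e) r x)) e
        ((hasDerivAt_id e).prodMk (hasDerivAt_const e _))
    have hlin : ∀ u v : ℝ, D (u, v) = u * D (1, 0) + v * D (0, 1) := by
      intro u v
      have : (u, v) = u • ((1 : ℝ), (0 : ℝ)) + v • ((0 : ℝ), (1 : ℝ)) := by simp
      rw [this, map_add, map_smul, map_smul, smul_eq_mul, smul_eq_mul]
    have hx1 : HasDerivAt (fun x => h (e, radialPath (a e) r x))
        (D (0, 2 * (r - a e) * x)) x :=
      hD.comp_hasDerivAt (f := fun x => (e, radialPath (a e) r x)) x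
        ((hasDerivAt_const x e).prodMk (hasDerivAt_radialPath _ _ _))
    have hp : HasDerivAt (fun ε => radialPath (a ε) r x) (a' * (1 - x ^ 2)) e := by
      have := ha.add ((ha.const_sub r).mul_const (x ^ 2))
      exact this.congr_deriv (by ring)
    have he1 : HasDerivAt (fun ε => h (ε, radialPath (a ε) r x)) (D (1, a' * (1 - x ^ 2))) e :=
      hD.comp_hasDerivAt (f := fun ε => (ε, radialPath (a ε) r x)) e
        ((hasDerivAt_id e).prodMk hp)
    have hK1 : HasDerivAt (fun ε => K (ε, x))
        ((fderiv ℝ K (e, x)).comp (ContinuousLinearMap.inl ℝ ℝ ℝ) 1) e :=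
      ((hK x (Ioo_subset_Icc_self hx)).differentiableAt
        (by norm_num)).hasFDerivAt.comp_hasDerivAt (f := fun ε => (ε, x)) e
        ((hasDerivAt_id e).prodMk (hasDerivAt_const e x))
    have hK2 := hK1.unique ((he1.mul (((ha.const_sub r).const_mul 2).mul_const
      x)).congr_of_eventuallyEq (hKh x hx))
    rw [hK2, hlin 1, hd1]
    have hx2 : HasDerivAt (fun x : ℝ => a' * (1 - x ^ 2)) (a' * (-(2 * x))) x := by
      have := ((hasDerivAt_pow 2 x).const_sub 1).const_mul a'
      exact this.congr_deriv (by norm_num)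
    refine (hx1.mul hx2).neg.congr_deriv ?_
    rw [hlin 0]
    ring
  -- The upper boundary value vanishes with `1 - x²`, since `r` is fixed; the lower one is the limit
  -- `b` of `h` times the speed of the end point.
  rw [intervalIntegral.integral_eq_sub_of_hasDerivAt_of_tendsto (zero_lt_one) key
    (hint.sub hci1) (fa := -(b * a')) (fb := 0)]
  · ring
  · have h1 : Tendsto (fun x : ℝ => a' * (1 - x ^ 2)) (𝓝[>] 0) (𝓝 a') := by
      have : ContinuousAt (fun x : ℝ => a' * (1 - x ^ 2)) 0 := by fun_prop
      have h2 := this.tendsto.mono_left (nhdsWithin_le_nhds (s := Ioi 0))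
      simpa using h2
    exact (hb.mul h1).neg
  · have h1 : ContinuousAt (fun x => -(h (e, radialPath (a e) r x) * (a' * (1 - x ^ 2)))) 1 := by
      have h2 : ContinuousAt (fun x => h (e, radialPath (a e) r x)) 1 :=
        (hh 1 ⟨zero_lt_one, le_rfl⟩).continuousAt.comp (f := fun x => (e, radialPath (a e) r x))
          (continuousAt_const.prodMk (continuous_radialPath _ _).continuousAt)
      exact (h2.mul (by fun_prop)).neg
    have h2 := h1.tendsto.mono_left (nhdsWithin_le_nhds (s := Iio 1))
    simpa using h2

end SchwarzschildLRL
end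

/-! ### Distinguished points: location, smoothness, and regularity of the radial segment -/

noncomputable section
namespace SchwarzschildLRL

/-- The quotient of the cubic `y³ v(y)²` by `y - a`, for a root `a`. -/
def cofactor (M E L a y : ℝ) : ℝ :=
  (E ^ 2 - 1) * (y ^ 2 + y * a + a ^ 2) + 2 * M * (y + a) - L ^ 2

/-- The factor of `v²` along `radialPath` that stays positive up to the distinguished point. -/
def speedCore (k : PointKind) (M E L a r x : ℝ) : ℝ :=
  match k with
  | .turning => (r - a) * cofactor M E L a (radialPath a r x) / radialPath a r x ^ 3
  | _ => radialSq M E L (radialPath a r x)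

/-- The weight by which `x dx / v` is expressed through `speedCore`. -/
def speedWeight (k : PointKind) (x : ℝ) : ℝ :=
  match k with
  | .turning => 1
  | _ => x

variable {M : ℝ} {U : Set (ℝ × ℝ)} {k : PointKind} {r₀ : ℝ → ℝ → ℝ} {E L r : ℝ}

theorem radialSq_eq_cubic (M E L : ℝ) {y : ℝ} (hy : y ≠ 0) :
    radialSq M E L y =
      ((E ^ 2 - 1) * y ^ 3 + 2 * M * y ^ 2 - L ^ 2 * y + 2 * M * L ^ 2) / y ^ 3 := by
  unfold radialSq; field_simp; ring

theorem radialSq_eq_cofactor {a y : ℝ} (hy : y ≠ 0)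
    (ha : (E ^ 2 - 1) * a ^ 3 + 2 * M * a ^ 2 - L ^ 2 * a + 2 * M * L ^ 2 = 0) :
    radialSq M E L y = (y - a) * cofactor M E L a y / y ^ 3 := by
  rw [radialSq_eq_cubic M E L hy]
  congr 1
  unfold cofactor
  linear_combination ha

/-- The quadratic reads `L² (a - 3M) = M a² > 0`. In particular centripetal points lie outside the
horizon. -/
theorem centripetal_bounds (hM : 0 < M) {a : ℝ} (ha : 0 < a)
    (h : M * a ^ 2 - L ^ 2 * a + 3 * L ^ 2 * M = 0) : L ≠ 0 ∧ 3 * M < a := by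
  have h0 : 0 < M * a ^ 2 := by positivity
  have h1 : L ^ 2 * (a - 3 * M) = M * a ^ 2 := by linear_combination -h
  have h2 : 0 < L ^ 2 * (a - 3 * M) := by rw [h1]; exact h0
  constructor
  · rintro rfl; simp at h2
  · nlinarith [sq_nonneg L, pos_of_mul_pos_right h2 (sq_nonneg L)]

theorem two_mul_le_distinguished (hM : 0 < M) (h : IsDistinguished M U r₀ k) (hU : (E, L) ∈ U) :
    2 * M ≤ r₀ E L := by
  cases k with
  | turning => exact ((h.2 E L hU).1).le
  | horizon => exact (h E L hU).ge
  | centripetal =>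
    obtain ⟨h1, h2⟩ := h.2 E L hU
    linarith [(centripetal_bounds hM h1 h2).2]

theorem two_mul_lt_distinguished (hM : 0 < M) (h : IsDistinguished M U r₀ k) (hk : k ≠ .horizon)
    (hU : (E, L) ∈ U) : 2 * M < r₀ E L := by
  cases k with
  | turning => exact (h.2 E L hU).1
  | horizon => exact absurd rfl hk
  | centripetal =>
    obtain ⟨h1, h2⟩ := h.2 E L hU
    linarith [(centripetal_bounds hM h1 h2).2]

theorem radialPath_mem_uIcc (a r : ℝ) {x : ℝ} (hx : x ∈ Icc (0 : ℝ) 1) :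
    radialPath a r x ∈ uIcc a r := by
  have h2 : x ^ 2 ≤ 1 := pow_le_one₀ hx.1 hx.2
  have h3 := sq_nonneg x
  unfold radialPath
  rcases le_total a r with h | h
  · rw [uIcc_of_le h]; constructor <;> nlinarith
  · rw [uIcc_of_ge h]; constructor <;> nlinarith

theorem exists_radialPath_eq {a r y : ℝ} (hy : y ∈ uIcc a r) :
    ∃ x ∈ Icc (0 : ℝ) 1, radialPath a r x = y := by
  have := intermediate_value_uIcc (a := (0 : ℝ)) (b := 1)
    (continuous_radialPath a r).continuousOn
  rw [radialPath_zero, radialPath_one, uIcc_of_le zero_le_one] at this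
  exact this hy

theorem two_mul_le_of_mem_uIcc {a y : ℝ} (ha : 2 * M ≤ a) (hr : 2 * M < r)
    (hy : y ∈ uIcc a r) : 2 * M ≤ y := le_trans (le_inf ha hr.le) hy.1

theorem two_mul_lt_of_mem_uIcc {a y : ℝ} (ha : 2 * M < a) (hr : 2 * M < r)
    (hy : y ∈ uIcc a r) : 2 * M < y := lt_of_lt_of_le (lt_min ha hr) hy.1

theorem two_mul_lt_radialPath {a x : ℝ} (ha : 2 * M ≤ a) (hr : 2 * M < r)
    (hx : x ∈ Ioc (0 : ℝ) 1) : 2 * M < radialPath a r x := by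
  have h2 : x ^ 2 ≤ 1 := pow_le_one₀ hx.1.le hx.2
  have h3 : 0 < x ^ 2 := by have := hx.1; positivity
  unfold radialPath
  nlinarith [mul_nonneg (sub_nonneg.2 ha) (sub_nonneg.2 h2), mul_pos h3 (sub_pos.2 hr)]

/-- At a turning point the root contributes `y - r₀ = (r - r₀) x²`, which is the factor `x²` on the
right. For the other kinds nothing vanishes at `r₀`, and the weight `x` supplies that factor, so
that all kinds share one formula. -/
theorem radialSq_radialPath (hM : 0 < M) (h : IsDistinguished M U r₀ k) (hU : (E, L) ∈ U)
    (hr : 2 * M < r) {x : ℝ} (hx : x ∈ Icc (0 : ℝ) 1) :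
    radialSq M E L (radialPath (r₀ E L) r x) * speedWeight k x ^ 2
      = x ^ 2 * speedCore k M E L (r₀ E L) r x := by
  have hy : radialPath (r₀ E L) r x ≠ 0 := by
    have := two_mul_le_of_mem_uIcc (two_mul_le_distinguished hM h hU) hr
      (radialPath_mem_uIcc _ r hx)
    linarith
  cases k with
  | turning =>
    rw [radialSq_eq_cofactor hy (h.2 E L hU).2.1]
    simp only [speedWeight, speedCore]
    have : radialPath (r₀ E L) r x - r₀ E L = (r - r₀ E L) * x ^ 2 := by unfold radialPath; ring
    rw [this]; ring
  | horizon => simp only [speedWeight, speedCore]; ring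
  | centripetal => simp only [speedWeight, speedCore]; ring

theorem speedWeight_pos (k : PointKind) {x : ℝ} (hx : 0 < x) : 0 < speedWeight k x := by
  cases k <;> simp [speedWeight, hx]

theorem continuous_speedWeight (k : PointKind) : Continuous (speedWeight k) := by
  cases k <;> unfold speedWeight <;> fun_prop

/-- Only a turning point needs an argument. The path meets `r₀` at some `x > 0` only if `r = r₀`,
and then `v²` would vanish at `r`. -/
theorem Regular.pos_of_pos (h : Regular M U k r₀ r E L) {x : ℝ} (hx : x ∈ Ioc (0 : ℝ) 1)
    (hd : IsDistinguished M U r₀ k) : 0 < radialSq M E L (radialPath (r₀ E L) r x) := by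
  refine h.2.2.2 _ (radialPath_mem_uIcc _ _ (Ioc_subset_Icc_self hx)) fun hk he => ?_
  subst hk
  have h1 : (r - r₀ E L) * x ^ 2 = 0 := by unfold radialPath at he; linarith
  have h2 : x ≠ 0 := hx.1.ne'
  have h3 : r = r₀ E L := by
    have := (mul_eq_zero.1 h1).resolve_right (pow_ne_zero 2 h2); linarith
  have h4 := h.2.2.1
  -- The sign of `M` is not assumed, so `r = 0`, where the quotient form of `v²` fails, is excluded
  -- separately: the cubic leaves `M L² = 0`, which contradicts either `2M < r₀` or the simplicity
  -- of the root.
  by_cases h0 : r = 0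
  · have h5 := (hd.2 E L h.2.1).1
    have h6 := (hd.2 E L h.2.1).2.1
    have h7 := (hd.2 E L h.2.1).2.2
    rw [← h3, h0] at h6 h7
    have h8 : M * L ^ 2 = 0 := by linarith
    rcases mul_eq_zero.1 h8 with h9 | h9
    · rw [h3] at h0; rw [h0, h9] at h5; linarith
    · rw [h9] at h7; simp at h7
  · rw [radialSq_eq_cubic M E L h0, h3, (hd.2 E L h.2.1).2.1] at h4
    simp at h4

/-- For `x > 0` the factorisation of `v²` gives positivity. At `x = 0` on a turning point,
continuity gives `≥ 0`, and the value is nonzero because the cofactor at its own root is the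
derivative of the cubic, nonzero for a simple root. -/
theorem Regular.speedCore_pos (hM : 0 < M) (hd : IsDistinguished M U r₀ k)
    (h : Regular M U k r₀ r E L) {x : ℝ} (hx : x ∈ Icc (0 : ℝ) 1) :
    0 < speedCore k M E L (r₀ E L) r x := by
  have hpos : ∀ x ∈ Ioc (0 : ℝ) 1, 0 < speedCore k M E L (r₀ E L) r x := by
    intro x hx
    have h1 := radialSq_radialPath hM hd h.2.1 h.1 (Ioc_subset_Icc_self hx)
    have h2 := mul_pos (h.pos_of_pos hx hd) (pow_pos (speedWeight_pos k hx.1) 2)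
    rw [h1] at h2
    exact pos_of_mul_pos_right h2 (sq_nonneg x)
  rcases eq_or_lt_of_le hx.1 with h0 | h0
  swap
  · exact hpos x ⟨h0, hx.2⟩
  subst h0
  cases k with
  | turning =>
    have ha := (hd.2 E L h.2.1).1
    have ha0 : 0 < r₀ E L := by linarith
    have hc : ContinuousAt (speedCore .turning M E L (r₀ E L) r) 0 := by
      unfold speedCore cofactor
      have hp : ContinuousAt (radialPath (r₀ E L) r) 0 :=
        (continuous_radialPath _ _).continuousAt
      refine ContinuousAt.div (by fun_prop) (by fun_prop) ?_
      rw [radialPath_zero]; positivity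
    have hge : 0 ≤ speedCore .turning M E L (r₀ E L) r 0 := by
      refine ge_of_tendsto (hc.tendsto.mono_left (nhdsWithin_le_nhds (s := Ioi 0))) ?_
      filter_upwards [Ioc_mem_nhdsGT (zero_lt_one' ℝ)] with x hx
      exact (hpos x hx).le
    refine lt_of_le_of_ne hge (Ne.symm ?_)
    simp only [speedCore, radialPath_zero]
    refine div_ne_zero (mul_ne_zero ?_ ?_) (by positivity)
    · intro hr
      have h1 := hpos 1 ⟨zero_lt_one, le_rfl⟩
      simp [speedCore, hr] at h1
    · have := (hd.2 E L h.2.1).2.2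
      intro h2; apply this; rw [← h2]; unfold cofactor; ring
  | horizon =>
    exact h.2.2.2 _ (radialPath_mem_uIcc _ _ hx) (by simp)
  | centripetal =>
    exact h.2.2.2 _ (radialPath_mem_uIcc _ _ hx) (by simp)

/-- The converse makes regularity equivalent to strict positivity of a continuous function on the
whole compact interval, which is stable under perturbation; positivity of `v²` itself, failing at a
turning point, would not be. -/
theorem regular_of_speedCore_pos (hM : 0 < M) (hd : IsDistinguished M U r₀ k) (hU : (E, L) ∈ U)
    (hr : 2 * M < r) (h : ∀ x ∈ Icc (0 : ℝ) 1, 0 < speedCore k M E L (r₀ E L) r x) :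
    Regular M U k r₀ r E L := by
  have key : ∀ x ∈ Ioc (0 : ℝ) 1, 0 < radialSq M E L (radialPath (r₀ E L) r x) := by
    intro x hx
    have h1 := radialSq_radialPath hM hd hU hr (Ioc_subset_Icc_self hx)
    have h2 := mul_pos (pow_pos hx.1 2) (h x (Ioc_subset_Icc_self hx))
    rw [← h1] at h2
    exact pos_of_mul_pos_left h2 (sq_nonneg _)
  refine ⟨hr, hU, ?_, fun y hy hne => ?_⟩
  · simpa [radialPath_one] using key 1 ⟨zero_lt_one, le_rfl⟩
  · obtain ⟨x, hx, rfl⟩ := exists_radialPath_eq hy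
    rcases eq_or_lt_of_le hx.1 with h0 | h0
    swap
    · exact key x ⟨h0, hx.2⟩
    subst h0
    cases k with
    | turning => exact absurd (radialPath_zero _ _) (hne rfl)
    | horizon => exact h 0 hx
    | centripetal => exact h 0 hx

/-- Implicit function theorem at a simple root: simplicity is assumed for turning points, and for
centripetal points it is the strict positivity of the discriminant. -/
theorem contDiffAt_distinguished (hU : IsOpen U) (hM : 0 < M) (hd : IsDistinguished M U r₀ k)
    (hq : (E, L) ∈ U) (h12 : k = .centripetal → 12 * M ^ 2 < L ^ 2) :
    ContDiffAt ℝ 2 (fun p : ℝ × ℝ => r₀ p.1 p.2) (E, L) := by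
  have hev : ∀ᶠ p in 𝓝 (E, L), p ∈ U := hU.mem_nhds hq
  cases k with
  | horizon =>
    refine (contDiffAt_const (c := 2 * M)).congr_of_eventuallyEq ?_
    filter_upwards [hev] with p hp using hd p.1 p.2 hp
  | turning =>
    refine contDiffAt_of_implicit (two_ne_zero)
      (f := fun w : (ℝ × ℝ) × ℝ => (w.1.1 ^ 2 - 1) * w.2 ^ 3 + 2 * M * w.2 ^ 2
        - w.1.2 ^ 2 * w.2 + 2 * M * w.1.2 ^ 2) (by fun_prop)
      (hd.1.continuousAt (hU.mem_nhds hq)) ?_ (hd.2 E L hq).2.2 ?_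
    · filter_upwards [hev] with p hp using (hd.2 p.1 p.2 hp).2.1
    · have h := ((((hasDerivAt_pow 3 (r₀ E L)).const_mul (E ^ 2 - 1)).add
        ((hasDerivAt_pow 2 (r₀ E L)).const_mul (2 * M))).sub
        ((hasDerivAt_id (r₀ E L)).const_mul (L ^ 2))).add_const (2 * M * L ^ 2)
      refine h.congr_deriv ?_
      norm_num; ring
  | centripetal =>
    have h1 := (hd.2 E L hq).1
    have h2 := (hd.2 E L hq).2
    refine contDiffAt_of_implicit (two_ne_zero)
      (f := fun w : (ℝ × ℝ) × ℝ => M * w.2 ^ 2 - w.1.2 ^ 2 * w.2 + 3 * w.1.2 ^ 2 * M)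
      (by fun_prop)
      (hd.1.continuousAt (hU.mem_nhds hq)) ?_ (d := 2 * M * r₀ E L - L ^ 2) ?_ ?_
    · filter_upwards [hev] with p hp using (hd.2 p.1 p.2 hp).2
    · intro h3
      -- On roots of the quadratic, `(2M r₀ - L²)² = L² (L² - 12M²)`: the squared derivative is the
      -- discriminant.
      have h4 : L ^ 2 * (L ^ 2 - 12 * M ^ 2) = 0 := by
        linear_combination (-(L ^ 2) + 2 * M * r₀ E L) * h3 - 4 * M * h2
      have h5 := (centripetal_bounds hM h1 h2).1
      rcases mul_eq_zero.1 h4 with h6 | h6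
      · exact h5 (pow_eq_zero_iff two_ne_zero |>.1 h6)
      · linarith [h12 rfl]
    · have h := (((hasDerivAt_pow 2 (r₀ E L)).const_mul M).sub
        ((hasDerivAt_id (r₀ E L)).const_mul (L ^ 2))).add_const (3 * L ^ 2 * M)
      refine h.congr_deriv ?_
      norm_num; ring

/-- A real root makes the discriminant nonnegative throughout `U`, so `12M² ≤ l²` there. As `U` is
open it also contains some `(E, c L)` with `0 < c < 1`, and the inequality at that point is strict
at `L`. -/
theorem twelve_mul_sq_lt (hM : 0 < M) (hU : IsOpen U) (hd : IsDistinguished M U r₀ .centripetal)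
    (hq : (E, L) ∈ U) : 12 * M ^ 2 < L ^ 2 := by
  have hle : ∀ l, (E, l) ∈ U → 12 * M ^ 2 ≤ l ^ 2 := by
    intro l hl
    have h1 := (hd.2 E l hl).1
    have h2 := (hd.2 E l hl).2
    have h3 := (centripetal_bounds hM h1 h2).1
    have h4 : l ^ 2 * (l ^ 2 - 12 * M ^ 2) = (2 * M * r₀ E l - l ^ 2) ^ 2 := by
      linear_combination -4 * M * h2
    have h5 : 0 < l ^ 2 := by positivity
    have h6 : 0 ≤ l ^ 2 * (l ^ 2 - 12 * M ^ 2) := by rw [h4]; positivity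
    linarith [nonneg_of_mul_nonneg_right h6 h5]
  have hL : L ≠ 0 := (centripetal_bounds hM (hd.2 E L hq).1 (hd.2 E L hq).2).1
  have hc : Tendsto (fun c : ℝ => (E, c * L)) (𝓝[<] 1) (𝓝 (E, L)) := by
    have : ContinuousAt (fun c : ℝ => (E, c * L)) 1 := by fun_prop
    simpa using this.tendsto.mono_left (nhdsWithin_le_nhds (s := Iio 1))
  obtain ⟨c, hcU, hc1⟩ := ((hc.eventually (hU.mem_nhds hq)).and
    (Ioo_mem_nhdsLT (zero_lt_one' ℝ))).exists
  have h1 := hle _ hcU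
  have h2 : c ^ 2 < 1 := by nlinarith [hc1.1, hc1.2]
  have h3 : 0 < L ^ 2 := by positivity
  nlinarith

end SchwarzschildLRL
end

/-! ### Radial integrals as `C²` functions of `(E, L, r)` -/

noncomputable section
namespace SchwarzschildLRL

/-- The regular triples `(E, L, r)`. -/
def regularSet (M : ℝ) (U : Set (ℝ × ℝ)) (k : PointKind) (r₀ : ℝ → ℝ → ℝ) : Set (ℝ × ℝ × ℝ) :=
  {p | Regular M U k r₀ p.2.2 p.1 p.2.1}

/-- The integral `∫_{r₀}^r g dy / |v|` as a function of `(E, L, r)`. -/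
def radialIntegral (M : ℝ) (r₀ : ℝ → ℝ → ℝ) (g : ℝ × ℝ × ℝ → ℝ) (p : ℝ × ℝ × ℝ) : ℝ :=
  ∫ y in (r₀ p.1 p.2.1)..p.2.2, g (p.1, p.2.1, y) / √(radialSq M p.1 p.2.1 y)

/-- The integrand of `radialIntegral` in the variable of `radialPath`. -/
def radialKernel (M : ℝ) (k : PointKind) (r₀ : ℝ → ℝ → ℝ) (g : ℝ × ℝ × ℝ → ℝ)
    (w : (ℝ × ℝ × ℝ) × ℝ) : ℝ :=
  g (w.1.1, w.1.2.1, radialPath (r₀ w.1.1 w.1.2.1) w.1.2.2 w.2) *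
    (2 * (w.1.2.2 - r₀ w.1.1 w.1.2.1) * speedWeight k w.2) /
      √(speedCore k M w.1.1 w.1.2.1 (r₀ w.1.1 w.1.2.1) w.1.2.2 w.2)

variable {M : ℝ} {U : Set (ℝ × ℝ)} {k : PointKind} {r₀ : ℝ → ℝ → ℝ} {E L r : ℝ}

theorem contDiffAt_radialSq {W : Type*} [NormedAddCommGroup W] [NormedSpace ℝ W]
    {n : WithTop ℕ∞} {e l y : W → ℝ} {w : W} (he : ContDiffAt ℝ n e w) (hl : ContDiffAt ℝ n l w)
    (hy : ContDiffAt ℝ n y w) (h0 : y w ≠ 0) :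
    ContDiffAt ℝ n (fun w => radialSq M (e w) (l w) (y w)) w := by
  unfold radialSq
  have h1 : ContDiffAt ℝ n (fun w => 2 * M / y w) w := contDiffAt_const.div hy h0
  have h2 : ContDiffAt ℝ n (fun w => l w ^ 2 / y w ^ 2) w :=
    (hl.pow 2).div (hy.pow 2) (pow_ne_zero 2 h0)
  fun_prop

theorem contDiffAt_radialPath {W : Type*} [NormedAddCommGroup W] [NormedSpace ℝ W]
    {n : WithTop ℕ∞} {a r x : W → ℝ} {w : W} (ha : ContDiffAt ℝ n a w) (hr : ContDiffAt ℝ n r w)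
    (hx : ContDiffAt ℝ n x w) : ContDiffAt ℝ n (fun w => radialPath (a w) (r w) (x w)) w := by
  unfold radialPath; fun_prop

theorem contDiffAt_speedCore {W : Type*} [NormedAddCommGroup W] [NormedSpace ℝ W]
    {n : WithTop ℕ∞} {e l a r x : W → ℝ} {w : W} (k : PointKind) (he : ContDiffAt ℝ n e w)
    (hl : ContDiffAt ℝ n l w) (ha : ContDiffAt ℝ n a w) (hr : ContDiffAt ℝ n r w)
    (hx : ContDiffAt ℝ n x w) (h0 : radialPath (a w) (r w) (x w) ≠ 0) :
    ContDiffAt ℝ n (fun w => speedCore k M (e w) (l w) (a w) (r w) (x w)) w := by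
  have hp := contDiffAt_radialPath ha hr hx
  cases k with
  | turning =>
    simp only [speedCore, cofactor]
    refine ContDiffAt.div ?_ (hp.pow 3) (pow_ne_zero 3 h0)
    fun_prop
  | horizon => exact contDiffAt_radialSq he hl hp h0
  | centripetal => exact contDiffAt_radialSq he hl hp h0

theorem contDiff_speedWeight (k : PointKind) {n : WithTop ℕ∞} :
    ContDiff ℝ n (speedWeight k) := by
  cases k <;> unfold speedWeight <;> fun_prop

theorem contDiffAt_distinguished_of_mem (hM : 0 < M) (hU : IsOpen U)
    (hd : IsDistinguished M U r₀ k) (hq : (E, L) ∈ U) :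
    ContDiffAt ℝ 2 (fun p : ℝ × ℝ => r₀ p.1 p.2) (E, L) :=
  contDiffAt_distinguished hU hM hd hq fun hk => by
    subst hk; exact twelve_mul_sq_lt hM hU hd hq

theorem Regular.le_distinguished (hM : 0 < M) (hd : IsDistinguished M U r₀ k)
    (h : Regular M U k r₀ r E L) : 2 * M ≤ r₀ E L := two_mul_le_distinguished hM hd h.2.1

theorem Regular.radialPath_pos (hM : 0 < M) (hd : IsDistinguished M U r₀ k)
    (h : Regular M U k r₀ r E L) {x : ℝ} (hx : x ∈ Icc (0 : ℝ) 1) :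
    0 < radialPath (r₀ E L) r x := by
  have := two_mul_le_of_mem_uIcc (h.le_distinguished hM hd) h.1 (radialPath_mem_uIcc _ r hx)
  linarith

theorem contDiffAt_distinguished_fibre (hM : 0 < M) (hU : IsOpen U)
    (hd : IsDistinguished M U r₀ k) {p : ℝ × ℝ × ℝ} (hp : (p.1, p.2.1) ∈ U) (x : ℝ) :
    ContDiffAt ℝ 2 (fun w : (ℝ × ℝ × ℝ) × ℝ => r₀ w.1.1 w.1.2.1) (p, x) := by
  have h := contDiffAt_distinguished_of_mem hM hU hd hp
  exact h.comp (f := fun w : (ℝ × ℝ × ℝ) × ℝ => (w.1.1, w.1.2.1)) (p, x) (by fun_prop)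

theorem contDiffAt_speedCore_fibre (hM : 0 < M) (hU : IsOpen U)
    (hd : IsDistinguished M U r₀ k) {p : ℝ × ℝ × ℝ} (hp : p ∈ regularSet M U k r₀) {x : ℝ}
    (hx : x ∈ Icc (0 : ℝ) 1) :
    ContDiffAt ℝ 2 (fun w : (ℝ × ℝ × ℝ) × ℝ =>
      speedCore k M w.1.1 w.1.2.1 (r₀ w.1.1 w.1.2.1) w.1.2.2 w.2) (p, x) :=
  contDiffAt_speedCore k (by fun_prop) (by fun_prop)
    (contDiffAt_distinguished_fibre hM hU hd hp.2.1 x) (by fun_prop) (by fun_prop)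
    (Regular.radialPath_pos hM hd hp hx).ne'

/-- Positivity of `speedCore` on `[0, 1]` persists for nearby data by compactness, and it
characterises regularity. -/
theorem isOpen_regularSet (hM : 0 < M) (hU : IsOpen U) (hd : IsDistinguished M U r₀ k) :
    IsOpen (regularSet M U k r₀) := by
  rw [isOpen_iff_eventually]
  intro p hp
  have h1 : ∀ᶠ q : ℝ × ℝ × ℝ in 𝓝 p, (q.1, q.2.1) ∈ U := by
    have : ContinuousAt (fun q : ℝ × ℝ × ℝ => (q.1, q.2.1)) p := by fun_prop
    exact this.eventually (hU.mem_nhds hp.2.1)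
  have h2 : ∀ᶠ q : ℝ × ℝ × ℝ in 𝓝 p, 2 * M < q.2.2 := by
    have : ContinuousAt (fun q : ℝ × ℝ × ℝ => q.2.2) p := by fun_prop
    exact this.eventually_const_lt hp.1
  have h3 : ∀ᶠ q : ℝ × ℝ × ℝ in 𝓝 p, ∀ x ∈ Icc (0 : ℝ) 1,
      0 < speedCore k M q.1 q.2.1 (r₀ q.1 q.2.1) q.2.2 x :=
    isCompact_Icc.eventually_forall_of_forall_eventually fun x hx =>
      (contDiffAt_speedCore_fibre hM hU hd hp hx).continuousAt.eventually_const_lt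
        (Regular.speedCore_pos hM hd hp hx)
  filter_upwards [h1, h2, h3] with q hq1 hq2 hq3
  exact regular_of_speedCore_pos hM hd hq1 hq2 hq3

/-- In the variable `x` the only denominator is `√speedCore`, positive up to and including `x = 0`.
Two derivatives are kept because the prolonged generator differentiates the proper time twice. -/
theorem contDiffAt_radialKernel (hM : 0 < M) (hU : IsOpen U)
    (hd : IsDistinguished M U r₀ k) {p : ℝ × ℝ × ℝ} (hp : p ∈ regularSet M U k r₀)
    {g : ℝ × ℝ × ℝ → ℝ}
    (hg : ∀ y ∈ uIcc (r₀ p.1 p.2.1) p.2.2, ContDiffAt ℝ 2 g (p.1, p.2.1, y)) {x : ℝ}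
    (hx : x ∈ Icc (0 : ℝ) 1) : ContDiffAt ℝ 2 (radialKernel M k r₀ g) (p, x) := by
  have ha := contDiffAt_distinguished_fibre hM hU hd hp.2.1 x
  have hc := contDiffAt_speedCore_fibre hM hU hd hp hx
  have hpos := Regular.speedCore_pos hM hd hp hx
  have hpath : ContDiffAt ℝ 2 (fun w : (ℝ × ℝ × ℝ) × ℝ =>
      radialPath (r₀ w.1.1 w.1.2.1) w.1.2.2 w.2) (p, x) :=
    contDiffAt_radialPath ha (by fun_prop) (by fun_prop)
  have hg1 : ContDiffAt ℝ 2 (fun w : (ℝ × ℝ × ℝ) × ℝ =>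
      g (w.1.1, w.1.2.1, radialPath (r₀ w.1.1 w.1.2.1) w.1.2.2 w.2)) (p, x) := by
    refine ContDiffAt.comp (p, x) (g := g) (f := fun w : (ℝ × ℝ × ℝ) × ℝ =>
      (w.1.1, w.1.2.1, radialPath (r₀ w.1.1 w.1.2.1) w.1.2.2 w.2))
      (hg _ (radialPath_mem_uIcc _ _ hx)) ?_
    exact ContDiffAt.prodMk (by fun_prop) (ContDiffAt.prodMk (by fun_prop) hpath)
  have hw : ContDiffAt ℝ 2 (fun w : (ℝ × ℝ × ℝ) × ℝ => speedWeight k w.2) (p, x) :=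
    (contDiff_speedWeight k).contDiffAt.comp (p, x) contDiffAt_snd
  have hr : ContDiffAt ℝ 2 (fun w : (ℝ × ℝ × ℝ) × ℝ => w.1.2.2) (p, x) := by fun_prop
  unfold radialKernel
  exact (hg1.mul ((contDiffAt_const.mul (hr.sub ha)).mul hw)).div (hc.sqrt hpos.ne')
    (Real.sqrt_ne_zero'.2 hpos)

theorem sqrt_radialSq_radialPath (hM : 0 < M) (hd : IsDistinguished M U r₀ k)
    (h : Regular M U k r₀ r E L) {x : ℝ} (hx : x ∈ Icc (0 : ℝ) 1) :
    √(radialSq M E L (radialPath (r₀ E L) r x)) * speedWeight k x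
      = x * √(speedCore k M E L (r₀ E L) r x) := by
  have h1 := radialSq_radialPath hM hd h.2.1 h.1 hx
  have hw : 0 ≤ speedWeight k x := by
    cases k <;> simp [speedWeight, hx.1]
  have h2 := congrArg Real.sqrt h1
  rwa [Real.sqrt_mul' _ (sq_nonneg _), Real.sqrt_sq hw, Real.sqrt_mul (sq_nonneg _),
    Real.sqrt_sq hx.1] at h2

/-- The factor `x` of `dy = 2 (r - r₀) x dx` absorbs the singularity of `1/√Q`. -/
theorem div_sqrt_radialSq_mul (hM : 0 < M) (hd : IsDistinguished M U r₀ k)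
    (h : Regular M U k r₀ r E L) {x : ℝ} (hx : x ∈ Ioc (0 : ℝ) 1) (c : ℝ) :
    c / √(radialSq M E L (radialPath (r₀ E L) r x)) * x
      = c * speedWeight k x / √(speedCore k M E L (r₀ E L) r x) := by
  have h1 := sqrt_radialSq_radialPath hM hd h (Ioc_subset_Icc_self hx)
  have h2 := Real.sqrt_pos.2 (h.pos_of_pos hx hd)
  have h3 := Real.sqrt_pos.2 (h.speedCore_pos hM hd (Ioc_subset_Icc_self hx))
  rw [div_mul_eq_mul_div, div_eq_div_iff h2.ne' h3.ne']
  linear_combination -c * h1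

theorem continuousOn_radialSq {s : Set ℝ} (h : ∀ y ∈ s, y ≠ 0) :
    ContinuousOn (radialSq M E L) s := by
  unfold radialSq
  refine ContinuousOn.sub (by fun_prop) (ContinuousOn.mul ?_ ?_)
  · exact continuousOn_const.sub (continuousOn_const.div continuousOn_id h)
  · exact continuousOn_const.add (continuousOn_const.div (by fun_prop)
      fun y hy => pow_ne_zero 2 (h y hy))

theorem continuousOn_speedCore (hM : 0 < M) (hd : IsDistinguished M U r₀ k)
    (h : Regular M U k r₀ r E L) :
    ContinuousOn (speedCore k M E L (r₀ E L) r) (Icc 0 1) := fun _ hx =>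
  (contDiffAt_speedCore (n := 0) k contDiffAt_const contDiffAt_const contDiffAt_const
    contDiffAt_const contDiffAt_id (h.radialPath_pos hM hd hx).ne').continuousAt.continuousWithinAt

theorem image_radialPath (a r : ℝ) : radialPath a r '' Icc 0 1 = uIcc a r := by
  ext y
  constructor
  · rintro ⟨x, hx, rfl⟩; exact radialPath_mem_uIcc a r hx
  · intro hy
    obtain ⟨x, hx, h⟩ := exists_radialPath_eq hy
    exact ⟨x, hx, h⟩

/-- The substitution `y = radialPath r₀ r x` in an integral against `dy / |v|`. -/
theorem radialIntegral_substitution (hM : 0 < M) (hd : IsDistinguished M U r₀ k)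
    (h : Regular M U k r₀ r E L) {g : ℝ → ℝ} (hg : ContinuousOn g (uIcc (r₀ E L) r)) :
    IntervalIntegrable (fun y => g y / √(radialSq M E L y)) MeasureTheory.volume (r₀ E L) r ∧
    IntervalIntegrable (fun x => g (radialPath (r₀ E L) r x) /
      √(radialSq M E L (radialPath (r₀ E L) r x)) * (2 * (r - r₀ E L) * x))
      MeasureTheory.volume 0 1 ∧
    ∫ x in (0 : ℝ)..1, g (radialPath (r₀ E L) r x) /
      √(radialSq M E L (radialPath (r₀ E L) r x)) * (2 * (r - r₀ E L) * x) =
      ∫ y in (r₀ E L)..r, g y / √(radialSq M E L y) := by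
  set a := r₀ E L with ha
  have hgp : ContinuousOn (fun x => g (radialPath a r x)) (Icc 0 1) :=
    hg.comp (continuous_radialPath a r).continuousOn fun x hx => radialPath_mem_uIcc a r hx
  have hcont : ∀ c : ℝ, ContinuousOn (fun x => g (radialPath a r x) * (2 * c) *
      speedWeight k x / √(speedCore k M E L a r x)) (Icc 0 1) := fun c =>
    ((hgp.mul continuousOn_const).mul (continuous_speedWeight k).continuousOn).div
      (continuousOn_speedCore hM hd h).sqrt
      fun x hx => Real.sqrt_ne_zero'.2 (h.speedCore_pos hM hd hx)
  have hint : ∀ c : ℝ, MeasureTheory.IntegrableOn (fun x => g (radialPath a r x) /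
      √(radialSq M E L (radialPath a r x)) * (2 * c * x)) (Icc 0 1) := by
    intro c
    rw [integrableOn_Icc_iff_integrableOn_Ioc]
    refine (((hcont c).integrableOn_Icc).mono_set Ioc_subset_Icc_self).congr_fun
      (fun x hx => ?_) measurableSet_Ioc
    dsimp only
    rw [← div_sqrt_radialSq_mul hM hd h hx]
    ring
  have hI2 : IntervalIntegrable (fun x => g (radialPath a r x) /
      √(radialSq M E L (radialPath a r x)) * (2 * (r - a) * x))
      MeasureTheory.volume 0 1 := by
    rw [intervalIntegrable_iff_integrableOn_Icc_of_le zero_le_one]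
    exact hint (r - a)
  -- For `r = a` the path is constant, so the change of variables through an injective map is
  -- unavailable; both integrals are then zero.
  rcases eq_or_ne r a with hra | hra
  · refine ⟨by rw [hra], hI2, ?_⟩
    rw [hra]; simp
  have hinj : InjOn (radialPath a r) (Icc 0 1) := by
    intro x hx y hy hxy
    have h1 : (r - a) * x ^ 2 = (r - a) * y ^ 2 := by
      unfold radialPath at hxy; linarith
    have h2 := mul_left_cancel₀ (sub_ne_zero.2 hra) h1
    exact (pow_left_inj₀ hx.1 hy.1 two_ne_zero).1 h2
  have hI1 : MeasureTheory.IntegrableOn (fun y => g y / √(radialSq M E L y)) (uIcc a r) := by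
    rw [← image_radialPath, MeasureTheory.integrableOn_image_iff_integrableOn_abs_deriv_smul
      measurableSet_Icc (fun x _ => (hasDerivAt_radialPath a r x).hasDerivWithinAt) hinj]
    refine (hint |r - a|).congr_fun (fun x hx => ?_) measurableSet_Icc
    simp only [smul_eq_mul, abs_mul, abs_of_nonneg hx.1]
    norm_num; ring
  refine ⟨?_, hI2, ?_⟩
  · exact (intervalIntegrable_iff' (by simp)).2 hI1
  · have := intervalIntegral.integral_comp_mul_deriv''' (a := 0) (b := 1) (f := radialPath a r)
      (f' := fun x => 2 * (r - a) * x) (g := fun y => g y / √(radialSq M E L y))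
      (continuous_radialPath a r).continuousOn
      (fun x _ => (hasDerivAt_radialPath a r x).hasDerivWithinAt) ?_ ?_ ?_
    · rw [radialPath_zero, radialPath_one] at this
      exact this
    · rw [min_eq_left zero_le_one, max_eq_right zero_le_one]
      have hsub : radialPath a r '' Ioo 0 1 ⊆ uIcc a r := by
        rw [← image_radialPath]; exact image_mono Ioo_subset_Icc_self
      refine (hg.mono hsub).div (continuousOn_radialSq ?_).sqrt ?_
      · rintro y ⟨x, hx, rfl⟩
        exact (h.radialPath_pos hM hd (Ioo_subset_Icc_self hx)).ne'
      · rintro y ⟨x, hx, rfl⟩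
        exact Real.sqrt_ne_zero'.2 (h.pos_of_pos (Ioo_subset_Ioc_self hx) hd)
    · rw [uIcc_of_le zero_le_one, image_radialPath]; exact hI1
    · rw [uIcc_of_le zero_le_one]; exact hint (r - a)

theorem radialIntegral_eq (hM : 0 < M) (hd : IsDistinguished M U r₀ k) {p : ℝ × ℝ × ℝ}
    (hp : p ∈ regularSet M U k r₀) {g : ℝ × ℝ × ℝ → ℝ}
    (hg : ContinuousOn (fun y => g (p.1, p.2.1, y)) (uIcc (r₀ p.1 p.2.1) p.2.2)) :
    radialIntegral M r₀ g p = ∫ x in (0 : ℝ)..1, radialKernel M k r₀ g (p, x) := by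
  rw [radialIntegral, ← (radialIntegral_substitution hM hd hp hg).2.2]
  -- The integrands are compared only for `x > 0`; the value at `x = 0`, where `√Q` may vanish, does
  -- not matter.
  refine intervalIntegral.integral_congr_ae (Eventually.of_forall fun x hx => ?_)
  rw [uIoc_of_le zero_le_one] at hx
  unfold radialKernel
  have := div_sqrt_radialSq_mul hM hd hp hx (g (p.1, p.2.1, radialPath (r₀ p.1 p.2.1) p.2.2 x)
    * (2 * (p.2.2 - r₀ p.1 p.2.1)))
  simp only [← mul_assoc] at this ⊢
  rw [← this]
  ring

/-- Smoothness of `g` on a neighbourhood of the radial segment of `p`. -/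
def SmoothAlong (r₀ : ℝ → ℝ → ℝ) (g : ℝ × ℝ × ℝ → ℝ) (p : ℝ × ℝ × ℝ) : Prop :=
  ∀ y ∈ uIcc (r₀ p.1 p.2.1) p.2.2, ContDiffAt ℝ 2 g (p.1, p.2.1, y)

theorem SmoothAlong.continuousOn {g : ℝ × ℝ × ℝ → ℝ} {p : ℝ × ℝ × ℝ}
    (h : SmoothAlong r₀ g p) :
    ContinuousOn (fun y => g (p.1, p.2.1, y)) (uIcc (r₀ p.1 p.2.1) p.2.2) := fun y hy =>
  ((h y hy).continuousAt.comp (f := fun y => (p.1, p.2.1, y)) (by fun_prop)).continuousWithinAt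

theorem eventually_radialIntegral_eq (hM : 0 < M) (hU : IsOpen U) (hd : IsDistinguished M U r₀ k)
    {p : ℝ × ℝ × ℝ} (hp : p ∈ regularSet M U k r₀) {g : ℝ × ℝ × ℝ → ℝ}
    (hg : ∀ q ∈ regularSet M U k r₀, SmoothAlong r₀ g q) :
    radialIntegral M r₀ g =ᶠ[𝓝 p] fun q => ∫ x in (0 : ℝ)..1, radialKernel M k r₀ g (q, x) := by
  filter_upwards [(isOpen_regularSet hM hU hd).mem_nhds hp] with q hq
  exact radialIntegral_eq hM hd hq (hg q hq).continuousOn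

/-- Since regularity is open, the integral equals its form over the fixed interval `[0, 1]` in a
whole neighbourhood, and differentiation under the integral applies to that form. -/
theorem contDiffAt_radialIntegral (hM : 0 < M) (hU : IsOpen U) (hd : IsDistinguished M U r₀ k)
    {p : ℝ × ℝ × ℝ} (hp : p ∈ regularSet M U k r₀) {g : ℝ × ℝ × ℝ → ℝ}
    (hg : ∀ q ∈ regularSet M U k r₀, SmoothAlong r₀ g q) :
    ContDiffAt ℝ 2 (radialIntegral M r₀ g) p := by
  refine ContDiffAt.congr_of_eventuallyEq ?_ (eventually_radialIntegral_eq hM hU hd hp hg)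
  exact contDiffAt_integral_fibre 2 fun x hx => contDiffAt_radialKernel hM hU hd hp (hg p hp) hx

theorem hasDerivAt_integral_radius (hM : 0 < M) (hd : IsDistinguished M U r₀ k)
    (h : Regular M U k r₀ r E L) {g : ℝ → ℝ} (hg : ContinuousOn g (uIcc (r₀ E L) r))
    (hgm : Measurable g) (hgr : ContinuousAt g r) :
    HasDerivAt (fun x => ∫ y in (r₀ E L)..x, g y / √(radialSq M E L y))
      (g r / √(radialSq M E L r)) r := by
  refine intervalIntegral.integral_hasDerivAt_right
    (radialIntegral_substitution hM hd h hg).1 ?_ ?_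
  · refine (Measurable.stronglyMeasurable ?_).stronglyMeasurableAtFilter
    unfold radialSq; fun_prop
  · have hr0 : r ≠ 0 := by linarith [h.1]
    refine hgr.div (ContinuousAt.sqrt ?_) (Real.sqrt_ne_zero'.2 h.2.2.1)
    exact (contDiffAt_radialSq (n := 0) contDiffAt_const contDiffAt_const contDiffAt_id
      hr0).continuousAt

/-- Differentiation of a radial integral along a curve in the plane of `(E, L)`. -/
theorem hasDerivAt_radialIntegral (hM : 0 < M) (hU : IsOpen U) (hd : IsDistinguished M U r₀ k)
    {e l d : ℝ → ℝ} {ε a' b : ℝ} (h : Regular M U k r₀ r (e ε) (l ε)) {g : ℝ × ℝ × ℝ → ℝ}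
    (hg : ∀ q ∈ regularSet M U k r₀, SmoothAlong r₀ g q)
    (he : ContDiffAt ℝ 1 e ε) (hl : ContDiffAt ℝ 1 l ε)
    (ha : HasDerivAt (fun x => r₀ (e x) (l x)) a' ε)
    (hdc : ContinuousOn d (uIcc (r₀ (e ε) (l ε)) r))
    (hder : ∀ y, 2 * M < y → 0 < radialSq M (e ε) (l ε) y →
      HasDerivAt (fun x => g (e x, l x, y) / √(radialSq M (e x) (l x) y))
        (d y / √(radialSq M (e ε) (l ε) y)) ε)
    (hb : Tendsto (fun x => g (e ε, l ε, radialPath (r₀ (e ε) (l ε)) r x) /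
      √(radialSq M (e ε) (l ε) (radialPath (r₀ (e ε) (l ε)) r x))) (𝓝[>] 0) (𝓝 b)) :
    HasDerivAt (fun x => radialIntegral M r₀ g (e x, l x, r))
      ((∫ y in (r₀ (e ε) (l ε))..r, d y / √(radialSq M (e ε) (l ε) y)) - b * a') ε := by
  have hp : (e ε, l ε, r) ∈ regularSet M U k r₀ := h
  have hcurve : ContDiffAt ℝ 1 (fun x => (e x, l x, r)) ε := he.prodMk (hl.prodMk contDiffAt_const)
  have hev : ∀ᶠ x in 𝓝 ε, (e x, l x, r) ∈ regularSet M U k r₀ :=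
    hcurve.continuousAt.eventually ((isOpen_regularSet hM hU hd).mem_nhds hp)
  have hsub := radialIntegral_substitution hM hd h hdc
  rw [← hsub.2.2]
  have hmain := hasDerivAt_integral_radialPath (a := fun x => r₀ (e x) (l x))
    (d := fun y => d y / √(radialSq M (e ε) (l ε) y)) (r := r) (e := ε) (b := b)
    (K := fun w => radialKernel M k r₀ g ((e w.1, l w.1, r), w.2))
    (h := fun w => g (e w.1, l w.1, w.2) / √(radialSq M (e w.1) (l w.1) w.2)) ha ?_ ?_ ?_ ?_
    hsub.2.1 hb
  · refine hmain.congr_of_eventuallyEq ?_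
    filter_upwards [hev] with x hx
    exact radialIntegral_eq hM hd hx (hg _ hx).continuousOn
  · intro x hx
    have h1 := (contDiffAt_radialKernel hM hU hd hp (hg _ hp) hx).of_le one_le_two
    refine h1.comp (f := fun w : ℝ × ℝ => ((e w.1, l w.1, r), w.2)) (ε, x) ?_
    refine ContDiffAt.prodMk ?_ contDiffAt_snd
    exact hcurve.comp (ε, x) contDiffAt_fst
  · intro x hx
    filter_upwards [hev] with t ht
    have := div_sqrt_radialSq_mul hM hd ht (Ioo_subset_Ioc_self hx)
      (g (e t, l t, radialPath (r₀ (e t) (l t)) r x) * (2 * (r - r₀ (e t) (l t))))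
    unfold radialKernel
    simp only [← mul_assoc] at this ⊢
    rw [← this]
    ring
  · intro x hx
    have hx' := Ioc_subset_Icc_self hx
    have hpos := h.pos_of_pos hx hd
    have he' : ContDiffAt ℝ 1 (fun w : ℝ × ℝ => e w.1)
      (ε, radialPath (r₀ (e ε) (l ε)) r x) := he.comp _ contDiffAt_fst
    have hl' : ContDiffAt ℝ 1 (fun w : ℝ × ℝ => l w.1)
      (ε, radialPath (r₀ (e ε) (l ε)) r x) := hl.comp _ contDiffAt_fst
    refine ContDiffAt.differentiableAt (n := 1) (ContDiffAt.div ?_ (ContDiffAt.sqrt ?_ hpos.ne')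
      (Real.sqrt_ne_zero'.2 hpos)) one_ne_zero
    · refine ((hg _ hp _ (radialPath_mem_uIcc _ _ hx')).of_le one_le_two).comp
        (f := fun w : ℝ × ℝ => (e w.1, l w.1, w.2)) (ε, radialPath (r₀ (e ε) (l ε)) r x) ?_
      exact he'.prodMk (hl'.prodMk contDiffAt_snd)
    · exact contDiffAt_radialSq he' hl' contDiffAt_snd (h.radialPath_pos hM hd hx').ne'
  · intro x hx
    exact hder _ (two_mul_lt_radialPath (h.le_distinguished hM hd) h.1
      (Ioo_subset_Ioc_self hx)) (h.pos_of_pos (Ioo_subset_Ioc_self hx) hd)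

end SchwarzschildLRL
end

/-! ### Derivatives of the radial integrals in `E`, `L` and along the scaling flow -/

noncomputable section
namespace SchwarzschildLRL

variable {M : ℝ} {U : Set (ℝ × ℝ)} {k : PointKind} {r₀ : ℝ → ℝ → ℝ} {E L r : ℝ}

theorem hasDerivAt_radialSq (M y : ℝ) {e l : ℝ → ℝ} {e' l' ε : ℝ} (he : HasDerivAt e e' ε)
    (hl : HasDerivAt l l' ε) :
    HasDerivAt (fun x => radialSq M (e x) (l x) y)
      (2 * e ε * e' - (1 - 2 * M / y) * (2 * l ε * l' / y ^ 2)) ε := by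
  have h := (he.pow 2).sub ((((hl.pow 2).div_const (y ^ 2)).const_add 1).const_mul (1 - 2 * M / y))
  refine h.congr_deriv ?_
  norm_num

/-- The derivative is written again as a numerator over `√q`, the shape that
`hasDerivAt_radialIntegral` expects. -/
theorem hasDerivAt_div_sqrt {G q : ℝ → ℝ} {G' q' ε : ℝ} (hG : HasDerivAt G G' ε)
    (hq : HasDerivAt q q' ε) (h0 : 0 < q ε) :
    HasDerivAt (fun x => G x / √(q x)) ((G' - G ε * q' / (2 * q ε)) / √(q ε)) ε := by
  have hs := Real.sqrt_pos.2 h0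
  refine (hG.div (hq.sqrt h0.ne') hs.ne').congr_deriv ?_
  have h2 : √(q ε) ^ 2 = q ε := Real.sq_sqrt h0.le
  rw [← h2, Real.sqrt_sq hs.le]
  field_simp

theorem radialSq_pos_of_ne_turning (hk : k ≠ .turning) (h : Regular M U k r₀ r E L) {y : ℝ}
    (hy : y ∈ uIcc (r₀ E L) r) : 0 < radialSq M E L y :=
  h.2.2.2 y hy fun h => absurd h hk

/-- `hasDerivAt_radialIntegral` when the integrand is regular at the distinguished point. -/
theorem hasDerivAt_radialIntegral_of_ne_turning (hk : k ≠ .turning) (hM : 0 < M) (hU : IsOpen U)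
    (hd : IsDistinguished M U r₀ k)
    {e l d : ℝ → ℝ} {ε a' : ℝ} (he0 : e ε = E) (hl0 : l ε = L)
    (h : Regular M U k r₀ r E L) {g : ℝ × ℝ × ℝ → ℝ}
    (hg : ∀ q ∈ regularSet M U k r₀, SmoothAlong r₀ g q)
    (he : ContDiffAt ℝ 1 e ε) (hl : ContDiffAt ℝ 1 l ε)
    (ha : HasDerivAt (fun x => r₀ (e x) (l x)) a' ε)
    (hdc : ContinuousOn d (uIcc (r₀ E L) r))
    (hder : ∀ y, 2 * M < y → 0 < radialSq M E L y →
      HasDerivAt (fun x => g (e x, l x, y) / √(radialSq M (e x) (l x) y))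
        (d y / √(radialSq M E L y)) ε) :
    HasDerivAt (fun x => radialIntegral M r₀ g (e x, l x, r))
      ((∫ y in (r₀ E L)..r, d y / √(radialSq M E L y)) -
        g (E, L, r₀ E L) / √(radialSq M E L (r₀ E L)) * a') ε := by
  subst he0 hl0
  refine hasDerivAt_radialIntegral hM hU hd h hg he hl ha hdc hder ?_
  have hp : (e ε, l ε, r) ∈ regularSet M U k r₀ := h
  have h1 : ContinuousAt (fun x => radialPath (r₀ (e ε) (l ε)) r x) 0 :=
    (continuous_radialPath _ _).continuousAt
  have h0 : r₀ (e ε) (l ε) ∈ uIcc (r₀ (e ε) (l ε)) r := left_mem_uIcc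
  have hy0 : r₀ (e ε) (l ε) ≠ 0 := by linarith [h.le_distinguished hM hd]
  have h2 : ContinuousAt (fun y => g (e ε, l ε, y) / √(radialSq M (e ε) (l ε) y))
      (radialPath (r₀ (e ε) (l ε)) r 0) := by
    rw [radialPath_zero]
    refine ContinuousAt.div ?_ (ContinuousAt.sqrt ?_)
      (Real.sqrt_ne_zero'.2 (radialSq_pos_of_ne_turning hk h h0))
    · exact (hg _ hp _ h0).continuousAt.comp (f := fun y => (e ε, l ε, y)) (by fun_prop)
    · exact (contDiffAt_radialSq (n := 0) contDiffAt_const contDiffAt_const contDiffAt_id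
        hy0).continuousAt
  have h3 := (ContinuousAt.comp (f := fun x => radialPath (r₀ (e ε) (l ε)) r x) (x := 0)
    h2 h1).tendsto.mono_left (nhdsWithin_le_nhds (s := Ioi 0))
  simpa [Function.comp_def, radialPath_zero] using h3

theorem fderiv_fst_eq {f : ℝ × ℝ × ℝ → ℝ} {p : ℝ × ℝ × ℝ} {v : ℝ} (hf : DifferentiableAt ℝ f p)
    (h : HasDerivAt (fun x => f (x, p.2.1, p.2.2)) v p.1) : fderiv ℝ f p (1, 0, 0) = v := by
  refine HasDerivAt.unique ?_ h
  exact hf.hasFDerivAt.comp_hasDerivAt (f := fun x => (x, p.2.1, p.2.2)) p.1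
    ((hasDerivAt_id _).prodMk ((hasDerivAt_const _ _).prodMk (hasDerivAt_const _ _)))

theorem fderiv_snd_eq {f : ℝ × ℝ × ℝ → ℝ} {p : ℝ × ℝ × ℝ} {v : ℝ} (hf : DifferentiableAt ℝ f p)
    (h : HasDerivAt (fun x => f (p.1, x, p.2.2)) v p.2.1) : fderiv ℝ f p (0, 1, 0) = v := by
  refine HasDerivAt.unique ?_ h
  exact hf.hasFDerivAt.comp_hasDerivAt (f := fun x => (p.1, x, p.2.2)) p.2.1
    ((hasDerivAt_const _ _).prodMk ((hasDerivAt_id _).prodMk (hasDerivAt_const _ _)))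

theorem fderiv_thd_eq {f : ℝ × ℝ × ℝ → ℝ} {p : ℝ × ℝ × ℝ} {v : ℝ} (hf : DifferentiableAt ℝ f p)
    (h : HasDerivAt (fun x => f (p.1, p.2.1, x)) v p.2.2) : fderiv ℝ f p (0, 0, 1) = v := by
  refine HasDerivAt.unique ?_ h
  exact hf.hasFDerivAt.comp_hasDerivAt (f := fun x => (p.1, p.2.1, x)) p.2.2
    ((hasDerivAt_const _ _).prodMk ((hasDerivAt_const _ _).prodMk (hasDerivAt_id _)))

theorem map_triple (D : ℝ × ℝ × ℝ →L[ℝ] ℝ) (u v w : ℝ) :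
    D (u, v, w) = u * D (1, 0, 0) + v * D (0, 1, 0) + w * D (0, 0, 1) := by
  have : (u, v, w) = u • ((1 : ℝ), (0 : ℝ), (0 : ℝ)) + v • ((0 : ℝ), (1 : ℝ), (0 : ℝ))
      + w • ((0 : ℝ), (0 : ℝ), (1 : ℝ)) := by simp
  rw [this, map_add, map_add, map_smul, map_smul, map_smul, smul_eq_mul, smul_eq_mul, smul_eq_mul]

/-! ### The three radial integrals -/

theorem smoothAlong_of_pos (hM : 0 < M) (hd : IsDistinguished M U r₀ k) {g : ℝ × ℝ × ℝ → ℝ}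
    (hg : ∀ e l y : ℝ, 0 < y → ContDiffAt ℝ 2 g (e, l, y)) :
    ∀ q ∈ regularSet M U k r₀, SmoothAlong r₀ g q := by
  intro q hq y hy
  have := two_mul_le_of_mem_uIcc (two_mul_le_distinguished hM hd hq.2.1) hq.1 hy
  exact hg _ _ _ (by linarith)

theorem smoothAlong_of_two_mul_lt (hM : 0 < M) (hk : k ≠ .horizon)
    (hd : IsDistinguished M U r₀ k) {g : ℝ × ℝ × ℝ → ℝ}
    (hg : ∀ e l y : ℝ, 2 * M < y → ContDiffAt ℝ 2 g (e, l, y)) :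
    ∀ q ∈ regularSet M U k r₀, SmoothAlong r₀ g q := by
  intro q hq y hy
  exact hg _ _ _ (two_mul_lt_of_mem_uIcc (two_mul_lt_distinguished hM hd hk hq.2.1) hq.1 hy)

theorem smoothAlong_one (q : ℝ × ℝ × ℝ) : SmoothAlong r₀ (fun _ => 1) q :=
  fun _ _ => contDiffAt_const

theorem smoothAlong_angle (hM : 0 < M) (hd : IsDistinguished M U r₀ k) :
    ∀ q ∈ regularSet M U k r₀, SmoothAlong r₀ (fun q => q.2.1 / q.2.2 ^ 2) q :=
  smoothAlong_of_pos hM hd fun e l y hy =>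
    ContDiffAt.div (by fun_prop) (by fun_prop) (pow_ne_zero 2 hy.ne')

theorem smoothAlong_time (hM : 0 < M) (hk : k ≠ .horizon) (hd : IsDistinguished M U r₀ k) :
    ∀ q ∈ regularSet M U k r₀,
      SmoothAlong r₀ (fun q => q.1 * q.2.2 / (q.2.2 - 2 * M)) q :=
  smoothAlong_of_two_mul_lt hM hk hd fun e l y hy =>
    ContDiffAt.div (by fun_prop) (by fun_prop) (sub_ne_zero.2 hy.ne')

theorem properTimeIntegral_one (p : ℝ × ℝ × ℝ) :
    properTimeIntegral M 1 p.1 p.2.1 (r₀ p.1 p.2.1) p.2.2 =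
      radialIntegral M r₀ (fun _ => 1) p := by
  simp [properTimeIntegral, radialIntegral, radialSpeed]

theorem mul_angleIntegral_one (p : ℝ × ℝ × ℝ) :
    p.2.1 * angleIntegral M 1 p.1 p.2.1 (r₀ p.1 p.2.1) p.2.2 =
      radialIntegral M r₀ (fun q => q.2.1 / q.2.2 ^ 2) p := by
  simp only [angleIntegral, radialIntegral, radialSpeed, ← intervalIntegral.integral_const_mul]
  congr 1; ext y
  rw [one_mul, mul_one_div, div_div]

theorem mul_timeIntegral_one (hM : 0 < M) (hk : k ≠ .horizon) (hd : IsDistinguished M U r₀ k)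
    {p : ℝ × ℝ × ℝ} (hp : (p.1, p.2.1) ∈ U) :
    p.1 * timeIntegral M 1 p.1 p.2.1 (r₀ p.1 p.2.1) p.2.2 =
      radialIntegral M r₀ (fun q => q.1 * q.2.2 / (q.2.2 - 2 * M)) p := by
  simp only [timeIntegral, if_neg (two_mul_lt_distinguished hM hd hk hp).ne', radialIntegral,
    radialSpeed, ← intervalIntegral.integral_const_mul]
  congr 1; ext y
  rw [one_mul, mul_div_assoc', div_div]

/-! ### Derivatives with respect to `E` and `L` for a centripetal or horizon point -/

section NeTurning

variable {a' : ℝ}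

/-- This is where turning points are left out: differentiating `1/√Q` produces a numerator with
`1/Q`, which is continuous on the closed segment only if `Q` is positive at `r₀` as well. -/
theorem continuousOn_div_radialSq (hk : k ≠ .turning) (hM : 0 < M) (hd : IsDistinguished M U r₀ k)
    (h : Regular M U k r₀ r E L) {g : ℝ → ℝ} (hg : ContinuousOn g (uIcc (r₀ E L) r)) :
    ContinuousOn (fun y => g y / radialSq M E L y) (uIcc (r₀ E L) r) := by
  refine hg.div (continuousOn_radialSq fun y hy => ?_)
    fun y hy => (radialSq_pos_of_ne_turning hk h hy).ne'
  have := two_mul_le_of_mem_uIcc (h.le_distinguished hM hd) h.1 hy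
  linarith

theorem continuousOn_angleDeriv (hM : 0 < M) (hd : IsDistinguished M U r₀ k)
    (h : Regular M U k r₀ r E L) :
    ContinuousOn (fun y => (1 - 2 * M / y) * L / y ^ 2) (uIcc (r₀ E L) r) := by
  have hy : ∀ y ∈ uIcc (r₀ E L) r, y ≠ 0 := fun y hy => by
    have := two_mul_le_of_mem_uIcc (h.le_distinguished hM hd) h.1 hy
    linarith
  refine ContinuousOn.div (ContinuousOn.mul (continuousOn_const.sub
    (continuousOn_const.div continuousOn_id hy)) continuousOn_const) (by fun_prop)
    fun y h => pow_ne_zero 2 (hy y h)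

theorem fderiv_properTime_fst (hk : k ≠ .turning) (hM : 0 < M) (hU : IsOpen U)
    (hd : IsDistinguished M U r₀ k) (h : Regular M U k r₀ r E L)
    (ha : HasDerivAt (fun x => r₀ x L) a' E) :
    fderiv ℝ (radialIntegral M r₀ fun _ => 1) (E, L, r) (1, 0, 0) =
      (∫ y in (r₀ E L)..r, -E / radialSq M E L y / √(radialSq M E L y)) -
        1 / √(radialSq M E L (r₀ E L)) * a' := by
  refine fderiv_fst_eq ((contDiffAt_radialIntegral hM hU hd (p := (E, L, r)) h
    fun q _ => smoothAlong_one q).differentiableAt (by norm_num)) ?_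
  refine hasDerivAt_radialIntegral_of_ne_turning (e := fun x => x) (l := fun _ => L) hk hM hU hd
    rfl rfl h (fun q _ => smoothAlong_one q) contDiffAt_id contDiffAt_const ha
    (continuousOn_div_radialSq hk hM hd h continuousOn_const) fun y hy hQ => ?_
  refine (hasDerivAt_div_sqrt (hasDerivAt_const E (1 : ℝ)) (hasDerivAt_radialSq M y
    (hasDerivAt_id' E) (hasDerivAt_const E L)) hQ).congr_deriv ?_
  congr 1
  field_simp
  ring

theorem fderiv_properTime_snd (hk : k ≠ .turning) (hM : 0 < M) (hU : IsOpen U)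
    (hd : IsDistinguished M U r₀ k) (h : Regular M U k r₀ r E L)
    (ha : HasDerivAt (fun x => r₀ E x) a' L) :
    fderiv ℝ (radialIntegral M r₀ fun _ => 1) (E, L, r) (0, 1, 0) =
      (∫ y in (r₀ E L)..r, (1 - 2 * M / y) * L / y ^ 2 / radialSq M E L y /
        √(radialSq M E L y)) - 1 / √(radialSq M E L (r₀ E L)) * a' := by
  refine fderiv_snd_eq ((contDiffAt_radialIntegral hM hU hd (p := (E, L, r)) h
    fun q _ => smoothAlong_one q).differentiableAt (by norm_num)) ?_
  refine hasDerivAt_radialIntegral_of_ne_turning (e := fun _ => E) (l := fun x => x) hk hM hU hd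
    rfl rfl h (fun q _ => smoothAlong_one q) contDiffAt_const contDiffAt_id ha
    (continuousOn_div_radialSq hk hM hd h (continuousOn_angleDeriv hM hd h)) fun y hy hQ => ?_
  have hy0 : 0 < y := by linarith
  refine (hasDerivAt_div_sqrt (hasDerivAt_const L (1 : ℝ)) (hasDerivAt_radialSq M y
    (hasDerivAt_const L E) (hasDerivAt_id' L)) hQ).congr_deriv ?_
  congr 1
  field_simp
  ring

theorem hasDerivAt_mul_exp (c : ℝ) : HasDerivAt (fun x => c * Real.exp x) c 0 := by
  simpa using (Real.hasDerivAt_exp 0).const_mul c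

/-- With `dQ/dε = 2 (Q + f)`, the integrand `(L/y²)/√Q` changes at the rate `(L/y²)(1 - (Q +
f)/Q)/√Q = -(f L/y²)/Q^(3/2)`. This is `-∂_L (1/√Q)`, so the interior integral matches the one in
`fderiv_properTime_snd`. -/
theorem hasDerivAt_angle_scaling (hk : k ≠ .turning) (hM : 0 < M) (hU : IsOpen U)
    (hd : IsDistinguished M U r₀ k) (h : Regular M U k r₀ r E L)
    (ha : HasDerivAt (fun x => r₀ (E * Real.exp x) (L * Real.exp x)) a' 0) :
    HasDerivAt (fun x => radialIntegral M r₀ (fun q => q.2.1 / q.2.2 ^ 2)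
        (E * Real.exp x, L * Real.exp x, r))
      (-(∫ y in (r₀ E L)..r, (1 - 2 * M / y) * L / y ^ 2 / radialSq M E L y /
        √(radialSq M E L y)) - L / r₀ E L ^ 2 / √(radialSq M E L (r₀ E L)) * a') 0 := by
  rw [← intervalIntegral.integral_neg]
  simp only [← neg_div]
  refine hasDerivAt_radialIntegral_of_ne_turning (g := fun q => q.2.1 / q.2.2 ^ 2)
    (d := fun y => -((1 - 2 * M / y) * L) / y ^ 2 / radialSq M E L y) hk hM hU hd
    (by simp) (by simp) h (smoothAlong_angle hM hd) (by fun_prop) (by fun_prop) ha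
    (continuousOn_div_radialSq hk hM hd h ?_) fun y hy hQ => ?_
  · exact (continuousOn_angleDeriv hM hd h).neg.congr fun y _ => neg_div _ _
  have hy0 : 0 < y := by linarith
  have h1 := hasDerivAt_div_sqrt ((hasDerivAt_mul_exp L).div_const (y ^ 2))
    (hasDerivAt_radialSq M y (hasDerivAt_mul_exp E) (hasDerivAt_mul_exp L)) (by simpa using hQ)
  simp only [Real.exp_zero, mul_one] at h1
  refine h1.congr_deriv ?_
  congr 1
  field_simp
  unfold radialSq
  field_simp
  ring

/-- The same cancellation gives `(E/f)(1 - (Q + f)/Q)/√Q = -E/Q^(3/2) = ∂_E (1/√Q)`, the interior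
integrand of `fderiv_properTime_fst`. The pole of `1/f` at the horizon keeps this case to
centripetal points. -/
theorem hasDerivAt_time_scaling (hk : k = .centripetal) (hM : 0 < M) (hU : IsOpen U)
    (hd : IsDistinguished M U r₀ k) (h : Regular M U k r₀ r E L)
    (ha : HasDerivAt (fun x => r₀ (E * Real.exp x) (L * Real.exp x)) a' 0) :
    HasDerivAt (fun x => radialIntegral M r₀ (fun q => q.1 * q.2.2 / (q.2.2 - 2 * M))
        (E * Real.exp x, L * Real.exp x, r))
      ((∫ y in (r₀ E L)..r, -E / radialSq M E L y / √(radialSq M E L y))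
        - E * r₀ E L / (r₀ E L - 2 * M) / √(radialSq M E L (r₀ E L)) * a') 0 := by
  have hk1 : k ≠ .turning := by simp [hk]
  refine hasDerivAt_radialIntegral_of_ne_turning
    (g := fun q => q.1 * q.2.2 / (q.2.2 - 2 * M)) hk1 hM hU hd
    (by simp) (by simp) h (smoothAlong_time hM (by simp [hk]) hd) (by fun_prop) (by fun_prop) ha
    (continuousOn_div_radialSq hk1 hM hd h continuousOn_const) fun y hy hQ => ?_
  have hy0 : 0 < y := by linarith
  have hy1 : 0 < y - 2 * M := by linarith
  have h1 := hasDerivAt_div_sqrt (((hasDerivAt_mul_exp E).mul_const y).div_const (y - 2 * M))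
    (hasDerivAt_radialSq M y (hasDerivAt_mul_exp E) (hasDerivAt_mul_exp L)) (by simpa using hQ)
  simp only [Real.exp_zero, mul_one] at h1
  refine h1.congr_deriv ?_
  congr 1
  field_simp
  unfold radialSq
  field_simp
  ring

end NeTurning

end SchwarzschildLRL
end

/-! ### Rates of the LRL angle and time: centripetal and horizon points -/

noncomputable section
namespace SchwarzschildLRL

variable {M : ℝ} {U : Set (ℝ × ℝ)} {k : PointKind} {r₀ : ℝ → ℝ → ℝ} {E L r : ℝ}

/-- The rate of change of the LRL angle under the scaling flow. -/
def angleRate (M : ℝ) (r₀ : ℝ → ℝ → ℝ) (E L : ℝ) : PointKind → ℝ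
  | .centripetal => cAngle M 1 r₀ E L
  | .turning => 0
  | .horizon => 0

/-- The rate of change of the LRL time under the scaling flow. -/
def timeRate (M : ℝ) (r₀ : ℝ → ℝ → ℝ) (E L : ℝ) : PointKind → ℝ
  | .centripetal => cTime M 1 r₀ E L
  | .turning => 0
  | .horizon => 0

theorem hasDerivAt_distinguished_comp (hM : 0 < M) (hU : IsOpen U)
    (hd : IsDistinguished M U r₀ k) {e l : ℝ → ℝ} {e' l' ε : ℝ} (he : HasDerivAt e e' ε)
    (hl : HasDerivAt l l' ε) (hq : (e ε, l ε) ∈ U) :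
    HasDerivAt (fun x => r₀ (e x) (l x))
      (fderiv ℝ (fun p : ℝ × ℝ => r₀ p.1 p.2) (e ε, l ε) (e', l')) ε :=
  ((contDiffAt_distinguished_of_mem hM hU hd hq).differentiableAt
    (by norm_num)).hasFDerivAt.comp_hasDerivAt (f := fun x => (e x, l x)) ε (he.prodMk hl)

/-! ### Centripetal points -/

/-- Implicit differentiation of the quadratic along a curve in `U`. The energy does not occur in it,
so `r₀` does not respond to `E`. -/
theorem centripetal_deriv (hU : IsOpen U)
    (hd : IsDistinguished M U r₀ .centripetal) {e l : ℝ → ℝ} {e' l' a' ε : ℝ}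
    (he : HasDerivAt e e' ε) (hl : HasDerivAt l l' ε) (hq : (e ε, l ε) ∈ U)
    (ha : HasDerivAt (fun x => r₀ (e x) (l x)) a' ε) :
    (2 * M * r₀ (e ε) (l ε) - l ε ^ 2) * a' =
      2 * l ε * l' * (r₀ (e ε) (l ε) - 3 * M) := by
  have h1 := (((ha.pow 2).const_mul M).sub ((hl.pow 2).mul ha)).add
    (((hl.pow 2).const_mul 3).mul_const M)
  have h2 : (fun x => M * r₀ (e x) (l x) ^ 2 - l x ^ 2 * r₀ (e x) (l x) + 3 * l x ^ 2 * M)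
      =ᶠ[𝓝 ε] fun _ => 0 := by
    have : ContinuousAt (fun x => (e x, l x)) ε := he.continuousAt.prodMk hl.continuousAt
    filter_upwards [this.eventually (hU.mem_nhds hq)] with x hx
    exact (hd.2 _ _ hx).2
  have h3 := h1.unique ((hasDerivAt_const ε (0 : ℝ)).congr_of_eventuallyEq h2)
  simp only [Pi.pow_apply] at h3
  norm_num at h3
  linear_combination h3

/-- The value `r₀ = 6M` belongs to the double root at `L² = 12M²`, which the strict bound on `L²`
rules out. -/
theorem centripetal_ne (hM : 0 < M) (hU : IsOpen U)
    (hd : IsDistinguished M U r₀ .centripetal) (hq : (E, L) ∈ U) :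
    L ≠ 0 ∧ 3 * M < r₀ E L ∧ r₀ E L ≠ 6 * M ∧ 2 * M * r₀ E L - L ^ 2 ≠ 0 := by
  obtain ⟨h1, h2⟩ := hd.2 E L hq
  obtain ⟨h3, h4⟩ := centripetal_bounds hM h1 h2
  have h5 := twelve_mul_sq_lt hM hU hd hq
  refine ⟨h3, h4, fun h6 => ?_, fun h6 => ?_⟩
  · rw [h6] at h2
    have : M * (3 * (L ^ 2 - 12 * M ^ 2)) = 0 := by linear_combination -h2
    rcases mul_eq_zero.1 this with h7 | h7 <;> linarith
  · have : L ^ 2 * (L ^ 2 - 12 * M ^ 2) = 0 := by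
      linear_combination (-(L ^ 2) + 2 * M * r₀ E L) * h6 - 4 * M * h2
    rcases mul_eq_zero.1 this with h7 | h7
    · exact h3 (pow_eq_zero_iff two_ne_zero |>.1 h7)
    · linarith

/-- The logarithmic derivative of a centripetal point along the scaling flow. -/
theorem centripetal_scaling_deriv (hM : 0 < M) (hU : IsOpen U)
    (hd : IsDistinguished M U r₀ .centripetal) (hq : (E, L) ∈ U) :
    2 * L ^ 2 * (r₀ E L - 3 * M) / (2 * M * r₀ E L - L ^ 2) =
      2 * r₀ E L * (r₀ E L - 3 * M) / (r₀ E L - 6 * M) := by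
  obtain ⟨h3, h4, h5, h6⟩ := centripetal_ne hM hU hd hq
  have h2 := (hd.2 E L hq).2
  rw [div_eq_div_iff h6 (sub_ne_zero.2 h5)]
  linear_combination (-4 * (r₀ E L - 3 * M)) * h2

/-- Returning from `u₀` to `r₀` exposes the first factor as the scaling derivative of `r₀`, which is
how the rate arises as an end-point term. -/
theorem cAngle_eq (hM : 0 < M) (hU : IsOpen U)
    (hd : IsDistinguished M U r₀ .centripetal) (hq : (E, L) ∈ U) (s : ℝ) :
    cAngle M s r₀ E L = 2 * r₀ E L * (r₀ E L - 3 * M) / (r₀ E L - 6 * M) / L *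
      (1 + L ^ 2 / r₀ E L ^ 2) / radialSpeed M s E L (r₀ E L) := by
  obtain ⟨hL, h3M, h6M, -⟩ := centripetal_ne hM hU hd hq
  have hr0 : 0 < r₀ E L := by linarith
  have h6M' : r₀ E L - 6 * M ≠ 0 := sub_ne_zero.2 h6M
  have hu : 3 * uZero M r₀ E L - 2 = (r₀ E L - 6 * M) / r₀ E L := by
    unfold uZero; field_simp; ring
  have hu1 : uZero M r₀ E L - 1 = -(2 * M / r₀ E L) := by unfold uZero; ring
  have hu2 : 1 - 3 * uZero M r₀ E L = -(2 * (r₀ E L - 3 * M) / r₀ E L) := by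
    unfold uZero; field_simp; ring
  rw [cAngle, hu, hu1, hu2]
  field_simp

theorem cTime_eq (hM : 0 < M) (hU : IsOpen U)
    (hd : IsDistinguished M U r₀ .centripetal) (hq : (E, L) ∈ U) (s : ℝ) :
    cTime M s r₀ E L = 2 * r₀ E L * (r₀ E L - 3 * M) / (r₀ E L - 6 * M) *
      (E * r₀ E L / (r₀ E L - 2 * M)) / radialSpeed M s E L (r₀ E L) := by
  obtain ⟨hL, h3M, h6M, -⟩ := centripetal_ne hM hU hd hq
  have hr0 : 0 < r₀ E L := by linarith
  have h2M : r₀ E L - 2 * M ≠ 0 := by linarith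
  have h6M' : r₀ E L - 6 * M ≠ 0 := sub_ne_zero.2 h6M
  have hu : 3 * uZero M r₀ E L - 2 = (r₀ E L - 6 * M) / r₀ E L := by
    unfold uZero; field_simp; ring
  have hu1 : uZero M r₀ E L - 1 = -(2 * M / r₀ E L) := by unfold uZero; ring
  have hu2 : 1 - 3 * uZero M r₀ E L = -(2 * (r₀ E L - 3 * M) / r₀ E L) := by
    unfold uZero; field_simp; ring
  have hu3 : uZero M r₀ E L = (r₀ E L - 2 * M) / r₀ E L := by unfold uZero; field_simp
  rw [cTime, hu, hu1, hu2, hu3]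
  field_simp

/-- The interior integrals on the two sides coincide, so only end-point terms are compared. They
follow from `∂r₀/∂E = 0` and `L ∂r₀/∂L = dr₀/dε`. For the angle they add up to `(dr₀/dε)(1/L +
L/r₀²)/ν₀`, for the time to `(dr₀/dε) E r₀/((r₀ - 2M) ν₀)`. -/
theorem hasDerivAt_centripetal (hM : 0 < M) (hU : IsOpen U)
    (hd : IsDistinguished M U r₀ .centripetal) (h : Regular M U .centripetal r₀ r E L) :
    HasDerivAt (fun x => radialIntegral M r₀ (fun q => q.2.1 / q.2.2 ^ 2)
        (E * Real.exp x, L * Real.exp x, r))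
      (-(fderiv ℝ (radialIntegral M r₀ fun _ => 1) (E, L, r) (0, 1, 0)) - cAngle M 1 r₀ E L) 0 ∧
    HasDerivAt (fun x => radialIntegral M r₀ (fun q => q.1 * q.2.2 / (q.2.2 - 2 * M))
        (E * Real.exp x, L * Real.exp x, r))
      (fderiv ℝ (radialIntegral M r₀ fun _ => 1) (E, L, r) (1, 0, 0) - cTime M 1 r₀ E L) 0 := by
  have hq := h.2.1
  obtain ⟨hL, h3M, h6M, hne⟩ := centripetal_ne hM hU hd hq
  have hr0 : 0 < r₀ E L := by linarith
  have h2M : r₀ E L - 2 * M ≠ 0 := by linarith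
  have h6M' : r₀ E L - 6 * M ≠ 0 := sub_ne_zero.2 h6M
  have hν := Real.sqrt_pos.2 (radialSq_pos_of_ne_turning (by simp) h left_mem_uIcc)
  have haE := hasDerivAt_distinguished_comp hM hU hd (hasDerivAt_id' E) (hasDerivAt_const E L) hq
  have haL := hasDerivAt_distinguished_comp hM hU hd (hasDerivAt_const L E) (hasDerivAt_id' L) hq
  have haS := hasDerivAt_distinguished_comp hM hU hd (hasDerivAt_mul_exp E) (hasDerivAt_mul_exp L)
    (by simpa using hq)
  have heE := centripetal_deriv hU hd (hasDerivAt_id' E) (hasDerivAt_const E L) hq haE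
  have heL := centripetal_deriv hU hd (hasDerivAt_const L E) (hasDerivAt_id' L) hq haL
  have heS := centripetal_deriv hU hd (hasDerivAt_mul_exp E) (hasDerivAt_mul_exp L)
    (by simpa using hq) haS
  have hIE := fderiv_properTime_fst (by simp) hM hU hd h haE
  have hIL := fderiv_properTime_snd (by simp) hM hU hd h haL
  have hφ := hasDerivAt_angle_scaling (by simp) hM hU hd h haS
  have ht := hasDerivAt_time_scaling rfl hM hU hd h haS
  simp only [Real.exp_zero, mul_one] at heS hφ ht
  generalize fderiv ℝ (fun p : ℝ × ℝ => r₀ p.1 p.2) (E, L) (1, 0) = aE at *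
  generalize fderiv ℝ (fun p : ℝ × ℝ => r₀ p.1 p.2) (E, L) (0, 1) = aL at *
  generalize fderiv ℝ (fun p : ℝ × ℝ => r₀ p.1 p.2) (E, L) (E, L) = aS at *
  have haE0 : aE = 0 := by simpa [hne] using heE
  have haS0 : aS = 2 * r₀ E L * (r₀ E L - 3 * M) / (r₀ E L - 6 * M) := by
    rw [← centripetal_scaling_deriv hM hU hd hq, eq_div_iff hne]
    linear_combination heS
  have haL0 : aL = aS / L := by
    rw [eq_div_iff hL]
    apply mul_left_cancel₀ hne
    linear_combination L * heL - heS
  rw [hIE, hIL, cAngle_eq hM hU hd hq, cTime_eq hM hU hd hq, radialSpeed, one_mul]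
  refine ⟨hφ.congr_deriv ?_, ht.congr_deriv ?_⟩
  · rw [haL0, ← haS0]
    generalize (∫ y in (r₀ E L)..r, (1 - 2 * M / y) * L / y ^ 2 / radialSq M E L y /
      √(radialSq M E L y)) = A
    field_simp
    ring
  · rw [haE0, ← haS0]
    ring

/-! ### Horizon points -/

theorem real_sign_mul_abs (x : ℝ) : Real.sign x * |x| = x := by
  rcases lt_trichotomy x 0 with h | rfl | h
  · rw [Real.sign_of_neg h, abs_of_neg h]; ring
  · simp
  · rw [Real.sign_of_pos h, abs_of_pos h]; ring

/-- The regular part of `E y / ((y - 2M) v)` at the horizon, up to sign, as a numerator over `v`. -/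
def horizonNumerator (M : ℝ) (q : ℝ × ℝ × ℝ) : ℝ :=
  (1 + q.2.1 ^ 2 / q.2.2 ^ 2) / (|q.1| + √(radialSq M q.1 q.2.1 q.2.2)) +
    √(radialSq M q.1 q.2.1 q.2.2)

theorem Regular.energy_ne_zero (hM : 0 < M) (h : Regular M U k r₀ r E L) : E ≠ 0 := by
  rintro rfl
  have h1 := h.2.2.1
  have hr : 0 < r := by linarith [h.1]
  have h2 : 0 < 1 - 2 * M / r := by rw [sub_pos, div_lt_one hr]; exact h.1
  have h3 : 0 < 1 + L ^ 2 / r ^ 2 := by positivity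
  unfold radialSq at h1
  nlinarith [mul_pos h2 h3]

/-- Since `E² - Q = f (1 + L²/y²)`, the difference `|E| - √Q` contains the factor `f`, which cancels
the pole. The left side is visibly smooth at the horizon; the right side is the convenient one to
differentiate. -/
theorem horizonNumerator_div (hM : 0 < M) {y : ℝ} (hE : E ≠ 0) (hy : 2 * M < y)
    (hQ : 0 < radialSq M E L y) :
    horizonNumerator M (E, L, y) / √(radialSq M E L y) =
      (|E| / √(radialSq M E L y) - 1) / (1 - 2 * M / y) + 1 := by
  have hs := Real.sqrt_pos.2 hQ
  have hE' := abs_pos.2 hE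
  have hy0 : 0 < y := by linarith
  have hf : 0 < 1 - 2 * M / y := by rw [sub_pos, div_lt_one hy0]; exact hy
  have h1 : |E| ^ 2 - √(radialSq M E L y) ^ 2 = (1 - 2 * M / y) * (1 + L ^ 2 / y ^ 2) := by
    rw [Real.sq_sqrt hQ.le, sq_abs]; unfold radialSq; ring
  unfold horizonNumerator
  simp only
  generalize √(radialSq M E L y) = v at *
  generalize 1 - 2 * M / y = f at *
  have h2 : 1 + L ^ 2 / y ^ 2 = (|E| ^ 2 - v ^ 2) / f := by rw [h1]; field_simp
  have h3 : |E| + v ≠ 0 := by positivity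
  rw [h2]
  field_simp
  ring

theorem smoothAlong_horizonNumerator (hM : 0 < M) (hk : k ≠ .turning)
    (hd : IsDistinguished M U r₀ k) :
    ∀ q ∈ regularSet M U k r₀, SmoothAlong r₀ (horizonNumerator M) q := by
  intro q hq y hy
  have hy0 : y ≠ 0 := by
    have := two_mul_le_of_mem_uIcc (two_mul_le_distinguished hM hd hq.2.1) hq.1 hy
    linarith
  have hQ := radialSq_pos_of_ne_turning hk hq hy
  have hE : q.1 ≠ 0 := Regular.energy_ne_zero hM hq
  have hs : ContDiffAt ℝ 2 (fun q : ℝ × ℝ × ℝ => √(radialSq M q.1 q.2.1 q.2.2))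
      (q.1, q.2.1, y) := (contDiffAt_radialSq (by fun_prop) (by fun_prop) (by fun_prop)
        hy0).sqrt hQ.ne'
  have ha : ContDiffAt ℝ 2 (fun q : ℝ × ℝ × ℝ => |q.1|) (q.1, q.2.1, y) :=
    (contDiffAt_abs hE).comp (q.1, q.2.1, y) contDiffAt_fst
  refine ContDiffAt.add (ContDiffAt.div (contDiffAt_const.add
    (ContDiffAt.div (by fun_prop) (by fun_prop) (pow_ne_zero 2 hy0))) (ha.add hs) ?_) hs
  have := abs_pos.2 hE
  have := Real.sqrt_nonneg (radialSq M q.1 q.2.1 y)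
  positivity

theorem horizonResidue_one (hM : 0 < M) : horizonResidue M 1 E L = 2 * M / |E| := by
  have : radialSq M E L (2 * M) = E ^ 2 := by
    unfold radialSq; rw [div_self (by positivity)]; ring
  rw [horizonResidue, radialSpeed, this, Real.sqrt_sq_eq_abs, one_mul]

theorem horizon_integrand_eq (hM : 0 < M) {y : ℝ} (hE : E ≠ 0) (hy : 2 * M < y)
    (hQ : 0 < radialSq M E L y) :
    y / ((y - 2 * M) * radialSpeed M 1 E L y) - horizonResidue M 1 E L / (y - 2 * M) =
      |E|⁻¹ * (horizonNumerator M (E, L, y) / √(radialSq M E L y)) := by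
  have hs := Real.sqrt_pos.2 hQ
  have hy0 : 0 < y := by linarith
  have hy2 : y - 2 * M ≠ 0 := by linarith
  have hE' : |E| ≠ 0 := abs_ne_zero.2 hE
  have hf : 1 - 2 * M / y = (y - 2 * M) / y := by field_simp
  rw [horizonNumerator_div hM hE hy hQ, radialSpeed, horizonResidue_one hM, hf]
  field_simp
  ring

/-- After multiplication by `E` the coefficient of the logarithm is `2M sgn E`. It does not change
when `E` is scaled by a positive factor, so the logarithm contributes nothing to the scaling
derivative. -/
theorem mul_timeIntegral_horizon (hM : 0 < M) (hd : IsDistinguished M U r₀ .horizon)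
    {p : ℝ × ℝ × ℝ} (hp : p ∈ regularSet M U .horizon r₀) :
    p.1 * timeIntegral M 1 p.1 p.2.1 (r₀ p.1 p.2.1) p.2.2 =
      Real.sign p.1 * (radialIntegral M r₀ (horizonNumerator M) p +
        2 * M * Real.log ((p.2.2 - 2 * M) / (2 * M))) := by
  obtain ⟨E, L, r⟩ := p
  have ha := hd E L hp.2.1
  have hE : E ≠ 0 := Regular.energy_ne_zero hM hp
  have hE' : |E| ≠ 0 := abs_ne_zero.2 hE
  have hsE : E / |E| = Real.sign E := by
    rw [div_eq_iff hE', real_sign_mul_abs]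
  simp only [timeIntegral, radialIntegral, ha, if_pos]
  rw [mul_add, mul_add, ← intervalIntegral.integral_const_mul,
    ← intervalIntegral.integral_const_mul]
  congr 1
  · refine intervalIntegral.integral_congr_ae (Eventually.of_forall fun y hy => ?_)
    have h2r : 2 * M < r := hp.1
    have hy1 : y ∈ uIcc (r₀ E L) r := by rw [ha]; exact uIoc_subset_uIcc hy
    rw [uIoc_of_le h2r.le] at hy
    rw [horizon_integrand_eq hM hE hy.1 (radialSq_pos_of_ne_turning (by simp) hp hy1), ← hsE]
    ring
  · rw [← hsE, horizonResidue_one hM]; ring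

/-- The lower limit `2M` is fixed, so no end-point terms appear, and the regularised integrand obeys
the same pointwise identity as at the other points. -/
theorem hasDerivAt_horizon (hM : 0 < M) (hU : IsOpen U)
    (hd : IsDistinguished M U r₀ .horizon) (h : Regular M U .horizon r₀ r E L) :
    HasDerivAt (fun x => radialIntegral M r₀ (fun q => q.2.1 / q.2.2 ^ 2)
        (E * Real.exp x, L * Real.exp x, r))
      (-(fderiv ℝ (radialIntegral M r₀ fun _ => 1) (E, L, r) (0, 1, 0))) 0 ∧
    HasDerivAt (fun x => E * Real.exp x * timeIntegral M 1 (E * Real.exp x) (L * Real.exp x)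
        (r₀ (E * Real.exp x) (L * Real.exp x)) r)
      (fderiv ℝ (radialIntegral M r₀ fun _ => 1) (E, L, r) (1, 0, 0)) 0 := by
  have hq := h.2.1
  have hE : E ≠ 0 := h.energy_ne_zero hM
  have hconst : ∀ {e l : ℝ → ℝ} {e' l' ε : ℝ}, HasDerivAt e e' ε → HasDerivAt l l' ε →
      (e ε, l ε) ∈ U → HasDerivAt (fun x => r₀ (e x) (l x)) 0 ε := by
    intro e l e' l' ε he hl hU'
    refine (hasDerivAt_const ε (2 * M)).congr_of_eventuallyEq ?_
    filter_upwards [(he.continuousAt.prodMk hl.continuousAt).eventually (hU.mem_nhds hU')]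
      with x hx using hd _ _ hx
  have haS := hconst (hasDerivAt_mul_exp E) (hasDerivAt_mul_exp L) (by simpa using hq)
  have hIE := fderiv_properTime_fst (by simp) hM hU hd h
    (hconst (hasDerivAt_id' E) (hasDerivAt_const E L) hq)
  have hIL := fderiv_properTime_snd (by simp) hM hU hd h
    (hconst (hasDerivAt_const L E) (hasDerivAt_id' L) hq)
  have hφ := hasDerivAt_angle_scaling (by simp) hM hU hd h haS
  rw [hIE, hIL]
  refine ⟨hφ.congr_deriv (by ring), ?_⟩
  have hev : ∀ᶠ x in 𝓝 (0 : ℝ), (E * Real.exp x, L * Real.exp x, r) ∈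
      regularSet M U .horizon r₀ := by
    have : ContinuousAt (fun x : ℝ => (E * Real.exp x, L * Real.exp x, r)) 0 := by fun_prop
    exact this.eventually ((isOpen_regularSet hM hU hd).mem_nhds (by simpa [regularSet] using h))
  -- The numerator `-|E|/Q` comes from `(|E|/√Q - 1)/f + 1`: its scaling derivative is `|E| (1 - (Q
  -- + f)/Q)/(f √Q)`, and the factor `f` cancels.
  have hder := hasDerivAt_radialIntegral_of_ne_turning (g := horizonNumerator M)
    (d := fun y => -|E| / radialSq M E L y) (by simp) hM hU hd
    (e := fun x => E * Real.exp x) (l := fun x => L * Real.exp x)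
    (by simp) (by simp) h (smoothAlong_horizonNumerator hM (by simp) hd) (by fun_prop)
    (by fun_prop) haS
    (continuousOn_div_radialSq (by simp) hM hd h continuousOn_const) fun y hy hQ => ?_
  · have h2 := (hder.add_const (2 * M * Real.log ((r - 2 * M) / (2 * M)))).const_mul (Real.sign E)
    refine (h2.congr_deriv ?_).congr_of_eventuallyEq ?_
    · rw [mul_zero, sub_zero, mul_zero, sub_zero, ← intervalIntegral.integral_const_mul]
      congr 1; ext y
      rw [mul_div_assoc', mul_div_assoc', mul_neg, real_sign_mul_abs]
    · filter_upwards [hev] with x hx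
      have := mul_timeIntegral_horizon hM hd hx
      simp only at this
      rw [this]
      congr 1
      rcases lt_or_gt_of_ne hE with h0 | h0
      · rw [Real.sign_of_neg h0, Real.sign_of_neg (mul_neg_of_neg_of_pos h0 (Real.exp_pos x))]
      · rw [Real.sign_of_pos h0, Real.sign_of_pos (mul_pos h0 (Real.exp_pos x))]
  · have hy0 : 0 < y := by linarith
    have hf : 0 < 1 - 2 * M / y := by rw [sub_pos, div_lt_one hy0]; exact hy
    have h1 := hasDerivAt_div_sqrt (hasDerivAt_mul_exp |E|)
      (hasDerivAt_radialSq M y (hasDerivAt_mul_exp E) (hasDerivAt_mul_exp L)) (by simpa using hQ)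
    have h2 := ((h1.sub_const 1).div_const (1 - 2 * M / y)).add_const 1
    simp only [Real.exp_zero, mul_one] at h2
    refine (h2.congr_deriv ?_).congr_of_eventuallyEq ?_
    · have hs := Real.sqrt_pos.2 hQ
      have h3 : 2 * radialSq M E L y - (2 * E * E - (1 - 2 * M / y) * (2 * L * L / y ^ 2)) =
        -2 * (1 - 2 * M / y) := by unfold radialSq; ring
      generalize √(radialSq M E L y) = v at *
      generalize 1 - 2 * M / y = f at *
      generalize 2 * E * E - f * (2 * L * L / y ^ 2) = w at *
      obtain rfl : w = 2 * radialSq M E L y + 2 * f := by linarith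
      field_simp
      ring
    · have hc : ContinuousAt (fun x => radialSq M (E * Real.exp x) (L * Real.exp x) y) 0 :=
        (hasDerivAt_radialSq M y (hasDerivAt_mul_exp E) (hasDerivAt_mul_exp L)).continuousAt
      filter_upwards [hc.eventually_const_lt (u := 0) (by simpa using hQ)] with x hx
      rw [horizonNumerator_div hM (mul_ne_zero hE (Real.exp_pos x).ne') hy hx, abs_mul,
        Real.abs_exp]

end SchwarzschildLRL
end

/-! ### Turning points through the radial action, and the three kinds together -/

noncomputable section
namespace SchwarzschildLRL

variable {M : ℝ} {U : Set (ℝ × ℝ)} {k : PointKind} {r₀ : ℝ → ℝ → ℝ} {E L r : ℝ}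

/-! ### Turning points -/

/-- The integrand, up to the factor `1 / v`, of the radial action. -/
def actionNumerator (M : ℝ) (q : ℝ × ℝ × ℝ) : ℝ :=
  radialSq M q.1 q.2.1 q.2.2 / (1 - 2 * M / q.2.2)

theorem one_sub_two_mul_div_pos (hM : 0 < M) {y : ℝ} (hy : 2 * M < y) : 0 < 1 - 2 * M / y := by
  rw [sub_pos, div_lt_one (by linarith)]; exact hy

theorem smoothAlong_actionNumerator (hM : 0 < M) (hk : k ≠ .horizon)
    (hd : IsDistinguished M U r₀ k) :
    ∀ q ∈ regularSet M U k r₀, SmoothAlong r₀ (actionNumerator M) q :=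
  smoothAlong_of_two_mul_lt hM hk hd fun e l y hy => by
    have hy0 : y ≠ 0 := by linarith
    refine ContDiffAt.div (contDiffAt_radialSq (by fun_prop) (by fun_prop) (by fun_prop) hy0)
      (contDiffAt_const.sub (ContDiffAt.div (by fun_prop) (by fun_prop) hy0))
      (one_sub_two_mul_div_pos hM hy).ne'

/-- The integrand of the action is `√Q/f`, which vanishes at a turning point. Hence the motion of
`r₀` gives no end-point term. -/
theorem tendsto_actionNumerator (hM : 0 < M) (hd : IsDistinguished M U r₀ .turning)
    (h : Regular M U .turning r₀ r E L) :
    Tendsto (fun x => actionNumerator M (E, L, radialPath (r₀ E L) r x) /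
      √(radialSq M E L (radialPath (r₀ E L) r x))) (𝓝[>] 0) (𝓝 0) := by
  have ha : 2 * M < r₀ E L := (hd.2 E L h.2.1).1
  have ha0 : r₀ E L ≠ 0 := by linarith
  have hQ0 : radialSq M E L (r₀ E L) = 0 := by
    rw [radialSq_eq_cubic M E L ha0, (hd.2 E L h.2.1).2.1, zero_div]
  have h1 : ContinuousAt (fun y => √(radialSq M E L y) / (1 - 2 * M / y))
      (radialPath (r₀ E L) r 0) := by
    rw [radialPath_zero]
    refine ContinuousAt.div (ContinuousAt.sqrt (contDiffAt_radialSq (n := 0) contDiffAt_const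
      contDiffAt_const contDiffAt_id ha0).continuousAt)
      (continuousAt_const.sub (continuousAt_const.div continuousAt_id ha0))
      (one_sub_two_mul_div_pos hM ha).ne'
  have h2 := (ContinuousAt.comp (f := fun x => radialPath (r₀ E L) r x) (x := 0) h1
    (continuous_radialPath _ _).continuousAt).tendsto.mono_left
      (nhdsWithin_le_nhds (s := Ioi 0))
  simp only [Function.comp_def, radialPath_zero, hQ0, Real.sqrt_zero, zero_div] at h2
  refine h2.congr fun x => ?_
  rw [actionNumerator, div_right_comm, Real.div_sqrt]

/-- The derivative of `√Q/f` is `Q'/(2 f √Q)`, no more singular than `1/√Q` and thus integrable up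
to a simple root, unlike the derivative of `1/√Q`. -/
theorem hasDerivAt_actionNumerator (hM : 0 < M) {y : ℝ} {e l : ℝ → ℝ} {e' l' ε : ℝ}
    (he : HasDerivAt e e' ε) (hl : HasDerivAt l l' ε)
    (hQ : 0 < radialSq M (e ε) (l ε) y) (hy : 2 * M < y) :
    HasDerivAt (fun x => actionNumerator M (e x, l x, y) / √(radialSq M (e x) (l x) y))
      ((e ε * e' * y / (y - 2 * M) - l ε * l' / y ^ 2) / √(radialSq M (e ε) (l ε) y)) ε := by
  have h1 := hasDerivAt_radialSq M y he hl
  refine (hasDerivAt_div_sqrt (h1.div_const (1 - 2 * M / y)) h1 hQ).congr_deriv ?_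
  congr 1
  have hy0 : 0 < y := by linarith
  have hf : y - 2 * M ≠ 0 := by linarith
  rw [show 1 - 2 * M / y = (y - 2 * M) / y by field_simp]
  field_simp
  ring

/-- Hamilton–Jacobi relation: the energy derivative of the radial action is the coordinate time. -/
theorem fderiv_action_fst (hM : 0 < M) (hU : IsOpen U) (hd : IsDistinguished M U r₀ .turning)
    {p : ℝ × ℝ × ℝ} (hp : p ∈ regularSet M U .turning r₀) :
    fderiv ℝ (radialIntegral M r₀ (actionNumerator M)) p (1, 0, 0) =
      radialIntegral M r₀ (fun q => q.1 * q.2.2 / (q.2.2 - 2 * M)) p := by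
  obtain ⟨E, L, r⟩ := p
  have hg := smoothAlong_actionNumerator hM (k := .turning) (by simp) hd
  refine fderiv_fst_eq ((contDiffAt_radialIntegral hM hU hd hp hg).differentiableAt
    (by norm_num)) ?_
  have ha := hasDerivAt_distinguished_comp hM hU hd (hasDerivAt_id' E) (hasDerivAt_const E L)
    hp.2.1
  refine (hasDerivAt_radialIntegral (e := fun x => x) (l := fun _ => L)
    (d := fun y => E * y / (y - 2 * M)) hM hU hd hp hg contDiffAt_id contDiffAt_const ha
    (smoothAlong_time hM (by simp) hd _ hp).continuousOn
    (fun y hy hQ => ?_) (tendsto_actionNumerator hM hd hp)).congr_deriv ?_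
  · refine (hasDerivAt_actionNumerator hM (hasDerivAt_id' E) (hasDerivAt_const E L) hQ
      hy).congr_deriv ?_
    simp
  · simp [radialIntegral]

theorem fderiv_action_snd (hM : 0 < M) (hU : IsOpen U) (hd : IsDistinguished M U r₀ .turning)
    {p : ℝ × ℝ × ℝ} (hp : p ∈ regularSet M U .turning r₀) :
    fderiv ℝ (radialIntegral M r₀ (actionNumerator M)) p (0, 1, 0) =
      -radialIntegral M r₀ (fun q => q.2.1 / q.2.2 ^ 2) p := by
  obtain ⟨E, L, r⟩ := p
  have hg := smoothAlong_actionNumerator hM (k := .turning) (by simp) hd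
  refine fderiv_snd_eq ((contDiffAt_radialIntegral hM hU hd hp hg).differentiableAt
    (by norm_num)) ?_
  have ha := hasDerivAt_distinguished_comp hM hU hd (hasDerivAt_const L E) (hasDerivAt_id' L)
    hp.2.1
  refine (hasDerivAt_radialIntegral (e := fun _ => E) (l := fun x => x)
    (d := fun y => -(L / y ^ 2)) hM hU hd hp hg contDiffAt_const contDiffAt_id ha
    (smoothAlong_angle hM hd _ hp).continuousOn.neg
    (fun y hy hQ => ?_) (tendsto_actionNumerator hM hd hp)).congr_deriv ?_
  · refine (hasDerivAt_actionNumerator hM (hasDerivAt_const L E) (hasDerivAt_id' L) hQ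
      hy).congr_deriv ?_
    simp
  · simp [radialIntegral, neg_div]

/-- The integrands satisfy `1 = E · E/f - L · L/y² - Q/f`, which is the definition of `Q`. So the
proper time is the Legendre-type combination `(E ∂_E + L ∂_L - 1) S`. -/
theorem properTime_eq_action (hM : 0 < M) (hU : IsOpen U) (hd : IsDistinguished M U r₀ .turning)
    {p : ℝ × ℝ × ℝ} (hp : p ∈ regularSet M U .turning r₀) :
    radialIntegral M r₀ (fun _ => 1) p =
      p.1 * fderiv ℝ (radialIntegral M r₀ (actionNumerator M)) p (1, 0, 0) +
      p.2.1 * fderiv ℝ (radialIntegral M r₀ (actionNumerator M)) p (0, 1, 0) -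
      radialIntegral M r₀ (actionNumerator M) p := by
  rw [fderiv_action_fst hM hU hd hp, fderiv_action_snd hM hU hd hp]
  have h1 := (radialIntegral_substitution hM hd hp
    (smoothAlong_time hM (k := .turning) (by simp) hd _ hp).continuousOn).1
  have h2 := (radialIntegral_substitution hM hd hp
    (smoothAlong_angle hM hd _ hp).continuousOn).1
  have h3 := (radialIntegral_substitution hM hd hp
    (smoothAlong_actionNumerator hM (k := .turning) (by simp) hd _ hp).continuousOn).1
  simp only [radialIntegral]
  have e1 := intervalIntegral.integral_sub (h1.const_mul p.1) (h2.const_mul p.2.1)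
  have e2 := intervalIntegral.integral_sub ((h1.const_mul p.1).sub (h2.const_mul p.2.1)) h3
  rw [mul_neg, ← sub_eq_add_neg, ← intervalIntegral.integral_const_mul,
    ← intervalIntegral.integral_const_mul]
  refine Eq.trans ?_ (e2.trans (congrArg (fun c => c - _) e1))
  refine intervalIntegral.integral_congr fun y hy => ?_
  have hy2 := two_mul_lt_of_mem_uIcc (hd.2 _ _ hp.2.1).1 hp.1 hy
  have hy0 : 0 < y := by linarith
  have hf : y - 2 * M ≠ 0 := by linarith
  simp only
  have key : 1 = p.1 * (p.1 * y / (y - 2 * M)) - p.2.1 * (p.2.1 / y ^ 2) -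
      actionNumerator M (p.1, p.2.1, y) := by
    unfold actionNumerator radialSq
    simp only
    rw [show 1 - 2 * M / y = (y - 2 * M) / y by field_simp]
    field_simp
    ring
  nth_rewrite 1 [key]
  ring

/-- Differentiating `I = E S_E + L S_L - S` in `E` cancels `S_E` and leaves `E S_EE + L S_LE`. The
scaling derivative of `S_E = J_t` is the same expression by symmetry of the second derivative. The
angle is treated in the same way with `S_L = -J_φ`. -/
theorem hasDerivAt_turning (hM : 0 < M) (hU : IsOpen U)
    (hd : IsDistinguished M U r₀ .turning) (h : Regular M U .turning r₀ r E L) :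
    HasDerivAt (fun x => radialIntegral M r₀ (fun q => q.2.1 / q.2.2 ^ 2)
        (E * Real.exp x, L * Real.exp x, r))
      (-(fderiv ℝ (radialIntegral M r₀ fun _ => 1) (E, L, r) (0, 1, 0))) 0 ∧
    HasDerivAt (fun x => radialIntegral M r₀ (fun q => q.1 * q.2.2 / (q.2.2 - 2 * M))
        (E * Real.exp x, L * Real.exp x, r))
      (fderiv ℝ (radialIntegral M r₀ fun _ => 1) (E, L, r) (1, 0, 0)) 0 := by
  have hp : (E, L, r) ∈ regularSet M U .turning r₀ := h
  have hg := smoothAlong_actionNumerator hM (k := .turning) (by simp) hd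
  set S := radialIntegral M r₀ (actionNumerator M) with hS
  have hC : ContDiffAt ℝ 2 S (E, L, r) := contDiffAt_radialIntegral hM hU hd hp hg
  have hD : DifferentiableAt ℝ (fderiv ℝ S) (E, L, r) :=
    (hC.fderiv_right (m := 1) (by norm_num)).differentiableAt (by norm_num)
  set D := fderiv ℝ (fderiv ℝ S) (E, L, r)
  have hDv : ∀ v, HasFDerivAt (fun q => fderiv ℝ S q v)
      ((ContinuousLinearMap.apply ℝ ℝ v).comp D) (E, L, r) := fun v =>
    (ContinuousLinearMap.apply ℝ ℝ v).hasFDerivAt.comp (E, L, r) hD.hasFDerivAt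
  have hsymm : ∀ u v, D u v = D v u := fun u v =>
    hC.isSymmSndFDerivAt (by simp) u v
  have hopen := isOpen_regularSet hM hU hd
  have hevp := hopen.mem_nhds hp
  have hcurve : HasDerivAt (fun x => (E * Real.exp x, L * Real.exp x, r)) (E, L, 0) 0 :=
    (hasDerivAt_mul_exp E).prodMk ((hasDerivAt_mul_exp L).prodMk (hasDerivAt_const 0 r))
  have hev : ∀ᶠ x in 𝓝 (0 : ℝ), (E * Real.exp x, L * Real.exp x, r) ∈
      regularSet M U .turning r₀ :=
    hcurve.continuousAt.eventually (hopen.mem_nhds (by simpa [regularSet] using h))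
  have hS1 : HasFDerivAt S (fderiv ℝ S (E, L, r)) (E, L, r) :=
    (hC.differentiableAt (by norm_num)).hasFDerivAt
  have hI : HasFDerivAt (radialIntegral M r₀ fun _ => 1) _ (E, L, r) :=
    (((hasFDerivAt_fst.mul (hDv (1, 0, 0))).add
      ((hasFDerivAt_fst.comp (E, L, r) hasFDerivAt_snd).mul (hDv (0, 1, 0)))).sub
      hS1).congr_of_eventuallyEq (by
        filter_upwards [hevp] with q hq using properTime_eq_action hM hU hd hq)
  have hscale : ∀ v, HasDerivAt (fun x => fderiv ℝ S (E * Real.exp x, L * Real.exp x, r) v)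
      (E * D (1, 0, 0) v + L * D (0, 1, 0) v) 0 := by
    intro v
    have h1 := HasFDerivAt.comp_hasDerivAt_of_eq (0 : ℝ) (hDv v) hcurve (by simp)
    refine h1.congr_deriv ?_
    rw [map_triple]
    simp
  refine ⟨?_, ?_⟩
  · refine ((hscale (0, 1, 0)).neg.congr_of_eventuallyEq ?_).congr_deriv ?_
    · filter_upwards [hev] with x hx
      rw [Pi.neg_apply, hS, fderiv_action_snd hM hU hd hx, neg_neg]
    · rw [hI.fderiv]
      simp [hsymm (0, 1, 0) (1, 0, 0)]
      ring
  · refine ((hscale (1, 0, 0)).congr_of_eventuallyEq ?_).congr_deriv ?_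
    · filter_upwards [hev] with x hx
      rw [fderiv_action_fst hM hU hd hx]
    · rw [hI.fderiv]
      simp [hsymm (0, 1, 0) (1, 0, 0)]
      ring

/-! ### All kinds of distinguished points -/

/-- Along the scaling flow of `(E, L)`, the radial integrals for the angle and the time change by
the derivatives of the proper time, up to the rates of the LRL quantities. -/
theorem hasDerivAt_scaling (hM : 0 < M) (hU : IsOpen U) (hd : IsDistinguished M U r₀ k)
    (h : Regular M U k r₀ r E L) :
    HasDerivAt (fun x => L * Real.exp x * angleIntegral M 1 (E * Real.exp x) (L * Real.exp x)
        (r₀ (E * Real.exp x) (L * Real.exp x)) r)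
      (-(fderiv ℝ (radialIntegral M r₀ fun _ => 1) (E, L, r) (0, 1, 0)) -
        angleRate M r₀ E L k) 0 ∧
    HasDerivAt (fun x => E * Real.exp x * timeIntegral M 1 (E * Real.exp x) (L * Real.exp x)
        (r₀ (E * Real.exp x) (L * Real.exp x)) r)
      (fderiv ℝ (radialIntegral M r₀ fun _ => 1) (E, L, r) (1, 0, 0) -
        timeRate M r₀ E L k) 0 := by
  have hA : (fun x => L * Real.exp x * angleIntegral M 1 (E * Real.exp x) (L * Real.exp x)
      (r₀ (E * Real.exp x) (L * Real.exp x)) r) = fun x =>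
      radialIntegral M r₀ (fun q => q.2.1 / q.2.2 ^ 2) (E * Real.exp x, L * Real.exp x, r) :=
    funext fun x => mul_angleIntegral_one (E * Real.exp x, L * Real.exp x, r)
  have hT : k ≠ .horizon → (fun x => E * Real.exp x * timeIntegral M 1 (E * Real.exp x)
      (L * Real.exp x) (r₀ (E * Real.exp x) (L * Real.exp x)) r) =ᶠ[𝓝 0] fun x =>
      radialIntegral M r₀ (fun q => q.1 * q.2.2 / (q.2.2 - 2 * M))
        (E * Real.exp x, L * Real.exp x, r) := by
    intro hk
    have hc : ContinuousAt (fun x => (E * Real.exp x, L * Real.exp x)) 0 := by fun_prop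
    filter_upwards [hc.eventually (hU.mem_nhds (by simpa using h.2.1))] with x hx
    exact mul_timeIntegral_one hM hk hd (p := (E * Real.exp x, L * Real.exp x, r)) hx
  rw [hA]
  cases k with
  | turning =>
    obtain ⟨h1, h2⟩ := hasDerivAt_turning hM hU hd h
    exact ⟨by simpa [angleRate] using h1,
      by simpa [timeRate] using h2.congr_of_eventuallyEq (hT (by simp))⟩
  | horizon =>
    obtain ⟨h1, h2⟩ := hasDerivAt_horizon hM hU hd h
    exact ⟨by simpa [angleRate] using h1, by simpa [timeRate] using h2⟩
  | centripetal =>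
    obtain ⟨h1, h2⟩ := hasDerivAt_centripetal hM hU hd h
    exact ⟨h1, h2.congr_of_eventuallyEq (hT (by simp))⟩

end SchwarzschildLRL
end

/-! ### The symmetry generator of the LRL proper time in explicit form -/

noncomputable section
namespace SchwarzschildLRL

variable {M : ℝ} {U : Set (ℝ × ℝ)} {k : PointKind} {r₀ : ℝ → ℝ → ℝ} {E L r : ℝ}

/-! ### The sign of the radial velocity -/

theorem radialSpeed_eq_mul (M s E L y : ℝ) :
    radialSpeed M s E L y = s * radialSpeed M 1 E L y := by simp [radialSpeed]

theorem inv_eq_self_of_sign {s : ℝ} (hs : s = 1 ∨ s = -1) : s⁻¹ = s := by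
  rcases hs with rfl | rfl <;> norm_num

/-- As `s⁻¹ = s`, the sign comes out as a factor and all integrals reduce to `s = 1`. Because `0⁻¹ =
0`, this holds without any condition on the speed. -/
theorem one_div_mul_radialSpeed {s : ℝ} (hs : s = 1 ∨ s = -1) (M E L y c d : ℝ) :
    c / (d * radialSpeed M s E L y) = s * (c / (d * radialSpeed M 1 E L y)) := by
  rw [radialSpeed_eq_mul, div_eq_mul_inv, mul_inv, mul_inv, inv_eq_self_of_sign hs,
    div_eq_mul_inv, mul_inv]
  ring

theorem properTimeIntegral_sign {s : ℝ} (hs : s = 1 ∨ s = -1) (M E L a r : ℝ) :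
    properTimeIntegral M s E L a r = s * properTimeIntegral M 1 E L a r := by
  rw [properTimeIntegral, properTimeIntegral, ← intervalIntegral.integral_const_mul]
  congr 1; ext y
  simpa using one_div_mul_radialSpeed hs M E L y 1 1

theorem angleIntegral_sign {s : ℝ} (hs : s = 1 ∨ s = -1) (M E L a r : ℝ) :
    angleIntegral M s E L a r = s * angleIntegral M 1 E L a r := by
  rw [angleIntegral, angleIntegral, ← intervalIntegral.integral_const_mul]
  congr 1; ext y
  exact one_div_mul_radialSpeed hs M E L y 1 (y ^ 2)

theorem horizonResidue_sign {s : ℝ} (hs : s = 1 ∨ s = -1) (M E L : ℝ) :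
    horizonResidue M s E L = s * horizonResidue M 1 E L := by
  simpa [horizonResidue] using one_div_mul_radialSpeed hs M E L (2 * M) (2 * M) 1

theorem timeIntegral_sign {s : ℝ} (hs : s = 1 ∨ s = -1) (M E L a r : ℝ) :
    timeIntegral M s E L a r = s * timeIntegral M 1 E L a r := by
  unfold timeIntegral
  split_ifs
  · rw [mul_add, ← intervalIntegral.integral_const_mul, horizonResidue_sign hs, mul_assoc]
    congr 1
    congr 1; ext y
    rw [one_div_mul_radialSpeed hs]
    ring
  · rw [← intervalIntegral.integral_const_mul]
    congr 1; ext y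
    exact one_div_mul_radialSpeed hs M E L y y (y - 2 * M)

theorem cAngle_sign {s : ℝ} (hs : s = 1 ∨ s = -1) (M : ℝ) (r₀ : ℝ → ℝ → ℝ) (E L : ℝ) :
    cAngle M s r₀ E L = s * cAngle M 1 r₀ E L := one_div_mul_radialSpeed hs ..

theorem cTime_sign {s : ℝ} (hs : s = 1 ∨ s = -1) (M : ℝ) (r₀ : ℝ → ℝ → ℝ) (E L : ℝ) :
    cTime M s r₀ E L = s * cTime M 1 r₀ E L := one_div_mul_radialSpeed hs ..

theorem sign_eq_one_or {v : ℝ} (hv : v ≠ 0) : Real.sign v = 1 ∨ Real.sign v = -1 :=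
  (Real.sign_apply_eq_of_ne_zero v hv).symm

theorem eventually_sign_eq {X : Type*} [TopologicalSpace X] {f : X → ℝ} {x : X}
    (hf : ContinuousAt f x) (h : f x ≠ 0) : ∀ᶠ y in 𝓝 x, Real.sign (f y) = Real.sign (f x) := by
  rcases lt_or_gt_of_ne h with h0 | h0
  · filter_upwards [hf.eventually_lt_const h0] with y hy
    rw [Real.sign_of_neg hy, Real.sign_of_neg h0]
  · filter_upwards [hf.eventually_const_lt h0] with y hy
    rw [Real.sign_of_pos hy, Real.sign_of_pos h0]

/-! ### The normalisation of the velocity -/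

/-- The defect `v² - Q` is `f` times the defect `g(u,u) + 1`, and `f` does not vanish in the
exterior. -/
theorem metricNorm_eq_iff {z : State} (hM : 0 < M) (hr : 2 * M < z 2) :
    metricNorm M z = -1 ↔ z 5 ^ 2 = radialSq M (energy M z) (angMom z) (z 2) := by
  have hr0 : 0 < z 2 := by linarith
  have hf : z 2 - 2 * M ≠ 0 := by linarith
  have h1 : z 5 ^ 2 - radialSq M (energy M z) (angMom z) (z 2) =
      (z 2 - 2 * M) / z 2 * (metricNorm M z + 1) := by
    unfold radialSq energy angMom metricNorm
    field_simp
    ring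
  have h2 : (z 2 - 2 * M) / z 2 ≠ 0 := div_ne_zero hf hr0.ne'
  constructor
  · intro h
    rw [h] at h1
    linarith
  · intro h
    rw [h, sub_self] at h1
    have := (mul_eq_zero.1 h1.symm).resolve_left h2
    linarith

/-- The constants of motion and the radius of a state. -/
def radialData (M : ℝ) (z : State) : ℝ × ℝ × ℝ := (energy M z, angMom z, z 2)

theorem sq_velocity {z : State} (hM : 0 < M) (hz : z ∈ domain M U k r₀) :
    z 5 ^ 2 = radialSq M (energy M z) (angMom z) (z 2) :=
  (metricNorm_eq_iff hM hz.2.1).1 hz.1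

theorem velocity_ne_zero {z : State} (hM : 0 < M) (hz : z ∈ domain M U k r₀) : z 5 ≠ 0 := by
  intro h
  have h1 := sq_velocity hM hz
  have h2 := hz.2.2.2.1
  rw [← h1, h] at h2
  simp at h2

theorem velocity_eq {z : State} (hM : 0 < M) (hz : z ∈ domain M U k r₀) :
    z 5 = Real.sign (z 5) * √(radialSq M (energy M z) (angMom z) (z 2)) := by
  rw [← sq_velocity hM hz, Real.sqrt_sq_eq_abs, real_sign_mul_abs]

/-! ### Derivatives along curves in the state space -/

theorem hasDerivAt_energy {γ : ℝ → State} {w : State} {t : ℝ} (h : HasDerivAt γ w t)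
    (h0 : γ t 2 ≠ 0) :
    HasDerivAt (fun x => energy M (γ x))
      (2 * M / γ t 2 ^ 2 * w 2 * γ t 4 + (1 - 2 * M / γ t 2) * w 4) t := by
  have h2 := hasDerivAt_pi.1 h 2
  have h4 := hasDerivAt_pi.1 h 4
  refine ((((hasDerivAt_const t (2 * M)).div h2 h0).const_sub 1).mul h4).congr_deriv ?_
  simp; ring

theorem hasDerivAt_angMom {γ : ℝ → State} {w : State} {t : ℝ} (h : HasDerivAt γ w t) :
    HasDerivAt (fun x => angMom (γ x)) (2 * γ t 2 * w 2 * γ t 6 + γ t 2 ^ 2 * w 6) t := by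
  have h2 := hasDerivAt_pi.1 h 2
  have h6 := hasDerivAt_pi.1 h 6
  refine ((h2.pow 2).mul h6).congr_deriv ?_
  norm_num

/-- Conservation of `E` and `L`; the normalisation of the velocity is not needed for it. -/
theorem hasDerivAt_radialData_geodesic (hM : 0 < M) {γ : ℝ → State} {z : State} {t : ℝ}
    (hγ : γ t = z) (h : HasDerivAt γ (geodesicField M z) t) (hr : 2 * M < z 2) :
    HasDerivAt (fun x => radialData M (γ x)) (0, 0, z 5) t := by
  subst hγ
  have hr0 : γ t 2 ≠ 0 := by linarith
  have hf : γ t 2 - 2 * M ≠ 0 := by linarith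
  have h1 := hasDerivAt_energy (M := M) h hr0
  have h2 := hasDerivAt_angMom h
  have h3 := hasDerivAt_pi.1 h 2
  refine HasDerivAt.prodMk (h1.congr_deriv ?_) ((h2.congr_deriv ?_).prodMk (h3.congr_deriv ?_))
  · simp [geodesicField]
    field_simp
    ring
  · simp [geodesicField]
    field_simp
    ring
  · simp [geodesicField]

theorem contDiffAt_radialData {n : WithTop ℕ∞} {z : State} (h0 : z 2 ≠ 0) :
    ContDiffAt ℝ n (radialData M) z := by
  have hi : ∀ i : Fin 7, ContDiffAt ℝ n (fun z : State => z i) z := fun i =>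
    (contDiff_apply ℝ ℝ i).contDiffAt
  have h1 : ContDiffAt ℝ n (fun z : State => 2 * M / z 2) z := contDiffAt_const.div (hi 2) h0
  exact ((contDiffAt_const.sub h1).mul (hi 4)).prodMk ((((hi 2).pow 2).mul (hi 6)).prodMk (hi 2))

/-! ### The LRL proper time near a state and its derivatives -/

/-- The states off the mass shell on which the LRL proper time is smooth. -/
def smoothStates (M : ℝ) (U : Set (ℝ × ℝ)) (k : PointKind) (r₀ : ℝ → ℝ → ℝ) : Set State :=
  {z | radialData M z ∈ regularSet M U k r₀ ∧ z 5 ≠ 0}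

theorem mem_smoothStates (hM : 0 < M) {z : State} (hz : z ∈ domain M U k r₀) :
    z ∈ smoothStates M U k r₀ := ⟨hz.2, velocity_ne_zero hM hz⟩

theorem smoothStates_lt {z : State} (hz : z ∈ smoothStates M U k r₀) : 2 * M < z 2 := hz.1.1

theorem isOpen_smoothStates (hM : 0 < M) (hU : IsOpen U) (hd : IsDistinguished M U r₀ k) :
    IsOpen (smoothStates M U k r₀) := by
  rw [isOpen_iff_eventually]
  intro z hz
  have hr0 : z 2 ≠ 0 := by linarith [smoothStates_lt hz]
  have h1 := (contDiffAt_radialData (M := M) (n := 0) hr0).continuousAt.eventually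
    ((isOpen_regularSet hM hU hd).mem_nhds hz.1)
  have h2 : ContinuousAt (fun z : State => z 5) z := (continuous_apply 5).continuousAt
  filter_upwards [h1, h2.eventually_ne hz.2] with y hy1 hy2 using ⟨hy1, hy2⟩

/-- The function `∫_{r₀}^r dy / |v|` of `(E, L, r)`. -/
abbrev timeFun (M : ℝ) (r₀ : ℝ → ℝ → ℝ) : ℝ × ℝ × ℝ → ℝ := radialIntegral M r₀ fun _ => 1

theorem lrlProperTime_eq {z : State} (hz : z 5 ≠ 0) :
    lrlProperTime M r₀ z = z 0 - Real.sign (z 5) * timeFun M r₀ (radialData M z) := by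
  rw [lrlProperTime, properTimeIntegral_sign (sign_eq_one_or hz)]
  congr 2
  exact properTimeIntegral_one (radialData M z)

theorem lrlProperTime_eventuallyEq (hM : 0 < M) (hU : IsOpen U) (hd : IsDistinguished M U r₀ k)
    {z : State} (hz : z ∈ smoothStates M U k r₀) :
    lrlProperTime M r₀ =ᶠ[𝓝 z] fun y =>
      y 0 - Real.sign (z 5) * timeFun M r₀ (radialData M y) := by
  have h2 : ContinuousAt (fun z : State => z 5) z := (continuous_apply 5).continuousAt
  filter_upwards [eventually_sign_eq h2 hz.2, (isOpen_smoothStates hM hU hd).mem_nhds hz]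
    with y hy hys
  rw [lrlProperTime_eq hys.2, hy]

theorem contDiffAt_timeFun (hM : 0 < M) (hU : IsOpen U) (hd : IsDistinguished M U r₀ k)
    {p : ℝ × ℝ × ℝ} (hp : p ∈ regularSet M U k r₀) : ContDiffAt ℝ 2 (timeFun M r₀) p :=
  contDiffAt_radialIntegral hM hU hd hp fun q _ => smoothAlong_one q

theorem contDiffAt_lrlProperTime (hM : 0 < M) (hU : IsOpen U) (hd : IsDistinguished M U r₀ k)
    {z : State} (hz : z ∈ smoothStates M U k r₀) : ContDiffAt ℝ 2 (lrlProperTime M r₀) z := by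
  refine ContDiffAt.congr_of_eventuallyEq ?_ (lrlProperTime_eventuallyEq hM hU hd hz)
  have hr0 : z 2 ≠ 0 := by linarith [smoothStates_lt hz]
  have h1 := (contDiffAt_timeFun hM hU hd hz.1).comp z (contDiffAt_radialData (M := M) hr0)
  exact (contDiff_apply ℝ ℝ 0).contDiffAt.sub (contDiffAt_const.mul h1)

/-- Partial derivatives of the LRL proper time in a velocity direction. -/
theorem partialD_lrlProperTime (hM : 0 < M) (hU : IsOpen U) (hd : IsDistinguished M U r₀ k)
    {z : State} (hz : z ∈ smoothStates M U k r₀) {i : Fin 7} (hi : i ≠ 0) {w : ℝ × ℝ × ℝ}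
    (hw : HasDerivAt (fun x => radialData M (Function.update z i x)) w (z i)) :
    partialD i (lrlProperTime M r₀) z =
      -(Real.sign (z 5) * fderiv ℝ (timeFun M r₀) (radialData M z) w) := by
  have hI := ((contDiffAt_timeFun hM hU hd hz.1).differentiableAt (by norm_num)).hasFDerivAt
  have hu : Function.update z i (z i) = z := Function.update_eq_self i z
  have h1 := (HasFDerivAt.comp_hasDerivAt_of_eq (z i) hI hw (by rw [hu])).const_mul
    (Real.sign (z 5))
  have h2 := h1.const_sub (z 0)
  refine HasDerivAt.deriv (h2.congr_of_eventuallyEq ?_)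
  have hc : ContinuousAt (fun x => Function.update z i x) (z i) := by fun_prop
  have h3 := hc.eventually (p := fun y => lrlProperTime M r₀ y =
    y 0 - Real.sign (z 5) * timeFun M r₀ (radialData M y)) (by
      simp only [hu]; exact lrlProperTime_eventuallyEq hM hU hd hz)
  filter_upwards [h3] with x hx
  rw [hx, Function.update_of_ne hi.symm]
  rfl

theorem partialD_four (hM : 0 < M) (hU : IsOpen U) (hd : IsDistinguished M U r₀ k)
    {z : State} (hz : z ∈ smoothStates M U k r₀) :
    partialD 4 (lrlProperTime M r₀) z = -(Real.sign (z 5) * ((1 - 2 * M / z 2) *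
      fderiv ℝ (timeFun M r₀) (radialData M z) (1, 0, 0))) := by
  rw [partialD_lrlProperTime hM hU hd hz (by decide) (w := (1 - 2 * M / z 2, 0, 0)), map_triple]
  · ring
  · simp only [radialData, energy, angMom, Function.update_self,
      Function.update_of_ne (show (2 : Fin 7) ≠ 4 by decide),
      Function.update_of_ne (show (6 : Fin 7) ≠ 4 by decide)]
    refine HasDerivAt.prodMk ?_ ((hasDerivAt_const _ _).prodMk (hasDerivAt_const _ _))
    simpa using (hasDerivAt_id (z 4)).const_mul (1 - 2 * M / z 2)

/-- Neither `E` nor `L` contains the radial velocity, so off the mass shell it enters only through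
its locally constant sign. -/
theorem partialD_five (hM : 0 < M) (hU : IsOpen U) (hd : IsDistinguished M U r₀ k)
    {z : State} (hz : z ∈ smoothStates M U k r₀) :
    partialD 5 (lrlProperTime M r₀) z = 0 := by
  rw [partialD_lrlProperTime hM hU hd hz (by decide) (w := 0), map_zero]
  · ring
  · simp only [radialData, energy, angMom,
      Function.update_of_ne (show (2 : Fin 7) ≠ 5 by decide),
      Function.update_of_ne (show (4 : Fin 7) ≠ 5 by decide),
      Function.update_of_ne (show (6 : Fin 7) ≠ 5 by decide)]
    exact hasDerivAt_const _ _

theorem partialD_six (hM : 0 < M) (hU : IsOpen U) (hd : IsDistinguished M U r₀ k)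
    {z : State} (hz : z ∈ smoothStates M U k r₀) :
    partialD 6 (lrlProperTime M r₀) z = -(Real.sign (z 5) * (z 2 ^ 2 *
      fderiv ℝ (timeFun M r₀) (radialData M z) (0, 1, 0))) := by
  rw [partialD_lrlProperTime hM hU hd hz (by decide) (w := (0, z 2 ^ 2, 0)), map_triple]
  · ring
  · simp only [radialData, energy, angMom, Function.update_self,
      Function.update_of_ne (show (2 : Fin 7) ≠ 6 by decide),
      Function.update_of_ne (show (4 : Fin 7) ≠ 6 by decide)]
    refine HasDerivAt.prodMk (hasDerivAt_const _ _) (HasDerivAt.prodMk ?_ (hasDerivAt_const _ _))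
    simpa using (hasDerivAt_id (z 6)).const_mul (z 2 ^ 2)

/-- The derivative of the radial proper time along the scaling of `(E, L)`. -/
def scalingDeriv (M : ℝ) (r₀ : ℝ → ℝ → ℝ) (p : ℝ × ℝ × ℝ) : ℝ :=
  p.1 * fderiv ℝ (timeFun M r₀) p (1, 0, 0) + p.2.1 * fderiv ℝ (timeFun M r₀) p (0, 1, 0)

theorem scaling_lrlProperTime (hM : 0 < M) (hU : IsOpen U) (hd : IsDistinguished M U r₀ k)
    {z : State} (hz : z ∈ smoothStates M U k r₀) :
    scaling (lrlProperTime M r₀) z =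
      -(Real.sign (z 5) * scalingDeriv M r₀ (radialData M z)) := by
  rw [scaling, partialD_four hM hU hd hz, partialD_five hM hU hd hz, partialD_six hM hU hd hz]
  simp only [scalingDeriv, radialData, energy, angMom]
  ring

theorem noetherT_lrlProperTime (hM : 0 < M) (hU : IsOpen U) (hd : IsDistinguished M U r₀ k)
    {z : State} (hz : z ∈ smoothStates M U k r₀) :
    noetherT M (lrlProperTime M r₀) z =
      Real.sign (z 5) * (fderiv ℝ (timeFun M r₀) (radialData M z) (1, 0, 0) -
        z 4 * scalingDeriv M r₀ (radialData M z)) := by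
  have h := smoothStates_lt hz
  have hr0 : z 2 ≠ 0 := by linarith
  have hf : z 2 - 2 * M ≠ 0 := by linarith
  rw [noetherT, scaling_lrlProperTime hM hU hd hz, partialD_four hM hU hd hz]
  field_simp
  ring

theorem noetherR_lrlProperTime (hM : 0 < M) (hU : IsOpen U) (hd : IsDistinguished M U r₀ k)
    {z : State} (hz : z ∈ smoothStates M U k r₀) :
    noetherR M (lrlProperTime M r₀) z =
      Real.sign (z 5) * -(z 5 * scalingDeriv M r₀ (radialData M z)) := by
  rw [noetherR, scaling_lrlProperTime hM hU hd hz, partialD_five hM hU hd hz]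
  ring

theorem noetherPhi_lrlProperTime (hM : 0 < M) (hU : IsOpen U) (hd : IsDistinguished M U r₀ k)
    {z : State} (hz : z ∈ smoothStates M U k r₀) :
    noetherPhi (lrlProperTime M r₀) z =
      Real.sign (z 5) * (-fderiv ℝ (timeFun M r₀) (radialData M z) (0, 1, 0) -
        z 6 * scalingDeriv M r₀ (radialData M z)) := by
  have h := smoothStates_lt hz
  have hr0 : z 2 ≠ 0 := by linarith
  rw [noetherPhi, scaling_lrlProperTime hM hU hd hz, partialD_six hM hU hd hz]
  field_simp
  ring

/-! ### Mixed derivatives -/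

theorem fderiv_timeFun_thd (hM : 0 < M) (hU : IsOpen U) (hd : IsDistinguished M U r₀ k)
    {p : ℝ × ℝ × ℝ} (hp : p ∈ regularSet M U k r₀) :
    fderiv ℝ (timeFun M r₀) p (0, 0, 1) = 1 / √(radialSq M p.1 p.2.1 p.2.2) :=
  fderiv_thd_eq ((contDiffAt_timeFun hM hU hd hp).differentiableAt (by norm_num))
    (hasDerivAt_integral_radius hM hd hp (g := fun _ => 1) continuousOn_const measurable_const
      continuousAt_const)

theorem differentiableAt_fderiv_timeFun (hM : 0 < M) (hU : IsOpen U)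
    (hd : IsDistinguished M U r₀ k) {p : ℝ × ℝ × ℝ} (hp : p ∈ regularSet M U k r₀) :
    DifferentiableAt ℝ (fderiv ℝ (timeFun M r₀)) p :=
  ((contDiffAt_timeFun hM hU hd hp).fderiv_right (m := 1) (by norm_num)).differentiableAt
    (by norm_num)

theorem hasFDerivAt_fderiv_timeFun_apply (hM : 0 < M) (hU : IsOpen U)
    (hd : IsDistinguished M U r₀ k) {p : ℝ × ℝ × ℝ} (hp : p ∈ regularSet M U k r₀)
    (v : ℝ × ℝ × ℝ) : HasFDerivAt (fun q => fderiv ℝ (timeFun M r₀) q v)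
      ((ContinuousLinearMap.apply ℝ ℝ v).comp (fderiv ℝ (fderiv ℝ (timeFun M r₀)) p)) p :=
  (ContinuousLinearMap.apply ℝ ℝ v).hasFDerivAt.comp p
    (differentiableAt_fderiv_timeFun hM hU hd hp).hasFDerivAt

/-- The mixed second derivatives of the radial proper time in `r` and a direction in `(E, L)`. -/
theorem mixed_fderiv_timeFun (hM : 0 < M) (hU : IsOpen U) (hd : IsDistinguished M U r₀ k)
    {p : ℝ × ℝ × ℝ} (hp : p ∈ regularSet M U k r₀) (u v : ℝ) :
    fderiv ℝ (fderiv ℝ (timeFun M r₀)) p (0, 0, 1) (u, v, 0) =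
      -(p.1 * u - (1 - 2 * M / p.2.2) * (p.2.1 * v / p.2.2 ^ 2)) /
        radialSq M p.1 p.2.1 p.2.2 / √(radialSq M p.1 p.2.1 p.2.2) := by
  have hC := contDiffAt_timeFun hM hU hd hp
  -- Exchanging the order puts the `r`-derivative first. It is the explicit `1/√Q`, so no singular
  -- integral has to be differentiated twice.
  rw [hC.isSymmSndFDerivAt (by simp) (0, 0, 1) (u, v, 0)]
  have hl1 : HasDerivAt (fun t : ℝ => p.1 + t * u) u 0 := by
    simpa using ((hasDerivAt_id (0 : ℝ)).mul_const u).const_add p.1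
  have hl2 : HasDerivAt (fun t : ℝ => p.2.1 + t * v) v 0 := by
    simpa using ((hasDerivAt_id (0 : ℝ)).mul_const v).const_add p.2.1
  have hline : HasDerivAt (fun t : ℝ => (p.1 + t * u, p.2.1 + t * v, p.2.2)) (u, v, 0) 0 :=
    hl1.prodMk (hl2.prodMk (hasDerivAt_const _ _))
  have h1 := HasFDerivAt.comp_hasDerivAt_of_eq (0 : ℝ)
    (hasFDerivAt_fderiv_timeFun_apply hM hU hd hp (0, 0, 1)) hline (by simp)
  refine h1.unique ?_
  have hQ := hasDerivAt_radialSq M p.2.2 hl1 hl2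
  have h2 := hasDerivAt_div_sqrt (hasDerivAt_const (0 : ℝ) (1 : ℝ)) hQ (by simpa using hp.2.2.1)
  refine (h2.congr_of_eventuallyEq ?_).congr_deriv ?_
  · filter_upwards [hline.continuousAt.eventually
      ((isOpen_regularSet hM hU hd).mem_nhds (by simpa using hp))] with t ht
    exact fderiv_timeFun_thd hM hU hd ht
  · simp only [zero_mul, add_zero]
    congr 1
    have := hp.2.2.1.ne'
    field_simp
    ring

/-! ### The generator -/

/-- The components of the generator have an explicit form `G` only near `z`, which is enough to
evaluate their total derivative as a derivative along a line. -/
theorem totalD_eq {G F : State → ℝ} {z : State} {v : ℝ} (hFG : F =ᶠ[𝓝 z] G)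
    (hG : DifferentiableAt ℝ G z)
    (h : HasDerivAt (fun t : ℝ => G (z + t • geodesicField M z)) v 0) : totalD M F z = v := by
  rw [totalD, hFG.fderiv_eq]
  refine HasDerivAt.unique ?_ h
  exact hG.hasFDerivAt.hasLineDerivAt _

theorem hasDerivAt_line (z w : State) : HasDerivAt (fun t : ℝ => z + t • w) w 0 := by
  simpa using ((hasDerivAt_id (0 : ℝ)).smul_const w).const_add z

theorem hasDerivAt_fderiv_timeFun_line (hM : 0 < M) (hU : IsOpen U)
    (hd : IsDistinguished M U r₀ k) {z : State} (hz : z ∈ smoothStates M U k r₀) (u v : ℝ) :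
    HasDerivAt (fun t : ℝ => fderiv ℝ (timeFun M r₀)
        (radialData M (z + t • geodesicField M z)) (u, v, 0))
      (z 5 * (-(energy M z * u - (1 - 2 * M / z 2) * (angMom z * v / z 2 ^ 2)) /
        radialSq M (energy M z) (angMom z) (z 2) /
          √(radialSq M (energy M z) (angMom z) (z 2)))) 0 := by
  have h1 := hasDerivAt_radialData_geodesic hM (by simp) (hasDerivAt_line z (geodesicField M z))
    (smoothStates_lt hz)
  have h2 := HasFDerivAt.comp_hasDerivAt_of_eq (0 : ℝ)
    (hasFDerivAt_fderiv_timeFun_apply hM hU hd hz.1 (u, v, 0)) h1 (by simp)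
  refine h2.congr_deriv ?_
  have := mixed_fderiv_timeFun hM hU hd hz.1 u v
  rw [show ((0 : ℝ), (0 : ℝ), z 5) = z 5 • ((0 : ℝ), (0 : ℝ), (1 : ℝ)) by simp, map_smul,
    ContinuousLinearMap.comp_apply, smul_eq_mul]
  exact congrArg (fun c => z 5 * c) this

theorem differentiableAt_fderiv_timeFun_radialData (hM : 0 < M) (hU : IsOpen U)
    (hd : IsDistinguished M U r₀ k) {z : State} (hz : z ∈ smoothStates M U k r₀)
    (v : ℝ × ℝ × ℝ) :
    DifferentiableAt ℝ (fun y => fderiv ℝ (timeFun M r₀) (radialData M y) v) z := by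
  have hr0 : z 2 ≠ 0 := by linarith [smoothStates_lt hz]
  exact (hasFDerivAt_fderiv_timeFun_apply hM hU hd hz.1 v).differentiableAt.comp z
    ((contDiffAt_radialData (n := 1) hr0).differentiableAt one_ne_zero)

/-- Along the field `E` and `L` stay fixed while `r` moves with speed `v`, so the derivative of `K`
is `v (E ∂_E + L ∂_L)(1/√Q) = -v (Q + f)/Q^(3/2)`. -/
theorem hasDerivAt_scalingDeriv_line (hM : 0 < M) (hU : IsOpen U)
    (hd : IsDistinguished M U r₀ k) {z : State} (hz : z ∈ smoothStates M U k r₀) :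
    HasDerivAt (fun t : ℝ => scalingDeriv M r₀ (radialData M (z + t • geodesicField M z)))
      (-z 5 * (1 + (1 - 2 * M / z 2) / radialSq M (energy M z) (angMom z) (z 2)) /
          √(radialSq M (energy M z) (angMom z) (z 2))) 0 := by
  have h1 := hasDerivAt_radialData_geodesic hM (by simp) (hasDerivAt_line z (geodesicField M z))
    (smoothStates_lt hz)
  have hA := hasDerivAt_fderiv_timeFun_line hM hU hd hz 1 0
  have hB := hasDerivAt_fderiv_timeFun_line hM hU hd hz 0 1
  have he : HasDerivAt (fun t : ℝ => (radialData M (z + t • geodesicField M z)).1) 0 0 :=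
    (ContinuousLinearMap.fst ℝ ℝ (ℝ × ℝ)).hasFDerivAt.comp_hasDerivAt _ h1
  have hl : HasDerivAt (fun t : ℝ => (radialData M (z + t • geodesicField M z)).2.1) 0 0 :=
    ((ContinuousLinearMap.fst ℝ ℝ ℝ).comp
    (ContinuousLinearMap.snd ℝ ℝ (ℝ × ℝ))).hasFDerivAt.comp_hasDerivAt _ h1
  have h2 := (he.mul hA).add (hl.mul hB)
  refine h2.congr_deriv ?_
  have hQ : 0 < radialSq M (energy M z) (angMom z) (z 2) := hz.1.2.2.1
  have hs := Real.sqrt_pos.2 hQ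
  have hE : radialSq M (energy M z) (angMom z) (z 2) = energy M z ^ 2 -
    (1 - 2 * M / z 2) * (1 + angMom z ^ 2 / z 2 ^ 2) := rfl
  have hr0 : z 2 ≠ 0 := by linarith [smoothStates_lt hz]
  simp only [zero_smul, add_zero, radialData]
  generalize √(radialSq M (energy M z) (angMom z) (z 2)) = v at *
  generalize radialSq M (energy M z) (angMom z) (z 2) = Q at *
  generalize 1 - 2 * M / z 2 = f at *
  field_simp at hE ⊢
  linear_combination z 5 * hE

theorem differentiableAt_scalingDeriv (hM : 0 < M) (hU : IsOpen U)
    (hd : IsDistinguished M U r₀ k) {z : State} (hz : z ∈ smoothStates M U k r₀) :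
    DifferentiableAt ℝ (fun y => scalingDeriv M r₀ (radialData M y)) z := by
  have hr0 : z 2 ≠ 0 := by linarith [smoothStates_lt hz]
  have h1 := (contDiffAt_radialData (M := M) (n := 1) hr0).differentiableAt one_ne_zero
  exact (h1.fst.mul (differentiableAt_fderiv_timeFun_radialData hM hU hd hz _)).add
    (h1.snd.fst.mul (differentiableAt_fderiv_timeFun_radialData hM hU hd hz _))

/-- The gauged generator of the LRL proper time, in terms of the derivatives of the radial proper
time. -/
def explicitGenerator (M : ℝ) (r₀ : ℝ → ℝ → ℝ) (z : State) : State :=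
  ![Real.sign (z 5) * scalingDeriv M r₀ (radialData M z),
    Real.sign (z 5) * fderiv ℝ (timeFun M r₀) (radialData M z) (1, 0, 0),
    0,
    -(Real.sign (z 5) * fderiv ℝ (timeFun M r₀) (radialData M z) (0, 1, 0)),
    z 4,
    (radialSq M (energy M z) (angMom z) (z 2) + (1 - 2 * M / z 2)) / z 5,
    z 6]

/-- The gauge function is `χ = s K`, and `χ D_τ` cancels every term in which `K` is
undifferentiated, apart from the `τ`-component. In the velocity components only derivatives of
`I_E`, `I_L` and `K` survive; they simplify by `s v = √Q`, which is where the normalisation is used.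
-/
theorem gaugedGenerator_lrlProperTime (hM : 0 < M) (hU : IsOpen U)
    (hd : IsDistinguished M U r₀ k) {z : State} (hz : z ∈ domain M U k r₀) :
    gaugedGenerator M (lrlProperTime M r₀) z = explicitGenerator M r₀ z := by
  have hz' := mem_smoothStates hM hz
  have hv0 := hz'.2
  have hr := smoothStates_lt hz'
  have hr0 : z 2 ≠ 0 := by linarith
  have hf0 : z 2 - 2 * M ≠ 0 := by linarith
  have hQ : 0 < radialSq M (energy M z) (angMom z) (z 2) := hz.2.2.2.1
  have hs := Real.sqrt_pos.2 hQ
  have hv := velocity_eq hM hz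
  have hv2 := sq_velocity hM hz
  have hsgn := sign_eq_one_or hv0
  have h5 : ContinuousAt (fun z : State => z 5) z := (continuous_apply 5).continuousAt
  -- The formulas for the components must hold near `z`, off the mass shell, with the sign frozen,
  -- before they are differentiated.
  have hev := (eventually_sign_eq h5 hv0).and ((isOpen_smoothStates hM hU hd).mem_nhds hz')
  have hK := hasDerivAt_scalingDeriv_line hM hU hd hz'
  have hKd := differentiableAt_scalingDeriv hM hU hd hz'
  have hcomp : ∀ i : Fin 7, HasDerivAt (fun t : ℝ => (z + t • geodesicField M z) i)
      (geodesicField M z i) 0 := fun i => hasDerivAt_pi.1 (hasDerivAt_line z _) i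
  have hci : ∀ i : Fin 7, DifferentiableAt ℝ (fun y : State => y i) z := fun i =>
    differentiableAt_apply i z
  have hT : totalD M (noetherT M (lrlProperTime M r₀)) z = _ :=
    totalD_eq (G := fun y => Real.sign (z 5) * (fderiv ℝ (timeFun M r₀) (radialData M y) (1, 0, 0) -
        y 4 * scalingDeriv M r₀ (radialData M y))) (by
        filter_upwards [hev] with y hy
        rw [noetherT_lrlProperTime hM hU hd hy.2, hy.1])
      (((differentiableAt_fderiv_timeFun_radialData hM hU hd hz' _).sub
        ((hci 4).mul hKd)).const_mul _)
      (((hasDerivAt_fderiv_timeFun_line hM hU hd hz' 1 0).sub ((hcomp 4).mul hK)).const_mul _)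
  have hR : totalD M (noetherR M (lrlProperTime M r₀)) z = _ :=
    totalD_eq (G := fun y => Real.sign (z 5) * -(y 5 * scalingDeriv M r₀ (radialData M y))) (by
        filter_upwards [hev] with y hy
        rw [noetherR_lrlProperTime hM hU hd hy.2, hy.1])
      (((hci 5).mul hKd).neg.const_mul _)
      (((hcomp 5).mul hK).neg.const_mul _)
  have hP : totalD M (noetherPhi (lrlProperTime M r₀)) z = _ :=
    totalD_eq (G := fun y => Real.sign (z 5) *
        (-fderiv ℝ (timeFun M r₀) (radialData M y) (0, 1, 0) -
        y 6 * scalingDeriv M r₀ (radialData M y))) (by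
        filter_upwards [hev] with y hy
        rw [noetherPhi_lrlProperTime hM hU hd hy.2, hy.1])
      (((differentiableAt_fderiv_timeFun_radialData hM hU hd hz' _).neg.sub
        ((hci 6).mul hKd)).const_mul _)
      (((hasDerivAt_fderiv_timeFun_line hM hU hd hz' 0 1).neg.sub
        ((hcomp 6).mul hK)).const_mul _)
  have hχ : -(noetherR M (lrlProperTime M r₀) z / z 5) =
      Real.sign (z 5) * scalingDeriv M r₀ (radialData M z) := by
    rw [noetherR_lrlProperTime hM hU hd hz']
    field_simp
  have hss : Real.sign (z 5) * z 5 = √(radialSq M (energy M z) (angMom z) (z 2)) := by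
    nth_rewrite 2 [hv]
    rcases hsgn with h | h <;> rw [h] <;> ring
  have hE : energy M z = (1 - 2 * M / z 2) * z 4 := rfl
  have hL : angMom z = z 2 ^ 2 * z 6 := rfl
  unfold gaugedGenerator prolongedGenerator
  rw [hχ, hT, hR, hP, noetherT_lrlProperTime hM hU hd hz', noetherR_lrlProperTime hM hU hd hz',
    noetherPhi_lrlProperTime hM hU hd hz']
  simp only [zero_smul, add_zero]
  have hs' : √(radialSq M (energy M z) (angMom z) (z 2)) ≠ 0 := hs.ne'
  have hQ' := hQ.ne'
  generalize √(radialSq M (energy M z) (angMom z) (z 2)) = v at *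
  ext i
  fin_cases i
  · simp [explicitGenerator, geodesicField]
  · simp [explicitGenerator, geodesicField]; ring
  · simp [explicitGenerator, geodesicField]; ring
  · simp [explicitGenerator, geodesicField]; ring
  · simp only [explicitGenerator, Pi.add_apply, Pi.smul_apply, smul_eq_mul]
    simp
    -- The acceleration and `K` are made opaque, since they only have to cancel.
    generalize geodesicField M z 4 = w
    generalize scalingDeriv M r₀ (radialData M z) = K
    trans Real.sign (z 5) * z 5 / v * (z 4 * (1 + (1 - 2 * M / z 2) /
      radialSq M (energy M z) (angMom z) (z 2)) - energy M z /
        radialSq M (energy M z) (angMom z) (z 2))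
    · ring
    · rw [hss, div_self hs']
      nth_rewrite 2 [hE]
      ring
  · simp [explicitGenerator]
    generalize geodesicField M z 5 = w
    generalize scalingDeriv M r₀ (radialData M z) = K
    trans Real.sign (z 5) * z 5 / v * (z 5 * (1 + (1 - 2 * M / z 2) /
      radialSq M (energy M z) (angMom z) (z 2)))
    · ring
    · rw [hss, div_self hs', eq_div_iff hv0, ← hv2]
      field_simp
  · simp [explicitGenerator]
    generalize geodesicField M z 6 = w
    generalize scalingDeriv M r₀ (radialData M z) = K
    trans Real.sign (z 5) * z 5 / v * (z 6 * (1 + (1 - 2 * M / z 2) /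
      radialSq M (energy M z) (angMom z) (z 2)) - (1 - 2 * M / z 2) * (angMom z / z 2 ^ 2) /
        radialSq M (energy M z) (angMom z) (z 2))
    · ring
    · rw [hss, div_self hs', show angMom z / z 2 ^ 2 = z 6 by rw [hL]; field_simp]
      ring

end SchwarzschildLRL
end

/-! ### Convergence, dependence on the radius, and the interval of parameters -/

noncomputable section
namespace SchwarzschildLRL

variable {M : ℝ} {U : Set (ℝ × ℝ)} {k : PointKind} {r₀ : ℝ → ℝ → ℝ} {E L r s : ℝ}

/-! ### Convergence of the radial integrals -/

theorem intervalIntegrable_properTime (hM : 0 < M) (hd : IsDistinguished M U r₀ k)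
    (h : Regular M U k r₀ r E L) (hs : s = 1 ∨ s = -1) :
    IntervalIntegrable (fun y => 1 / radialSpeed M s E L y) MeasureTheory.volume (r₀ E L) r := by
  have h1 := (radialIntegral_substitution hM hd h (g := fun _ => 1) continuousOn_const).1
  refine (h1.const_mul s).congr_ae (Eventually.of_forall fun y => ?_)
  simpa [radialSpeed] using (one_div_mul_radialSpeed hs M E L y 1 1).symm

theorem intervalIntegrable_angle (hM : 0 < M) (hd : IsDistinguished M U r₀ k)
    (h : Regular M U k r₀ r E L) (hs : s = 1 ∨ s = -1) :
    IntervalIntegrable (fun y => 1 / (y ^ 2 * radialSpeed M s E L y)) MeasureTheory.volume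
      (r₀ E L) r := by
  have hg : ContinuousOn (fun y : ℝ => 1 / y ^ 2) (uIcc (r₀ E L) r) :=
    continuousOn_const.div (by fun_prop) fun y hy => by
      have := two_mul_le_of_mem_uIcc (h.le_distinguished hM hd) h.1 hy
      exact pow_ne_zero 2 (by linarith)
  have h1 := (radialIntegral_substitution hM hd h hg).1
  refine (h1.const_mul s).congr_ae (Eventually.of_forall fun y => ?_)
  simp only
  rw [one_div_mul_radialSpeed hs, div_div, radialSpeed, one_mul]

theorem intervalIntegrable_time (hM : 0 < M) (hk : k ≠ .horizon) (hd : IsDistinguished M U r₀ k)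
    (h : Regular M U k r₀ r E L) (hs : s = 1 ∨ s = -1) :
    IntervalIntegrable (fun y => y / ((y - 2 * M) * radialSpeed M s E L y)) MeasureTheory.volume
      (r₀ E L) r := by
  have hg : ContinuousOn (fun y : ℝ => y / (y - 2 * M)) (uIcc (r₀ E L) r) :=
    continuousOn_id.div (by fun_prop) fun y hy => by
      have := two_mul_lt_of_mem_uIcc (two_mul_lt_distinguished hM hd hk h.2.1) h.1 hy
      linarith
  have h1 := (radialIntegral_substitution hM hd h hg).1
  refine (h1.const_mul s).congr_ae (Eventually.of_forall fun y => ?_)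
  simp only
  rw [one_div_mul_radialSpeed hs, div_div, radialSpeed, one_mul]

theorem intervalIntegrable_horizon (hM : 0 < M) (hd : IsDistinguished M U r₀ .horizon)
    (h : Regular M U .horizon r₀ r E L) (hs : s = 1 ∨ s = -1) :
    IntervalIntegrable (fun y => y / ((y - 2 * M) * radialSpeed M s E L y) -
      horizonResidue M s E L / (y - 2 * M)) MeasureTheory.volume (2 * M) r := by
  have ha := hd E L h.2.1
  have h1 := (radialIntegral_substitution hM hd h
    (smoothAlong_horizonNumerator hM (by simp) hd (E, L, r) h).continuousOn).1
  rw [ha] at h1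
  refine ((h1.const_mul |E|⁻¹).const_mul s).congr fun y hy => ?_
  have hy1 : y ∈ uIcc (r₀ E L) r := by rw [ha]; exact uIoc_subset_uIcc hy
  rw [uIoc_of_le h.1.le] at hy
  simp only
  rw [← horizon_integrand_eq hM (h.energy_ne_zero hM) hy.1
    (radialSq_pos_of_ne_turning (by simp) h hy1), one_div_mul_radialSpeed hs,
    horizonResidue_sign hs]
  ring

/-- The finite part of the time integral at the horizon as a limit. -/
theorem tendsto_timeIntegral_horizon (hM : 0 < M) (hd : IsDistinguished M U r₀ .horizon)
    (h : Regular M U .horizon r₀ r E L) (hs : s = 1 ∨ s = -1) :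
    Tendsto (fun δ => (∫ y in (2 * M + δ)..r, y / ((y - 2 * M) * radialSpeed M s E L y)) +
      horizonResidue M s E L * Real.log (δ / (2 * M))) (𝓝[>] 0)
      (𝓝 (timeIntegral M s E L (2 * M) r)) := by
  have hr : 2 * M < r := h.1
  have hint := intervalIntegrable_horizon hM hd h hs
  set c := horizonResidue M s E L
  rw [timeIntegral, if_pos rfl]
  -- The regularised integral is continuous in its lower limit. On `[2M + δ, r]` the subtracted pole
  -- integrates to `c (log (r - 2M) - log δ)`, whose divergence the added logarithm compensates.
  have hprim := intervalIntegral.continuousOn_primitive_interval_left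
    ((intervalIntegrable_iff' (by simp)).1 hint)
  have hT : Tendsto (fun δ : ℝ => 2 * M + δ) (𝓝[>] 0) (𝓝[uIcc (2 * M) r] (2 * M)) := by
    refine tendsto_nhdsWithin_iff.2 ⟨?_, ?_⟩
    · have : ContinuousAt (fun δ : ℝ => 2 * M + δ) 0 := by fun_prop
      simpa using this.tendsto.mono_left (nhdsWithin_le_nhds (s := Ioi 0))
    · filter_upwards [Ioo_mem_nhdsGT (sub_pos.2 hr)] with δ hδ
      rw [uIcc_of_le hr.le]
      exact ⟨by linarith [hδ.1], by linarith [hδ.2]⟩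
  have hlim := ((hprim (2 * M) left_mem_uIcc).tendsto.comp hT).add_const
    (c * Real.log ((r - 2 * M) / (2 * M)))
  refine hlim.congr' ?_
  filter_upwards [Ioo_mem_nhdsGT (sub_pos.2 hr)] with δ hδ
  have hδr : 2 * M + δ ≤ r := by linarith [hδ.2]
  have hsub : uIcc (2 * M + δ) r ⊆ uIcc (2 * M) r := by
    rw [uIcc_of_le hr.le, uIcc_of_le hδr]
    exact Icc_subset_Icc (by linarith [hδ.1]) le_rfl
  have hinv : IntervalIntegrable (fun y => c / (y - 2 * M)) MeasureTheory.volume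
      (2 * M + δ) r := by
    refine ContinuousOn.intervalIntegrable (continuousOn_const.div (by fun_prop) fun y hy => ?_)
    rw [uIcc_of_le hδr] at hy
    linarith [hy.1, hδ.1]
  have hval : ∫ y in (2 * M + δ)..r, c / (y - 2 * M) =
      c * (Real.log (r - 2 * M) - Real.log δ) := by
    simp only [div_eq_mul_inv]
    rw [intervalIntegral.integral_const_mul,
      intervalIntegral.integral_comp_sub_right (fun y => y⁻¹) (2 * M), add_sub_cancel_left,
      integral_inv_of_pos hδ.1 (by linarith), Real.log_div (by linarith) hδ.1.ne']
  have hsum := intervalIntegral.integral_add (hint.mono_set hsub) hinv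
  simp only [sub_add_cancel] at hsum
  simp only [Function.comp]
  rw [hsum, hval, Real.log_div (by linarith) (by positivity), Real.log_div hδ.1.ne'
    (by positivity)]
  ring

/-! ### Derivatives of the radial integrals with respect to the radius -/

theorem hasDerivAt_properTimeIntegral_radius (hM : 0 < M) (hd : IsDistinguished M U r₀ k)
    (h : Regular M U k r₀ r E L) (hs : s = 1 ∨ s = -1) :
    HasDerivAt (fun x => properTimeIntegral M s E L (r₀ E L) x) (1 / radialSpeed M s E L r) r := by
  have h1 := (hasDerivAt_integral_radius hM hd h (g := fun _ => 1) continuousOn_const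
    measurable_const continuousAt_const).const_mul s
  have h2 := one_div_mul_radialSpeed hs M E L r 1 1
  simp only [one_mul] at h2
  rw [h2]
  simp only [radialSpeed, one_mul]
  refine h1.congr_of_eventuallyEq (Eventually.of_forall fun x => ?_)
  simp only
  rw [properTimeIntegral_sign hs]
  simp [properTimeIntegral, radialSpeed]

theorem hasDerivAt_angleIntegral_radius (hM : 0 < M) (hd : IsDistinguished M U r₀ k)
    (h : Regular M U k r₀ r E L) (hs : s = 1 ∨ s = -1) :
    HasDerivAt (fun x => angleIntegral M s E L (r₀ E L) x)
      (1 / (r ^ 2 * radialSpeed M s E L r)) r := by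
  have hr0 : r ≠ 0 := by linarith [h.1]
  have hg : ContinuousOn (fun y : ℝ => 1 / y ^ 2) (uIcc (r₀ E L) r) :=
    continuousOn_const.div (by fun_prop) fun y hy => by
      have := two_mul_le_of_mem_uIcc (h.le_distinguished hM hd) h.1 hy
      exact pow_ne_zero 2 (by linarith)
  have h1 := (hasDerivAt_integral_radius hM hd h hg (by fun_prop)
    (continuousAt_const.div (by fun_prop) (pow_ne_zero 2 hr0))).const_mul s
  rw [one_div_mul_radialSpeed hs]
  simp only [radialSpeed, one_mul, ← div_div]
  refine h1.congr_of_eventuallyEq (Eventually.of_forall fun x => ?_)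
  simp only
  rw [angleIntegral_sign hs]
  simp only [angleIntegral, radialSpeed, one_mul, div_div]

/-- The factor `E` is kept so that both representations of the time integral, regular and finite
part, apply. At the horizon the logarithm restores the pole removed from the integrand. -/
theorem hasDerivAt_mul_timeIntegral_radius (hM : 0 < M) (hU : IsOpen U)
    (hd : IsDistinguished M U r₀ k) (h : Regular M U k r₀ r E L) (hs : s = 1 ∨ s = -1) :
    HasDerivAt (fun x => E * timeIntegral M s E L (r₀ E L) x)
      (E * (r / ((r - 2 * M) * radialSpeed M s E L r))) r := by
  have hr := h.1
  have hr0 : 0 < r := by linarith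
  have hr2 : r - 2 * M ≠ 0 := by linarith
  have hQ := h.2.2.1
  have hsq := Real.sqrt_pos.2 hQ
  have hp : (E, L, r) ∈ regularSet M U k r₀ := h
  suffices h1 : HasDerivAt (fun x => E * timeIntegral M 1 E L (r₀ E L) x)
      (E * (r / ((r - 2 * M) * radialSpeed M 1 E L r))) r by
    refine ((h1.const_mul s).congr_deriv ?_).congr_of_eventuallyEq
      (Eventually.of_forall fun x => ?_)
    · rw [one_div_mul_radialSpeed hs]; ring
    · simp only
      rw [timeIntegral_sign hs]; ring
  by_cases hk : k = .horizon
  · subst hk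
    have hE := h.energy_ne_zero hM
    have hcont := smoothAlong_horizonNumerator hM (by simp) hd (E, L, r) hp
    have hm : Measurable fun y => horizonNumerator M (E, L, y) := by
      unfold horizonNumerator radialSq; fun_prop
    have h1 := hasDerivAt_integral_radius hM hd h hcont.continuousOn hm
      ((hcont r right_mem_uIcc).continuousAt.comp (f := fun y => (E, L, y)) (by fun_prop))
    have h2 : HasDerivAt (fun x => Real.log ((x - 2 * M) / (2 * M))) (1 / (r - 2 * M)) r := by
      have := ((hasDerivAt_id r).sub_const (2 * M)).div_const (2 * M)
      refine (this.log (div_ne_zero hr2 (by positivity))).congr_deriv ?_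
      simp only [id]
      field_simp
    have h3 := ((h1.add (h2.const_mul (2 * M))).const_mul (Real.sign E))
    refine (h3.congr_deriv ?_).congr_of_eventuallyEq ?_
    · have h4 := horizon_integrand_eq hM hE hr hQ
      rw [horizonResidue_one hM, sub_eq_iff_eq_add] at h4
      rw [h4]
      have h5 := abs_ne_zero.2 hE
      have h6 : E * |E|⁻¹ = Real.sign E := by
        rw [← div_eq_mul_inv, div_eq_iff h5, real_sign_mul_abs]
      rw [← h6]
      ring
    · have hc : ContinuousAt (fun x : ℝ => (E, L, x)) r := by fun_prop
      filter_upwards [hc.eventually ((isOpen_regularSet hM hU hd).mem_nhds hp)] with x hx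
      exact mul_timeIntegral_horizon hM hd (p := (E, L, x)) hx
  · have hg : ContinuousOn (fun y : ℝ => E * y / (y - 2 * M)) (uIcc (r₀ E L) r) :=
      (smoothAlong_time hM hk hd _ hp).continuousOn
    have h1 := hasDerivAt_integral_radius hM hd h hg (by fun_prop)
      (ContinuousAt.div (by fun_prop) (by fun_prop) hr2)
    refine (h1.congr_deriv ?_).congr_of_eventuallyEq (Eventually.of_forall fun x => ?_)
    · rw [radialSpeed, one_mul, mul_div_assoc', div_div]
    · exact mul_timeIntegral_one hM hk hd (p := (E, L, x)) h.2.1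

/-! ### The rates for a centripetal point -/

/-- In the form of `cAngle_eq` and `cTime_eq` the denominators are `L`, `r₀`, `r₀ - 2M`, `r₀ - 6M`
and the speed at `r₀`, all nonzero at a regular centripetal point. -/
theorem continuousAt_cAngle_cTime (hM : 0 < M) (hU : IsOpen U)
    (hd : IsDistinguished M U r₀ .centripetal) (hs : s = 1 ∨ s = -1)
    (h : Regular M U .centripetal r₀ r E L) :
    ContinuousAt (fun p : ℝ × ℝ => cAngle M s r₀ p.1 p.2) (E, L) ∧
    ContinuousAt (fun p : ℝ × ℝ => cTime M s r₀ p.1 p.2) (E, L) := by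
  have hq := h.2.1
  obtain ⟨hL, h3, h6, -⟩ := centripetal_ne hM hU hd hq
  have hr0 : r₀ E L ≠ 0 := by linarith
  have h2 : r₀ E L - 2 * M ≠ 0 := by linarith
  have h6' : r₀ E L - 6 * M ≠ 0 := sub_ne_zero.2 h6
  have hQ := radialSq_pos_of_ne_turning (by simp) h left_mem_uIcc
  have hs0 : s ≠ 0 := by rcases hs with rfl | rfl <;> norm_num
  have hr : ContinuousAt (fun p : ℝ × ℝ => r₀ p.1 p.2) (E, L) :=
    (contDiffAt_distinguished_of_mem hM hU hd hq).continuousAt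
  have hspeed : ContinuousAt (fun p : ℝ × ℝ => radialSpeed M s p.1 p.2 (r₀ p.1 p.2)) (E, L) := by
    refine continuousAt_const.mul (ContinuousAt.sqrt ?_)
    exact (contDiffAt_radialSq (n := 0) contDiffAt_fst contDiffAt_snd
      ((contDiffAt_distinguished_of_mem hM hU hd hq).of_le (by norm_num)) hr0).continuousAt
  have hspeed0 : radialSpeed M s E L (r₀ E L) ≠ 0 :=
    mul_ne_zero hs0 (Real.sqrt_ne_zero'.2 hQ)
  have hfac : ContinuousAt (fun p : ℝ × ℝ =>
      2 * r₀ p.1 p.2 * (r₀ p.1 p.2 - 3 * M) / (r₀ p.1 p.2 - 6 * M)) (E, L) :=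
    ((continuousAt_const.mul hr).mul (hr.sub continuousAt_const)).div
      (hr.sub continuousAt_const) h6'
  have hev : ∀ᶠ p in 𝓝 (E, L), p ∈ U := hU.mem_nhds hq
  constructor
  · refine ContinuousAt.congr_of_eventuallyEq ?_ (hev.mono fun p hp => cAngle_eq hM hU hd hp s)
    exact ((hfac.div continuousAt_snd hL).mul (continuousAt_const.add
      ((continuousAt_snd.pow 2).div (hr.pow 2) (pow_ne_zero 2 hr0)))).div hspeed hspeed0
  · refine ContinuousAt.congr_of_eventuallyEq ?_ (hev.mono fun p hp => cTime_eq hM hU hd hp s)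
    exact (hfac.mul ((continuousAt_fst.mul hr).div (hr.sub continuousAt_const) h2)).div hspeed
      hspeed0

/-! ### The set of parameters -/

/-- The values of the scaling parameter at which the scaled constants of motion are regular. -/
def regularParams (M : ℝ) (U : Set (ℝ × ℝ)) (k : PointKind) (r₀ : ℝ → ℝ → ℝ) (z : State) : Set ℝ :=
  {x | Regular M U k r₀ (z 2) (energy M z * Real.exp x) (angMom z * Real.exp x)}

theorem isOpen_regularParams (hM : 0 < M) (hU : IsOpen U) (hd : IsDistinguished M U r₀ k)
    (z : State) : IsOpen (regularParams M U k r₀ z) := by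
  have hc : Continuous fun x : ℝ => (energy M z * Real.exp x, angMom z * Real.exp x, z 2) := by
    fun_prop
  exact (isOpen_regularSet hM hU hd).preimage hc

theorem mem_paramSet_iff {z : State} {ε : ℝ} :
    ε ∈ paramSet M U k r₀ z ↔ uIcc 0 ε ⊆ regularParams M U k r₀ z := Iff.rfl

theorem regular_of_mem_paramSet {z : State} {ε : ℝ} (h : ε ∈ paramSet M U k r₀ z) :
    Regular M U k r₀ (z 2) (energy M z * Real.exp ε) (angMom z * Real.exp ε) :=
  h ε right_mem_uIcc

/-- The parameters are those joined to `0` inside the open set `regularParams`, and such a segment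
can be prolonged by a small ball about its end. -/
theorem isOpen_paramSet (hM : 0 < M) (hU : IsOpen U) (hd : IsDistinguished M U r₀ k)
    (z : State) : IsOpen (paramSet M U k r₀ z) := by
  rw [Metric.isOpen_iff]
  intro ε hε
  obtain ⟨δ, hδ, hb⟩ := Metric.isOpen_iff.1 (isOpen_regularParams hM hU hd z) ε
    (hε ε right_mem_uIcc)
  refine ⟨δ, hδ, fun x hx => mem_paramSet_iff.2 ?_⟩
  refine (uIcc_subset_uIcc_union_uIcc (b := ε)).trans (union_subset (mem_paramSet_iff.1 hε) ?_)
  exact ((convex_ball ε δ).ordConnected.uIcc_subset (Metric.mem_ball_self hδ) hx).trans hb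

theorem uIcc_subset_paramSet {z : State} {ε : ℝ} (h : ε ∈ paramSet M U k r₀ z) :
    uIcc 0 ε ⊆ paramSet M U k r₀ z := fun _ hx =>
  mem_paramSet_iff.2 ((uIcc_subset_uIcc left_mem_uIcc hx).trans (mem_paramSet_iff.1 h))

theorem ordConnected_paramSet (z : State) : (paramSet M U k r₀ z).OrdConnected := by
  refine ⟨fun a ha b hb x hx => ?_⟩
  rcases le_total 0 x with h | h
  · refine uIcc_subset_paramSet hb ?_
    rw [uIcc_of_le (h.trans hx.2)]
    exact ⟨h, hx.2⟩
  · refine uIcc_subset_paramSet ha ?_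
    rw [uIcc_of_ge (hx.1.trans h)]
    exact ⟨hx.1, h⟩

theorem zero_mem_paramSet {z : State} (hz : z ∈ domain M U k r₀) :
    (0 : ℝ) ∈ paramSet M U k r₀ z := by
  rw [mem_paramSet_iff, uIcc_self, singleton_subset_iff]
  simpa [regularParams] using hz.2

theorem sign_eq_of_continuousOn {f : ℝ → ℝ} {a b : ℝ} (hf : ContinuousOn f (uIcc a b))
    (h0 : ∀ x ∈ uIcc a b, f x ≠ 0) : Real.sign (f b) = Real.sign (f a) := by
  have hiv := intermediate_value_uIcc hf
  have ha := h0 a left_mem_uIcc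
  have hb := h0 b right_mem_uIcc
  have hno : (0 : ℝ) ∉ uIcc (f a) (f b) := fun h => by
    obtain ⟨x, hx, hx0⟩ := hiv h
    exact h0 x hx hx0
  rcases lt_or_gt_of_ne ha with h1 | h1 <;> rcases lt_or_gt_of_ne hb with h2 | h2
  · rw [Real.sign_of_neg h1, Real.sign_of_neg h2]
  · exact absurd (mem_uIcc.2 (Or.inl ⟨h1.le, h2.le⟩)) hno
  · exact absurd (mem_uIcc.2 (Or.inr ⟨h2.le, h1.le⟩)) hno
  · rw [Real.sign_of_pos h1, Real.sign_of_pos h2]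

/-- Mean value inequality with constant `0`. One-sided derivatives at the ends are allowed, so `J`
may be any interval, even a single point. -/
theorem eq_zero_of_hasDerivWithinAt_zero {F : Type*} [NormedAddCommGroup F] [NormedSpace ℝ F]
    {f : ℝ → F} {J : Set ℝ} (hJ : J.OrdConnected) (h : ∀ x ∈ J, HasDerivWithinAt f 0 J x)
    {a b : ℝ} (ha : a ∈ J) (hb : b ∈ J) : f b = f a := by
  have := hJ.convex.norm_image_sub_le_of_norm_hasDerivWithin_le (C := 0) h (by simp) ha hb
  rwa [zero_mul, norm_le_zero_iff, sub_eq_zero] at this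

end SchwarzschildLRL
end

/-! ### The transformation as a local one-parameter group and as a flow -/

noncomputable section
namespace SchwarzschildLRL

variable {M : ℝ} {U : Set (ℝ × ℝ)} {k : PointKind} {r₀ : ℝ → ℝ → ℝ} {z : State} {ε : ℝ}

/-! ### Elementary properties of the transformation -/

theorem one_sub_ne_zero (hM : 0 < M) {y : ℝ} (hy : 2 * M < y) : 1 - 2 * M / y ≠ 0 :=
  (one_sub_two_mul_div_pos hM hy).ne'

theorem energy_transform (hM : 0 < M) (hz : z ∈ domain M U k r₀) (ε : ℝ) :
    energy M (properTimeTransform M k r₀ ε z) = energy M z * Real.exp ε := by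
  change (1 - 2 * M / z 2) * ((1 - 2 * M / z 2)⁻¹ * (energy M z * Real.exp ε)) = _
  rw [mul_inv_cancel_left₀ (one_sub_ne_zero hM hz.2.1)]

theorem angMom_transform (hM : 0 < M) (hz : z ∈ domain M U k r₀) (ε : ℝ) :
    angMom (properTimeTransform M k r₀ ε z) = angMom z * Real.exp ε := by
  change z 2 ^ 2 * ((z 2 ^ 2)⁻¹ * (angMom z * Real.exp ε)) = _
  have h0 : z 2 ≠ 0 := by linarith [hz.2.1]
  rw [mul_inv_cancel_left₀ (pow_ne_zero 2 h0)]

theorem transform_five (ε : ℝ) : properTimeTransform M k r₀ ε z 5 =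
    Real.sign (z 5) * √(radialSq M (energy M z * Real.exp ε) (angMom z * Real.exp ε) (z 2)) := rfl

theorem sign_mul_of_pos {s c : ℝ} (hs : s = 1 ∨ s = -1) (hc : 0 < c) : Real.sign (s * c) = s := by
  rcases hs with rfl | rfl
  · rw [one_mul, Real.sign_of_pos hc]
  · rw [Real.sign_of_neg (by linarith)]

theorem sign_transform (hM : 0 < M) (hz : z ∈ domain M U k r₀) (hε : ε ∈ paramSet M U k r₀ z) :
    Real.sign (properTimeTransform M k r₀ ε z 5) = Real.sign (z 5) := by
  rw [transform_five]
  exact sign_mul_of_pos (sign_eq_one_or (velocity_ne_zero hM hz))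
    (Real.sqrt_pos.2 (regular_of_mem_paramSet hε).2.2.1)

theorem sign_sq {s : ℝ} (hs : s = 1 ∨ s = -1) : s ^ 2 = 1 := by
  rcases hs with rfl | rfl <;> norm_num

theorem transform_mem_domain (hM : 0 < M) (hz : z ∈ domain M U k r₀)
    (hε : ε ∈ paramSet M U k r₀ z) : properTimeTransform M k r₀ ε z ∈ domain M U k r₀ := by
  have hreg := regular_of_mem_paramSet hε
  have h2 : properTimeTransform M k r₀ ε z 2 = z 2 := rfl
  refine ⟨(metricNorm_eq_iff hM ?_).2 ?_, ?_⟩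
  · rw [h2]; exact hz.2.1
  · rw [energy_transform hM hz, angMom_transform hM hz, transform_five, h2, mul_pow,
      sign_sq (sign_eq_one_or (velocity_ne_zero hM hz)), one_mul, Real.sq_sqrt hreg.2.2.1.le]
  · rw [energy_transform hM hz, angMom_transform hM hz, h2]; exact hreg

theorem lrlProperTime_transform (hM : 0 < M) (hz : z ∈ domain M U k r₀)
    (hε : ε ∈ paramSet M U k r₀ z) :
    lrlProperTime M r₀ (properTimeTransform M k r₀ ε z) = lrlProperTime M r₀ z := by
  rw [lrlProperTime, sign_transform hM hz hε, energy_transform hM hz, angMom_transform hM hz]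
  -- The LRL quantity of the image subtracts the same integral that was added in forming the image,
  -- with the same sign, constants and radius.
  exact add_sub_cancel_right _ _

theorem lrlAngle_transform (hM : 0 < M) (hz : z ∈ domain M U k r₀)
    (hε : ε ∈ paramSet M U k r₀ z) :
    lrlAngle M r₀ (properTimeTransform M k r₀ ε z) = angleDagger M r₀ ε z k := by
  rw [lrlAngle, sign_transform hM hz hε, energy_transform hM hz, angMom_transform hM hz]
  exact add_sub_cancel_right _ _

theorem lrlTime_transform (hM : 0 < M) (hz : z ∈ domain M U k r₀)
    (hε : ε ∈ paramSet M U k r₀ z) :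
    lrlTime M r₀ (properTimeTransform M k r₀ ε z) = timeDagger M r₀ ε z k := by
  rw [lrlTime, sign_transform hM hz hε, energy_transform hM hz, angMom_transform hM hz]
  exact add_sub_cancel_right _ _

theorem angleDagger_zero : angleDagger M r₀ 0 z k = lrlAngle M r₀ z := by
  cases k <;> simp [angleDagger]

theorem timeDagger_zero : timeDagger M r₀ 0 z k = lrlTime M r₀ z := by
  cases k <;> simp [timeDagger]

theorem transform_zero (hM : 0 < M) (hz : z ∈ domain M U k r₀) :
    properTimeTransform M k r₀ 0 z = z := by
  have hf := one_sub_ne_zero hM hz.2.1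
  have h0 : z 2 ≠ 0 := by linarith [hz.2.1]
  unfold properTimeTransform
  simp only [Real.exp_zero, mul_one, angleDagger_zero, timeDagger_zero]
  ext i
  fin_cases i
  · exact sub_add_cancel _ _
  · exact sub_add_cancel _ _
  · rfl
  · exact sub_add_cancel _ _
  · exact inv_mul_cancel_left₀ hf _
  · exact (velocity_eq hM hz).symm
  · exact inv_mul_cancel_left₀ (pow_ne_zero 2 h0) _

theorem paramSet_transform (hM : 0 < M) (hz : z ∈ domain M U k r₀) (ε η : ℝ) :
    η ∈ paramSet M U k r₀ (properTimeTransform M k r₀ ε z) ↔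
      ∀ x ∈ uIcc 0 η, ε + x ∈ regularParams M U k r₀ z := by
  simp only [paramSet, regularParams, mem_ofPred_eq, energy_transform hM hz,
    angMom_transform hM hz, mul_assoc, ← Real.exp_add]
  rfl

theorem add_mem_paramSet (hM : 0 < M) (hz : z ∈ domain M U k r₀) {η : ℝ}
    (hε : ε ∈ paramSet M U k r₀ z)
    (hη : η ∈ paramSet M U k r₀ (properTimeTransform M k r₀ ε z)) :
    ε + η ∈ paramSet M U k r₀ z := by
  rw [paramSet_transform hM hz] at hη
  refine mem_paramSet_iff.2 ((uIcc_subset_uIcc_union_uIcc (b := ε)).trans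
    (union_subset (mem_paramSet_iff.1 hε) fun x hx => ?_))
  have h1 : x - ε ∈ uIcc 0 η := by
    rcases mem_uIcc.1 hx with h | h
    · exact mem_uIcc.2 (Or.inl ⟨by linarith [h.1], by linarith [h.2]⟩)
    · exact mem_uIcc.2 (Or.inr ⟨by linarith [h.1], by linarith [h.2]⟩)
  simpa using hη _ h1

/-! ### The quadratures for a centripetal point -/

theorem continuousOn_rates (hM : 0 < M) (hU : IsOpen U)
    (hd : IsDistinguished M U r₀ .centripetal) {s : ℝ} (hs : s = 1 ∨ s = -1) :
    ContinuousOn (fun x => cAngle M s r₀ (energy M z * Real.exp x) (angMom z * Real.exp x))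
      (regularParams M U .centripetal r₀ z) ∧
    ContinuousOn (fun x => cTime M s r₀ (energy M z * Real.exp x) (angMom z * Real.exp x))
      (regularParams M U .centripetal r₀ z) := by
  have hc : Continuous fun x : ℝ => (energy M z * Real.exp x, angMom z * Real.exp x) := by
    fun_prop
  constructor
  · intro x hx
    have h1 := (continuousAt_cAngle_cTime hM hU hd hs hx).1
    exact (ContinuousAt.comp (f := fun x : ℝ => (energy M z * Real.exp x, angMom z * Real.exp x))
      h1 hc.continuousAt).continuousWithinAt
  · intro x hx
    have h1 := (continuousAt_cAngle_cTime hM hU hd hs hx).2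
    exact (ContinuousAt.comp (f := fun x : ℝ => (energy M z * Real.exp x, angMom z * Real.exp x))
      h1 hc.continuousAt).continuousWithinAt

theorem hasDerivAt_integral_of_continuousOn {f : ℝ → ℝ} {V : Set ℝ} (hV : IsOpen V)
    (hf : ContinuousOn f V) {a b : ℝ} (hab : uIcc a b ⊆ V) :
    HasDerivAt (fun x => ∫ y in a..x, f y) (f b) b :=
  intervalIntegral.integral_hasDerivAt_right (hf.mono hab).intervalIntegrable
    (hf.stronglyMeasurableAtFilter hV b (hab right_mem_uIcc))
    (hf.continuousAt (hV.mem_nhds (hab right_mem_uIcc)))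

/-- The quadrature is additive: starting from the image shifts the integration variable by `ε`, and
adjacent intervals join. -/
theorem angleDagger_add (hM : 0 < M) (hU : IsOpen U) (hd : IsDistinguished M U r₀ k)
    (hz : z ∈ domain M U k r₀) {η : ℝ} (hε : ε ∈ paramSet M U k r₀ z)
    (hη : ε + η ∈ paramSet M U k r₀ z) :
    angleDagger M r₀ η (properTimeTransform M k r₀ ε z) k = angleDagger M r₀ (ε + η) z k := by
  have h1 := lrlAngle_transform hM hz hε
  cases k with
  | turning => exact h1
  | horizon => exact h1
  | centripetal =>
    have hs := sign_eq_one_or (velocity_ne_zero hM hz)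
    have hc := (continuousOn_rates (z := z) hM hU hd hs).1
    have i1 := ContinuousOn.intervalIntegrable (μ := MeasureTheory.volume)
      (hc.mono (mem_paramSet_iff.1 hε))
    have i2 := ContinuousOn.intervalIntegrable (μ := MeasureTheory.volume)
      (hc.mono (mem_paramSet_iff.1 hη))
    simp only [angleDagger] at h1 ⊢
    rw [h1, sign_transform hM hz hε, energy_transform hM hz, angMom_transform hM hz, add_assoc]
    simp only [mul_assoc, ← Real.exp_add]
    rw [intervalIntegral.integral_comp_add_left (fun x => cAngle M (Real.sign (z 5)) r₀
      (energy M z * Real.exp x) (angMom z * Real.exp x)), add_zero,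
      intervalIntegral.integral_add_adjacent_intervals i1 (i1.symm.trans i2)]

theorem timeDagger_add (hM : 0 < M) (hU : IsOpen U) (hd : IsDistinguished M U r₀ k)
    (hz : z ∈ domain M U k r₀) {η : ℝ} (hε : ε ∈ paramSet M U k r₀ z)
    (hη : ε + η ∈ paramSet M U k r₀ z) :
    timeDagger M r₀ η (properTimeTransform M k r₀ ε z) k = timeDagger M r₀ (ε + η) z k := by
  have h1 := lrlTime_transform hM hz hε
  cases k with
  | turning => exact h1
  | horizon => exact h1
  | centripetal =>
    have hs := sign_eq_one_or (velocity_ne_zero hM hz)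
    have hc := (continuousOn_rates (z := z) hM hU hd hs).2
    have i1 := ContinuousOn.intervalIntegrable (μ := MeasureTheory.volume)
      (hc.mono (mem_paramSet_iff.1 hε))
    have i2 := ContinuousOn.intervalIntegrable (μ := MeasureTheory.volume)
      (hc.mono (mem_paramSet_iff.1 hη))
    simp only [timeDagger] at h1 ⊢
    rw [h1, sign_transform hM hz hε, energy_transform hM hz, angMom_transform hM hz, add_assoc]
    simp only [mul_assoc, ← Real.exp_add]
    rw [intervalIntegral.integral_comp_add_left (fun x => cTime M (Real.sign (z 5)) r₀
      (energy M z * Real.exp x) (angMom z * Real.exp x)), add_zero,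
      intervalIntegral.integral_add_adjacent_intervals i1 (i1.symm.trans i2)]

theorem transform_transform (hM : 0 < M) (hU : IsOpen U) (hd : IsDistinguished M U r₀ k)
    (hz : z ∈ domain M U k r₀) {η : ℝ} (hε : ε ∈ paramSet M U k r₀ z)
    (hη : ε + η ∈ paramSet M U k r₀ z) :
    properTimeTransform M k r₀ η (properTimeTransform M k r₀ ε z) =
      properTimeTransform M k r₀ (ε + η) z := by
  have h2 : properTimeTransform M k r₀ ε z 2 = z 2 := rfl
  -- Stated for an arbitrary state, so that the outer transformation unfolds while the inner one
  -- stays folded for rewriting.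
  have key : ∀ w : State, properTimeTransform M k r₀ η w =
      ![lrlProperTime M r₀ w + properTimeIntegral M (Real.sign (w 5)) (energy M w * Real.exp η)
          (angMom w * Real.exp η) (r₀ (energy M w * Real.exp η) (angMom w * Real.exp η)) (w 2),
        timeDagger M r₀ η w k + energy M w * Real.exp η * timeIntegral M (Real.sign (w 5))
          (energy M w * Real.exp η) (angMom w * Real.exp η)
          (r₀ (energy M w * Real.exp η) (angMom w * Real.exp η)) (w 2),
        w 2,
        angleDagger M r₀ η w k + angMom w * Real.exp η * angleIntegral M (Real.sign (w 5))
          (energy M w * Real.exp η) (angMom w * Real.exp η)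
          (r₀ (energy M w * Real.exp η) (angMom w * Real.exp η)) (w 2),
        (1 - 2 * M / w 2)⁻¹ * (energy M w * Real.exp η),
        radialSpeed M (Real.sign (w 5)) (energy M w * Real.exp η) (angMom w * Real.exp η) (w 2),
        (w 2 ^ 2)⁻¹ * (angMom w * Real.exp η)] := fun _ => rfl
  rw [key (properTimeTransform M k r₀ ε z), angleDagger_add hM hU hd hz hε hη,
    timeDagger_add hM hU hd hz hε hη, lrlProperTime_transform hM hz hε, sign_transform hM hz hε,
    energy_transform hM hz, angMom_transform hM hz, h2]
  simp only [mul_assoc, ← Real.exp_add]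
  unfold properTimeTransform
  simp only [mul_assoc]

theorem hasDerivAt_angleDagger (hM : 0 < M) (hU : IsOpen U) (hd : IsDistinguished M U r₀ k)
    (hz : z ∈ domain M U k r₀) (hε : ε ∈ paramSet M U k r₀ z) :
    HasDerivAt (fun x => angleDagger M r₀ x z k) (Real.sign (z 5) *
      angleRate M r₀ (energy M z * Real.exp ε) (angMom z * Real.exp ε) k) ε := by
  have hs := sign_eq_one_or (velocity_ne_zero hM hz)
  cases k with
  | turning => simpa [angleRate, angleDagger] using hasDerivAt_const ε (lrlAngle M r₀ z)
  | horizon => simpa [angleRate, angleDagger] using hasDerivAt_const ε (lrlAngle M r₀ z)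
  | centripetal =>
    have h := hasDerivAt_integral_of_continuousOn (isOpen_regularParams hM hU hd z)
      (continuousOn_rates (z := z) hM hU hd hs).1 (mem_paramSet_iff.1 hε)
    simp only [angleRate]
    rw [← cAngle_sign hs]
    exact h.const_add _

theorem hasDerivAt_timeDagger (hM : 0 < M) (hU : IsOpen U) (hd : IsDistinguished M U r₀ k)
    (hz : z ∈ domain M U k r₀) (hε : ε ∈ paramSet M U k r₀ z) :
    HasDerivAt (fun x => timeDagger M r₀ x z k) (Real.sign (z 5) *
      timeRate M r₀ (energy M z * Real.exp ε) (angMom z * Real.exp ε) k) ε := by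
  have hs := sign_eq_one_or (velocity_ne_zero hM hz)
  cases k with
  | turning => simpa [timeRate, timeDagger] using hasDerivAt_const ε (lrlTime M r₀ z)
  | horizon => simpa [timeRate, timeDagger] using hasDerivAt_const ε (lrlTime M r₀ z)
  | centripetal =>
    have h := hasDerivAt_integral_of_continuousOn (isOpen_regularParams hM hU hd z)
      (continuousOn_rates (z := z) hM hU hd hs).2 (mem_paramSet_iff.1 hε)
    simp only [timeRate]
    rw [← cTime_sign hs]
    exact h.const_add _

/-! ### The transformation is the flow of the generator -/

/-- `hasDerivAt_scaling` at an arbitrary value of the scaling parameter. -/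
theorem hasDerivAt_scaling_at (hM : 0 < M) (hU : IsOpen U) (hd : IsDistinguished M U r₀ k)
    {E L r : ℝ} (h : Regular M U k r₀ r (E * Real.exp ε) (L * Real.exp ε)) :
    HasDerivAt (fun x => L * Real.exp x * angleIntegral M 1 (E * Real.exp x) (L * Real.exp x)
        (r₀ (E * Real.exp x) (L * Real.exp x)) r)
      (-(fderiv ℝ (timeFun M r₀) (E * Real.exp ε, L * Real.exp ε, r) (0, 1, 0)) -
        angleRate M r₀ (E * Real.exp ε) (L * Real.exp ε) k) ε ∧
    HasDerivAt (fun x => E * Real.exp x * timeIntegral M 1 (E * Real.exp x) (L * Real.exp x)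
        (r₀ (E * Real.exp x) (L * Real.exp x)) r)
      (fderiv ℝ (timeFun M r₀) (E * Real.exp ε, L * Real.exp ε, r) (1, 0, 0) -
        timeRate M r₀ (E * Real.exp ε) (L * Real.exp ε) k) ε := by
  obtain ⟨h1, h2⟩ := hasDerivAt_scaling hM hU hd h
  have h0 := (hasDerivAt_id ε).sub_const ε
  have h3 := h1.comp_of_eq ε h0 (sub_self ε).symm
  have h4 := h2.comp_of_eq ε h0 (sub_self ε).symm
  have he : ∀ c x : ℝ, c * Real.exp ε * Real.exp (x - ε) = c * Real.exp x := fun c x => by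
    rw [mul_assoc, ← Real.exp_add, add_sub_cancel]
  simp only [Function.comp_def, id, he, mul_one] at h3 h4
  exact ⟨h3, h4⟩

theorem radialData_transform (hM : 0 < M) (hz : z ∈ domain M U k r₀) (ε : ℝ) :
    radialData M (properTimeTransform M k r₀ ε z) =
      (energy M z * Real.exp ε, angMom z * Real.exp ε, z 2) := by
  rw [radialData, energy_transform hM hz, angMom_transform hM hz]; rfl

/-- In the `t` and `φ` components the rate of `T†` or `Φ†` cancels the rate subtracted in
`hasDerivAt_scaling`, leaving `s I_E` and `-s I_L`. The `τ` component is the chain rule for `I`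
along the scaling, and the `v` component is half of `dQ/dε = 2 (Q + f)` over `v`. -/
theorem hasDerivAt_transform (hM : 0 < M) (hU : IsOpen U) (hd : IsDistinguished M U r₀ k)
    (hz : z ∈ domain M U k r₀) (hε : ε ∈ paramSet M U k r₀ z) :
    HasDerivAt (fun x => properTimeTransform M k r₀ x z)
      (explicitGenerator M r₀ (properTimeTransform M k r₀ ε z)) ε := by
  have hreg := regular_of_mem_paramSet hε
  have hs := sign_eq_one_or (velocity_ne_zero hM hz)
  have hf := one_sub_ne_zero hM hz.2.1
  have hexp : ∀ c : ℝ, HasDerivAt (fun x => c * Real.exp x) (c * Real.exp ε) ε := fun c =>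
    (Real.hasDerivAt_exp ε).const_mul c
  obtain ⟨hA, hT⟩ := hasDerivAt_scaling_at hM hU hd hreg
  unfold explicitGenerator
  rw [sign_transform hM hz hε, radialData_transform hM hz, energy_transform hM hz,
    angMom_transform hM hz]
  refine hasDerivAt_pi.2 fun i => ?_
  fin_cases i
  · have h1 := (((contDiffAt_timeFun hM hU hd (p := (_, _, _)) hreg).differentiableAt
      (by norm_num)).hasFDerivAt.comp_hasDerivAt ε ((hexp (energy M z)).prodMk
        ((hexp (angMom z)).prodMk (hasDerivAt_const ε (z 2))))).const_mul (Real.sign (z 5))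
    refine ((h1.const_add (lrlProperTime M r₀ z)).congr_deriv ?_).congr_of_eventuallyEq
      (Eventually.of_forall fun x => ?_)
    · rw [map_triple]
      simp [scalingDeriv]
    · exact congrArg (fun c => lrlProperTime M r₀ z + c) (properTimeIntegral_sign hs ..|>.trans
        (congrArg _ (properTimeIntegral_one (energy M z * Real.exp x, angMom z * Real.exp x, z 2))))
  · refine (((hasDerivAt_timeDagger hM hU hd hz hε).add
      (hT.const_mul (Real.sign (z 5)))).congr_deriv ?_).congr_of_eventuallyEq
      (Eventually.of_forall fun x => ?_)
    · simp
      ring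
    · refine congrArg (fun c => timeDagger M r₀ x z k + c) ?_
      rw [timeIntegral_sign hs]
      ring
  · exact hasDerivAt_const ε (z 2)
  · refine (((hasDerivAt_angleDagger hM hU hd hz hε).add
      (hA.const_mul (Real.sign (z 5)))).congr_deriv ?_).congr_of_eventuallyEq
      (Eventually.of_forall fun x => ?_)
    · simp
      ring
    · refine congrArg (fun c => angleDagger M r₀ x z k + c) ?_
      rw [angleIntegral_sign hs]
      ring
  · exact (hexp (energy M z)).const_mul _
  · have hQ : 0 < radialSq M (energy M z * Real.exp ε) (angMom z * Real.exp ε) (z 2) :=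
      hreg.2.2.1
    have h1 := ((hasDerivAt_radialSq M (z 2) (hexp (energy M z)) (hexp (angMom z))).sqrt
      hQ.ne').const_mul (Real.sign (z 5))
    refine h1.congr_deriv ?_
    have hsq := Real.sqrt_pos.2 hQ
    simp only [transform_five]
    have h2 : properTimeTransform M k r₀ ε z 2 = z 2 := rfl
    have h3 : ∀ c : ℝ, c / (Real.sign (z 5) * √(radialSq M (energy M z * Real.exp ε)
        (angMom z * Real.exp ε) (z 2))) = Real.sign (z 5) * (c / √(radialSq M
        (energy M z * Real.exp ε) (angMom z * Real.exp ε) (z 2))) := fun c => by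
      rw [div_eq_mul_inv, mul_inv, inv_eq_self_of_sign hs]; ring
    simp [h2, h3]
    left
    unfold radialSq
    field_simp
    ring
  · exact (hexp (angMom z)).const_mul _

/-- The generator does not involve `τ`, `t`, `φ`, so once the other coordinates are known these
three are found by quadrature. -/
theorem explicitGenerator_congr {z z' : State} (h2 : z' 2 = z 2) (h4 : z' 4 = z 4)
    (h5 : z' 5 = z 5) (h6 : z' 6 = z 6) : explicitGenerator M r₀ z' = explicitGenerator M r₀ z := by
  simp only [explicitGenerator, radialData, energy, angMom, h2, h4, h5, h6]

end SchwarzschildLRL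
end

/-! ### Uniqueness of the flow, images of geodesics, and the scaled distinguished point -/

noncomputable section
namespace SchwarzschildLRL

variable {M : ℝ} {U : Set (ℝ × ℝ)} {k : PointKind} {r₀ : ℝ → ℝ → ℝ} {z : State} {ε : ℝ}

/-! ### Uniqueness of integral curves -/

theorem eq_mul_exp_of_hasDerivWithinAt {f : ℝ → ℝ} {J : Set ℝ} (hJ : J.OrdConnected)
    (h : ∀ x ∈ J, HasDerivWithinAt f (f x) J x) (h0 : (0 : ℝ) ∈ J) {x : ℝ} (hx : x ∈ J) :
    f x = f 0 * Real.exp x := by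
  have h1 : ∀ y ∈ J, HasDerivWithinAt (fun y => f y * Real.exp (-y)) 0 J y := fun y hy => by
    refine ((h y hy).mul (hasDerivAt_neg y).exp.hasDerivWithinAt).congr_deriv ?_
    ring
  have h2 := eq_zero_of_hasDerivWithinAt_zero hJ h1 h0 hx
  simp only [neg_zero, Real.exp_zero, mul_one] at h2
  rw [← h2, mul_assoc, ← Real.exp_add, neg_add_cancel, Real.exp_zero, mul_one]

/-- The system is triangular. The radius is constant, `σ` and `ω` solve `y' = y`, and `v` follows
from the normalisation with a sign that cannot change because `v` never vanishes in the domain. The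
two curves then have equal derivatives, so their difference is constant. -/
theorem eq_transform_of_integralCurve (hM : 0 < M) (hU : IsOpen U) (hd : IsDistinguished M U r₀ k)
    {J : Set ℝ} {γ : ℝ → State} (hJ : J.OrdConnected) (h0 : (0 : ℝ) ∈ J) (hγ : γ 0 = z)
    (h : ∀ x ∈ J, γ x ∈ domain M U k r₀ ∧
      HasDerivWithinAt γ (explicitGenerator M r₀ (γ x)) J x) (hε : ε ∈ J) :
    ε ∈ paramSet M U k r₀ z ∧ γ ε = properTimeTransform M k r₀ ε z := by
  have hz : z ∈ domain M U k r₀ := hγ ▸ (h 0 h0).1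
  have hc : ∀ x ∈ J, ∀ i, HasDerivWithinAt (fun y => γ y i)
      (explicitGenerator M r₀ (γ x) i) J x := fun x hx =>
    hasDerivWithinAt_pi.1 (h x hx).2
  have h2 : ∀ x ∈ J, γ x 2 = z 2 := fun x hx =>
    hγ ▸ eq_zero_of_hasDerivWithinAt_zero hJ (fun y hy => hc y hy 2) h0 hx
  have h4 : ∀ x ∈ J, γ x 4 = z 4 * Real.exp x := fun x hx =>
    hγ ▸ eq_mul_exp_of_hasDerivWithinAt hJ (fun y hy => hc y hy 4) h0 hx
  have h6 : ∀ x ∈ J, γ x 6 = z 6 * Real.exp x := fun x hx =>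
    hγ ▸ eq_mul_exp_of_hasDerivWithinAt hJ (fun y hy => hc y hy 6) h0 hx
  have hE : ∀ x ∈ J, energy M (γ x) = energy M z * Real.exp x := fun x hx => by
    rw [energy, energy, h2 x hx, h4 x hx, mul_assoc]
  have hL : ∀ x ∈ J, angMom (γ x) = angMom z * Real.exp x := fun x hx => by
    rw [angMom, angMom, h2 x hx, h6 x hx, mul_assoc]
  have hP : ∀ x ∈ J, x ∈ paramSet M U k r₀ z := fun x hx y hy => by
    have hy' := hJ.uIcc_subset h0 hx hy
    have := (h y hy').1.2
    rwa [h2 y hy', hE y hy', hL y hy'] at this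
  have hsgn : ∀ x ∈ J, Real.sign (γ x 5) = Real.sign (z 5) := fun x hx => by
    rw [← hγ]
    have hs := hJ.uIcc_subset h0 hx
    exact sign_eq_of_continuousOn (f := fun y => γ y 5)
      (fun y hy => ((hc y (hs hy) 5).continuousWithinAt).mono hs)
      fun y hy => velocity_ne_zero hM (h y (hs hy)).1
  have h5 : ∀ x ∈ J, γ x 5 = properTimeTransform M k r₀ x z 5 := fun x hx => by
    rw [velocity_eq hM (h x hx).1, hsgn x hx, hE x hx, hL x hx, h2 x hx, transform_five]
  have h4' : ∀ x ∈ J, γ x 4 = properTimeTransform M k r₀ x z 4 := fun x hx => by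
    have hf := one_sub_ne_zero hM hz.2.1
    rw [h4 x hx]
    change _ = (1 - 2 * M / z 2)⁻¹ * ((1 - 2 * M / z 2) * z 4 * Real.exp x)
    rw [mul_assoc, inv_mul_cancel_left₀ hf]
  have h6' : ∀ x ∈ J, γ x 6 = properTimeTransform M k r₀ x z 6 := fun x hx => by
    have hr0 : z 2 ≠ 0 := by linarith [hz.2.1]
    rw [h6 x hx]
    change _ = (z 2 ^ 2)⁻¹ * (z 2 ^ 2 * z 6 * Real.exp x)
    rw [mul_assoc, inv_mul_cancel_left₀ (pow_ne_zero 2 hr0)]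
  have hdiff : ∀ x ∈ J,
      HasDerivWithinAt (fun y => γ y - properTimeTransform M k r₀ y z) 0 J x := fun x hx => by
    refine ((h x hx).2.sub
      (hasDerivAt_transform hM hU hd hz (hP x hx)).hasDerivWithinAt).congr_deriv ?_
    rw [explicitGenerator_congr (z := properTimeTransform M k r₀ x z) (h2 x hx)
      (h4' x hx) (h5 x hx) (h6' x hx), sub_self]
  have hend := eq_zero_of_hasDerivWithinAt_zero hJ hdiff h0 hε
  simp only [hγ, transform_zero hM hz, sub_self] at hend
  exact ⟨hP ε hε, sub_eq_zero.1 hend⟩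

/-! ### The transformation maps geodesics to geodesics -/

theorem eventually_constants_of_geodesic (hM : 0 < M) (hz : z ∈ domain M U k r₀) {γ : ℝ → State}
    (hγ : γ 0 = z) (h : ∀ᶠ x in 𝓝 0, HasDerivAt γ (geodesicField M (γ x)) x) :
    ∀ᶠ x in 𝓝 (0 : ℝ), energy M (γ x) = energy M z ∧ angMom (γ x) = angMom z ∧
      Real.sign (γ x 5) = Real.sign (z 5) := by
  subst hγ
  have hc : ∀ i, ContinuousAt (fun x => γ x i) 0 := fun i =>
    (hasDerivAt_pi.1 h.self_of_nhds i).continuousAt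
  obtain ⟨δ, hδ, hb⟩ := Metric.eventually_nhds_iff_ball.1
    (h.and ((hc 2).eventually_const_lt hz.2.1))
  have hord : (Metric.ball (0 : ℝ) δ).OrdConnected := (convex_ball 0 δ).ordConnected
  have h1 : ∀ x ∈ Metric.ball (0 : ℝ) δ,
      HasDerivAt (fun y => radialData M (γ y)) (0, 0, γ x 5) x := fun x hx =>
    hasDerivAt_radialData_geodesic hM rfl (hb x hx).1 (hb x hx).2
  have hfst : ∀ x ∈ Metric.ball (0 : ℝ) δ,
      HasDerivWithinAt (fun y => ((radialData M (γ y)).1, (radialData M (γ y)).2.1)) 0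
        (Metric.ball (0 : ℝ) δ) x := fun x hx =>
    (((ContinuousLinearMap.fst ℝ ℝ (ℝ × ℝ)).prod ((ContinuousLinearMap.fst ℝ ℝ ℝ).comp
      (ContinuousLinearMap.snd ℝ ℝ (ℝ × ℝ)))).hasFDerivAt.comp_hasDerivAt x
        (h1 x hx)).hasDerivWithinAt
  filter_upwards [Metric.ball_mem_nhds 0 hδ,
    eventually_sign_eq (hc 5) (velocity_ne_zero hM hz)] with x hx hsx
  have h2 := eq_zero_of_hasDerivWithinAt_zero hord hfst (Metric.mem_ball_self hδ) hx
  exact ⟨congrArg Prod.fst h2, congrArg Prod.snd h2, hsx⟩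

/-- The increment of `Φ` depends only on `E`, `L` and the sign of `v`, hence is the same for all
states along a geodesic. -/
theorem angleDagger_sub_lrlAngle {w : State} (hE : energy M w = energy M z)
    (hL : angMom w = angMom z) (hs : Real.sign (w 5) = Real.sign (z 5)) :
    angleDagger M r₀ ε w k = lrlAngle M r₀ w + (angleDagger M r₀ ε z k - lrlAngle M r₀ z) := by
  cases k <;> simp [angleDagger, hE, hL, hs]

theorem timeDagger_sub_lrlTime {w : State} (hE : energy M w = energy M z)
    (hL : angMom w = angMom z) (hs : Real.sign (w 5) = Real.sign (z 5)) :
    timeDagger M r₀ ε w k = lrlTime M r₀ w + (timeDagger M r₀ ε z k - lrlTime M r₀ z) := by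
  cases k <;> simp [timeDagger, hE, hL, hs]

theorem hasDerivAt_radialSq_radius (M E L : ℝ) {y : ℝ} (hy : y ≠ 0) :
    HasDerivAt (fun x => radialSq M E L x)
      (-(2 * M / y ^ 2 * (1 + L ^ 2 / y ^ 2)) + (1 - 2 * M / y) * (2 * L ^ 2 / y ^ 3)) y := by
  have h1 := ((hasDerivAt_const y (2 * M)).div (hasDerivAt_id y) hy).const_sub 1
  have h2 := ((hasDerivAt_const y (L ^ 2)).div ((hasDerivAt_id y).pow 2)
    (pow_ne_zero 2 hy)).const_add 1
  refine ((h1.mul h2).const_sub (E ^ 2)).congr_deriv ?_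
  simp
  field_simp
  ring

/-- With `σ`, `ω` and `v²` expressed by the constants of motion, the radial geodesic equation is
`dv/dτ = (1/2) dQ/dr`. -/
theorem radial_acceleration_eq (M e l : ℝ) {r : ℝ} (hr0 : r ≠ 0) (hr2 : r - 2 * M ≠ 0) :
    -(M * (r - 2 * M) / r ^ 3) * (r / (r - 2 * M) * e) ^ 2 +
      M / (r * (r - 2 * M)) * (e ^ 2 - (1 - 2 * M / r) * (1 + l ^ 2 / r ^ 2)) +
      (r - 2 * M) * ((r ^ 2)⁻¹ * l) ^ 2 =
    (-(2 * M / r ^ 2 * (1 + l ^ 2 / r ^ 2)) + (1 - 2 * M / r) * (2 * l ^ 2 / r ^ 3)) / 2 := by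
  have h1 : 1 - 2 * M / r = (r - 2 * M) / r := by field_simp
  have h2 : M / (r * (r - 2 * M)) * (e ^ 2 - (r - 2 * M) / r * (1 + l ^ 2 / r ^ 2)) =
      M * e ^ 2 / (r * (r - 2 * M)) - M / r ^ 2 * (1 + l ^ 2 / r ^ 2) := by
    generalize r - 2 * M = d at hr2
    field_simp
  have h3 : M * (r - 2 * M) / r ^ 3 * (r / (r - 2 * M) * e) ^ 2 =
      M * e ^ 2 / (r * (r - 2 * M)) := by
    field_simp
  rw [h1, h2, neg_mul, h3]
  field_simp
  ring

/-- Along the geodesic `E`, `L` and the sign of `v` are locally constant, so the image depends on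
the parameter only through `τ`, `t`, `φ` and `r`. The old integrals cancel the motion of `τ`, `t`,
`φ`, and the new ones reproduce the geodesic with the scaled constants. The radius being shared, the
two parametrisations differ by `v/v†`. -/
theorem hasDerivAt_transform_geodesic (hM : 0 < M) (hU : IsOpen U)
    (hd : IsDistinguished M U r₀ k) (hz : z ∈ domain M U k r₀) {γ : ℝ → State}
    (hγ : γ 0 = z) (h : ∀ᶠ x in 𝓝 0, HasDerivAt γ (geodesicField M (γ x)) x)
    (hε : ε ∈ paramSet M U k r₀ z) :
    HasDerivAt (fun x => properTimeTransform M k r₀ ε (γ x))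
      ((z 5 / properTimeTransform M k r₀ ε z 5) •
        geodesicField M (properTimeTransform M k r₀ ε z)) 0 := by
  have hev := eventually_constants_of_geodesic hM hz hγ h
  have hγ' : ∀ i, HasDerivAt (fun x => γ x i) (geodesicField M z i) 0 :=
    hasDerivAt_pi.1 (hγ ▸ h.self_of_nhds)
  have hreg := regular_of_mem_paramSet hε
  have hs := sign_eq_one_or (velocity_ne_zero hM hz)
  have hr := hz.2.1
  have hr0 : z 2 ≠ 0 := by linarith
  have hr2 : z 2 - 2 * M ≠ 0 := by linarith
  have hf := one_sub_ne_zero hM hr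
  have hv0 := velocity_ne_zero hM hz
  have hv : radialSpeed M (Real.sign (z 5)) (energy M z) (angMom z) (z 2) = z 5 :=
    (velocity_eq hM hz).symm
  have hw0 := velocity_ne_zero hM (transform_mem_domain hM hz hε)
  have hcomp : ∀ {f : ℝ → ℝ} {f' : ℝ}, HasDerivAt f f' (z 2) →
      HasDerivAt (fun x => f (γ x 2)) (f' * z 5) 0 := fun hf =>
    hf.comp_of_eq 0 (hγ' 2) (by rw [hγ])
  have a1 := hcomp (hasDerivAt_properTimeIntegral_radius hM hd hz.2 hs)
  have b1 := hcomp (hasDerivAt_properTimeIntegral_radius hM hd hreg hs)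
  have a2 := hcomp (hasDerivAt_mul_timeIntegral_radius hM hU hd hz.2 hs)
  have b2 := hcomp (hasDerivAt_mul_timeIntegral_radius hM hU hd hreg hs)
  have a3 := hcomp (hasDerivAt_angleIntegral_radius hM hd hz.2 hs)
  have b3 := hcomp (hasDerivAt_angleIntegral_radius hM hd hreg hs)
  have c4 := hcomp (((((hasDerivAt_const (z 2) (2 * M)).div (hasDerivAt_id (z 2))
    hr0).const_sub 1).inv hf).mul_const (energy M z * Real.exp ε))
  have c5 := hcomp (((hasDerivAt_radialSq_radius M (energy M z * Real.exp ε)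
    (angMom z * Real.exp ε) hr0).sqrt hreg.2.2.1.ne').const_mul (Real.sign (z 5)))
  have c6 := hcomp ((((hasDerivAt_id (z 2)).pow 2).inv (pow_ne_zero 2 hr0)).mul_const
    (angMom z * Real.exp ε))
  have hE4 : z 4 = energy M z * (z 2 / (z 2 - 2 * M)) := by
    unfold energy; field_simp
  have hL6 : z 6 = angMom z / z 2 ^ 2 := by unfold angMom; field_simp
  have hsq : properTimeTransform M k r₀ ε z 5 ^ 2 =
      radialSq M (energy M z * Real.exp ε) (angMom z * Real.exp ε) (z 2) := by
    have := sq_velocity hM (transform_mem_domain hM hz hε)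
    rwa [energy_transform hM hz, angMom_transform hM hz] at this
  have hdiv : Real.sign (z 5) / √(radialSq M (energy M z * Real.exp ε) (angMom z * Real.exp ε)
      (z 2)) = (properTimeTransform M k r₀ ε z 5)⁻¹ := by
    rw [transform_five, mul_inv, inv_eq_self_of_sign hs, div_eq_mul_inv]
  have t2 : properTimeTransform M k r₀ ε z 2 = z 2 := rfl
  have t4 : properTimeTransform M k r₀ ε z 4 =
      (1 - 2 * M / z 2)⁻¹ * (energy M z * Real.exp ε) := rfl
  have t6 : properTimeTransform M k r₀ ε z 6 = (z 2 ^ 2)⁻¹ * (angMom z * Real.exp ε) := rfl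
  have hw : radialSpeed M (Real.sign (z 5)) (energy M z * Real.exp ε) (angMom z * Real.exp ε)
    (z 2) = properTimeTransform M k r₀ ε z 5 := rfl
  rw [hv] at a1 a2 a3
  rw [hw] at b1 b2 b3
  have hinv : (1 - 2 * M / z 2)⁻¹ = z 2 / (z 2 - 2 * M) := by field_simp
  generalize hW : properTimeTransform M k r₀ ε z 5 = W at *
  refine hasDerivAt_pi.2 fun i => ?_
  fin_cases i
  · refine ((((hγ' 0).sub a1).add b1).congr_deriv ?_).congr_of_eventuallyEq ?_
    · simp [geodesicField]
      field_simp
      ring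
    · filter_upwards [hev] with x ⟨hE, hL, hsx⟩
      simp [properTimeTransform, lrlProperTime, hE, hL, hsx]
  · refine ((((hγ' 1).sub a2).add_const (timeDagger M r₀ ε z k - lrlTime M r₀ z)).add
      b2 |>.congr_deriv ?_).congr_of_eventuallyEq ?_
    · simp [geodesicField, t4, hinv, hE4]
      field_simp
      ring
    · filter_upwards [hev] with x ⟨hE, hL, hsx⟩
      simp [properTimeTransform, timeDagger_sub_lrlTime hE hL hsx, lrlTime, hE, hL, hsx]
  · refine (hγ' 2).congr_deriv ?_
    simp [geodesicField, hW]
    field_simp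
  · refine ((((hγ' 3).sub (a3.const_mul (angMom z))).add_const
      (angleDagger M r₀ ε z k - lrlAngle M r₀ z)).add
      (b3.const_mul (angMom z * Real.exp ε)) |>.congr_deriv ?_).congr_of_eventuallyEq ?_
    · simp [geodesicField, t6, hL6]
      field_simp
      ring
    · filter_upwards [hev] with x ⟨hE, hL, hsx⟩
      simp [properTimeTransform, angleDagger_sub_lrlAngle hE hL hsx, lrlAngle, hE, hL, hsx]
  · refine (c4.congr_deriv ?_).congr_of_eventuallyEq ?_
    · simp [geodesicField, t2, t4, hW]
      field_simp
    · filter_upwards [hev] with x ⟨hE, hL, hsx⟩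
      simp [properTimeTransform, hE]
  · refine (c5.congr_deriv ?_).congr_of_eventuallyEq ?_
    · have hG : geodesicField M (properTimeTransform M k r₀ ε z) 5 =
          (-(2 * M / z 2 ^ 2 * (1 + (angMom z * Real.exp ε) ^ 2 / z 2 ^ 2)) +
            (1 - 2 * M / z 2) * (2 * (angMom z * Real.exp ε) ^ 2 / z 2 ^ 3)) / 2 := by
        simp only [geodesicField, Matrix.cons_val]
        rw [hW, hsq, t2, t4, t6, hinv, radialSq]
        exact radial_acceleration_eq _ _ _ hr0 hr2
      change _ = z 5 / W * geodesicField M (properTimeTransform M k r₀ ε z) 5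
      rw [hG, div_eq_mul_inv (z 5), ← hdiv]
      ring
    · filter_upwards [hev] with x ⟨hE, hL, hsx⟩
      simp [properTimeTransform, radialSpeed, hE, hL, hsx]
  · refine (c6.congr_deriv ?_).congr_of_eventuallyEq ?_
    · simp [geodesicField, t2, t6, hW]
      field_simp
    · filter_upwards [hev] with x ⟨hE, hL, hsx⟩
      simp [properTimeTransform, hL]

/-! ### The distinguished point under the scaling -/

/-- The function `D = (2M r₀ - L²)/L` of the parameter satisfies `D² = L² - 12M² > 0` and `2M r₀ = L
(L + D)`. Being continuous and nowhere zero on an interval, it keeps its sign, which is the sign of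
the square root. -/
theorem exists_sign_centripetal (hM : 0 < M) (hU : IsOpen U)
    (hd : IsDistinguished M U r₀ .centripetal) (hz : z ∈ domain M U .centripetal r₀) :
    ∃ s : ℝ, (s = 1 ∨ s = -1) ∧ ∀ ε ∈ paramSet M U .centripetal r₀ z,
      12 * M ^ 2 < (angMom z * Real.exp ε) ^ 2 ∧
      r₀ (energy M z * Real.exp ε) (angMom z * Real.exp ε) =
        (2 * M)⁻¹ * (angMom z * Real.exp ε) * (angMom z * Real.exp ε +
          s * √((angMom z * Real.exp ε) ^ 2 - 12 * M ^ 2)) := by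
  set D : ℝ → ℝ := fun x =>
    (2 * M * r₀ (energy M z * Real.exp x) (angMom z * Real.exp x) - (angMom z * Real.exp x) ^ 2) /
      (angMom z * Real.exp x) with hD
  have hD0 : ∀ x ∈ paramSet M U .centripetal r₀ z, D x ≠ 0 := fun x hx => by
    obtain ⟨hL, -, -, h2⟩ := centripetal_ne hM hU hd (regular_of_mem_paramSet hx).2.1
    exact div_ne_zero h2 hL
  have hDc : ContinuousOn D (paramSet M U .centripetal r₀ z) := fun x hx => by
    have hq := (regular_of_mem_paramSet hx).2.1
    obtain ⟨hL, -, -, -⟩ := centripetal_ne hM hU hd hq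
    have hc : ContinuousAt (fun x : ℝ => (energy M z * Real.exp x, angMom z * Real.exp x)) x := by
      fun_prop
    have h1 : ContinuousAt (fun x => r₀ (energy M z * Real.exp x) (angMom z * Real.exp x)) x :=
      ContinuousAt.comp (f := fun x : ℝ => (energy M z * Real.exp x, angMom z * Real.exp x))
        (contDiffAt_distinguished_of_mem hM hU hd hq).continuousAt hc
    exact (((continuousAt_const.mul h1).sub (by fun_prop)).div
      (by fun_prop) hL).continuousWithinAt
  refine ⟨Real.sign (D 0), sign_eq_one_or (hD0 0 (zero_mem_paramSet hz)), fun ε hε => ?_⟩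
  have hq := (regular_of_mem_paramSet hε).2.1
  obtain ⟨hL, -, -, -⟩ := centripetal_ne hM hU hd hq
  refine ⟨twelve_mul_sq_lt hM hU hd hq, ?_⟩
  rw [← sign_eq_of_continuousOn (hDc.mono (uIcc_subset_paramSet hε))
    fun x hx => hD0 x (uIcc_subset_paramSet hε hx)]
  have h2 := (hd.2 _ _ hq).2
  have hsq : (angMom z * Real.exp ε) ^ 2 - 12 * M ^ 2 = D ε ^ 2 := by
    rw [hD]
    simp only
    rw [div_pow, eq_div_iff (pow_ne_zero 2 hL)]
    linear_combination -4 * M * h2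
  rw [hsq, Real.sqrt_sq_eq_abs, real_sign_mul_abs, hD]
  simp only
  generalize r₀ (energy M z * Real.exp ε) (angMom z * Real.exp ε) = ρ
  generalize angMom z * Real.exp ε = l at hL
  field_simp
  ring

theorem turning_root (hd : IsDistinguished M U r₀ .turning)
    (hε : ε ∈ paramSet M U .turning r₀ z) :
    2 * M < r₀ (energy M z * Real.exp ε) (angMom z * Real.exp ε) ∧
      (energy M z ^ 2 * Real.exp (2 * ε) - 1) *
          r₀ (energy M z * Real.exp ε) (angMom z * Real.exp ε) ^ 3 +
        2 * M * r₀ (energy M z * Real.exp ε) (angMom z * Real.exp ε) ^ 2 -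
        angMom z ^ 2 * Real.exp (2 * ε) *
          r₀ (energy M z * Real.exp ε) (angMom z * Real.exp ε) +
        2 * M * angMom z ^ 2 * Real.exp (2 * ε) = 0 := by
  obtain ⟨h1, h2, -⟩ := hd.2 _ _ (regular_of_mem_paramSet hε).2.1
  refine ⟨h1, ?_⟩
  have hexp : Real.exp (2 * ε) = Real.exp ε ^ 2 := by
    rw [← Real.exp_nat_mul]; norm_num
  rw [hexp]
  linear_combination h2

end SchwarzschildLRL
end

/-! ### Assembly of the main theorem -/

open SchwarzschildLRL in
theorem mainTheorem3 (M : ℝ) (hM : 0 < M) (U : Set (ℝ × ℝ)) (hU : IsOpen U) (k : PointKind)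
    (r₀ : ℝ → ℝ → ℝ) (hr₀ : IsDistinguished M U r₀ k)
    (z : State) (hz : z ∈ domain M U k r₀) :
    -- the integrals converge (as a finite part in one case), and the conserved quantity that
    -- defines the generator is twice differentiable near z
    (IntervalIntegrable
        (fun y => 1 / radialSpeed M (Real.sign (z 5)) (energy M z) (angMom z) y)
        MeasureTheory.volume (r₀ (energy M z) (angMom z)) (z 2) ∧
      IntervalIntegrable
        (fun y => 1 / (y ^ 2 * radialSpeed M (Real.sign (z 5)) (energy M z) (angMom z) y))
        MeasureTheory.volume (r₀ (energy M z) (angMom z)) (z 2) ∧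
      (k ≠ PointKind.horizon → IntervalIntegrable
        (fun y => y / ((y - 2 * M) *
          radialSpeed M (Real.sign (z 5)) (energy M z) (angMom z) y))
        MeasureTheory.volume (r₀ (energy M z) (angMom z)) (z 2)) ∧
      (k = PointKind.horizon → Tendsto
        (fun δ => (∫ y in (2 * M + δ)..(z 2), y / ((y - 2 * M) *
            radialSpeed M (Real.sign (z 5)) (energy M z) (angMom z) y)) +
          horizonResidue M (Real.sign (z 5)) (energy M z) (angMom z) * Real.log (δ / (2 * M)))
        (𝓝[>] 0)
        (𝓝 (timeIntegral M (Real.sign (z 5)) (energy M z) (angMom z) (2 * M) (z 2)))) ∧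
      ContDiffAt ℝ 2 (lrlProperTime M r₀) z) ∧
    -- the explicit transformations form a local one-parameter group
    (IsOpen (paramSet M U k r₀ z) ∧ (paramSet M U k r₀ z).OrdConnected ∧
      (0 : ℝ) ∈ paramSet M U k r₀ z ∧
      properTimeTransform M k r₀ 0 z = z ∧
      (∀ ε ∈ paramSet M U k r₀ z, properTimeTransform M k r₀ ε z ∈ domain M U k r₀) ∧
      (∀ ε ∈ paramSet M U k r₀ z,
        ∀ η ∈ paramSet M U k r₀ (properTimeTransform M k r₀ ε z),
          ε + η ∈ paramSet M U k r₀ z ∧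
          properTimeTransform M k r₀ η (properTimeTransform M k r₀ ε z) =
            properTimeTransform M k r₀ (ε + η) z)) ∧
    -- it is generated by the symmetry that corresponds to the LRL proper time
    (∀ ε ∈ paramSet M U k r₀ z,
      HasDerivAt (fun x => properTimeTransform M k r₀ x z)
        (gaugedGenerator M (lrlProperTime M r₀) (properTimeTransform M k r₀ ε z)) ε) ∧
    (∀ (J : Set ℝ) (γ : ℝ → State), J.OrdConnected → (0 : ℝ) ∈ J → γ 0 = z →
      (∀ ε ∈ J, γ ε ∈ domain M U k r₀ ∧
        HasDerivWithinAt γ (gaugedGenerator M (lrlProperTime M r₀) (γ ε)) J ε) →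
      ∀ ε ∈ J, ε ∈ paramSet M U k r₀ z ∧ γ ε = properTimeTransform M k r₀ ε z) ∧
    -- it maps geodesics to geodesics
    (∀ γ : ℝ → State, γ 0 = z → (∀ᶠ x in 𝓝 0, HasDerivAt γ (geodesicField M (γ x)) x) →
      ∀ ε ∈ paramSet M U k r₀ z,
        HasDerivAt (fun x => properTimeTransform M k r₀ ε (γ x))
          ((z 5 / properTimeTransform M k r₀ ε z 5) •
            geodesicField M (properTimeTransform M k r₀ ε z)) 0) ∧
    -- the action on the constants of motion and on the distinguished point
    (∀ ε ∈ paramSet M U k r₀ z,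
      energy M (properTimeTransform M k r₀ ε z) = energy M z * Real.exp ε ∧
      angMom (properTimeTransform M k r₀ ε z) = angMom z * Real.exp ε ∧
      energy M z ≠ 0 ∧
      angMom (properTimeTransform M k r₀ ε z) / energy M (properTimeTransform M k r₀ ε z) =
        angMom z / energy M z ∧
      lrlProperTime M r₀ (properTimeTransform M k r₀ ε z) = lrlProperTime M r₀ z ∧
      (k = PointKind.turning ∨ k = PointKind.horizon →
        lrlAngle M r₀ (properTimeTransform M k r₀ ε z) = lrlAngle M r₀ z ∧
        lrlTime M r₀ (properTimeTransform M k r₀ ε z) = lrlTime M r₀ z) ∧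
      (k = PointKind.horizon →
        r₀ (energy M z * Real.exp ε) (angMom z * Real.exp ε) = r₀ (energy M z) (angMom z)) ∧
      (k = PointKind.turning →
        2 * M < r₀ (energy M z * Real.exp ε) (angMom z * Real.exp ε) ∧
        (energy M z ^ 2 * Real.exp (2 * ε) - 1) *
            r₀ (energy M z * Real.exp ε) (angMom z * Real.exp ε) ^ 3 +
          2 * M * r₀ (energy M z * Real.exp ε) (angMom z * Real.exp ε) ^ 2 -
          angMom z ^ 2 * Real.exp (2 * ε) *
            r₀ (energy M z * Real.exp ε) (angMom z * Real.exp ε) +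
          2 * M * angMom z ^ 2 * Real.exp (2 * ε) = 0) ∧
      (k = PointKind.centripetal →
        IntervalIntegrable (fun x => cAngle M (Real.sign (z 5)) r₀
          (energy M z * Real.exp x) (angMom z * Real.exp x)) MeasureTheory.volume 0 ε ∧
        IntervalIntegrable (fun x => cTime M (Real.sign (z 5)) r₀
          (energy M z * Real.exp x) (angMom z * Real.exp x)) MeasureTheory.volume 0 ε ∧
        lrlAngle M r₀ (properTimeTransform M k r₀ ε z) = lrlAngle M r₀ z +
          ∫ x in (0 : ℝ)..ε, cAngle M (Real.sign (z 5)) r₀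
            (energy M z * Real.exp x) (angMom z * Real.exp x) ∧
        lrlTime M r₀ (properTimeTransform M k r₀ ε z) = lrlTime M r₀ z +
          ∫ x in (0 : ℝ)..ε, cTime M (Real.sign (z 5)) r₀
            (energy M z * Real.exp x) (angMom z * Real.exp x))) ∧
    (k = PointKind.centripetal → ∃ s : ℝ, (s = 1 ∨ s = -1) ∧ ∀ ε ∈ paramSet M U k r₀ z,
      12 * M ^ 2 < (angMom z * Real.exp ε) ^ 2 ∧
      r₀ (energy M z * Real.exp ε) (angMom z * Real.exp ε) =
        (2 * M)⁻¹ * (angMom z * Real.exp ε) * (angMom z * Real.exp ε +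
          s * √((angMom z * Real.exp ε) ^ 2 - 12 * M ^ 2))) := by
  have hs := sign_eq_one_or (velocity_ne_zero hM hz)
  refine ⟨⟨intervalIntegrable_properTime hM hr₀ hz.2 hs, intervalIntegrable_angle hM hr₀ hz.2 hs,
    fun hk => intervalIntegrable_time hM hk hr₀ hz.2 hs, ?_,
    contDiffAt_lrlProperTime hM hU hr₀ (mem_smoothStates hM hz)⟩,
    ⟨isOpen_paramSet hM hU hr₀ z, ordConnected_paramSet z, zero_mem_paramSet hz,
      transform_zero hM hz, fun ε hε => transform_mem_domain hM hz hε,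
      fun ε hε η hη => ⟨add_mem_paramSet hM hz hε hη,
        transform_transform hM hU hr₀ hz hε (add_mem_paramSet hM hz hε hη)⟩⟩,
    fun ε hε => ?_, fun J γ hJ h0 hγ h ε hε => ?_,
    fun γ hγ h ε hε => hasDerivAt_transform_geodesic hM hU hr₀ hz hγ h hε,
    fun ε hε => ⟨energy_transform hM hz ε, angMom_transform hM hz ε,
      hz.2.energy_ne_zero hM, ?_, lrlProperTime_transform hM hz hε, ?_, ?_, ?_, ?_⟩, ?_⟩
  · rintro rfl
    exact tendsto_timeIntegral_horizon hM hr₀ hz.2 hs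
  · rw [gaugedGenerator_lrlProperTime hM hU hr₀ (transform_mem_domain hM hz hε)]
    exact hasDerivAt_transform hM hU hr₀ hz hε
  · refine eq_transform_of_integralCurve hM hU hr₀ hJ h0 hγ (fun x hx => ⟨(h x hx).1, ?_⟩) hε
    rw [← gaugedGenerator_lrlProperTime hM hU hr₀ (h x hx).1]
    exact (h x hx).2
  · rw [energy_transform hM hz, angMom_transform hM hz,
      mul_div_mul_right _ _ (Real.exp_pos ε).ne']
  · rw [lrlAngle_transform hM hz hε, lrlTime_transform hM hz hε]
    rintro (rfl | rfl) <;> exact ⟨rfl, rfl⟩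
  · rintro rfl
    rw [hr₀ _ _ (regular_of_mem_paramSet hε).2.1, hr₀ _ _ hz.2.2.1]
  · rintro rfl
    exact turning_root hr₀ hε
  · rintro rfl
    obtain ⟨hA, hT⟩ := continuousOn_rates (z := z) hM hU hr₀ hs
    have hsub := mem_paramSet_iff.1 hε
    exact ⟨(hA.mono hsub).intervalIntegrable, (hT.mono hsub).intervalIntegrable,
      lrlAngle_transform hM hz hε, lrlTime_transform hM hz hε⟩
  · rintro rfl
    exact exists_sign_centripetal hM hU hr₀ hz
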